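/- Let $\mathcal A$ be a von Neumann algebra on a complex Hilbert space $\mathcal H$ and let $\Omega\in\mathcal H$ be a unit vector that is cyclic and separating for $\mathcal A$, so that $(\mathcal A,\Omega)$ is the GNS representation of the faithful normal state $\psi(a)=\langle\Omega,a\Omega\rangle$. Inner products are linear in the second entry. Let $S$ be the Tomita operator, i.e. the closure of $a\Omega\mapsto a^\dagger\Omega$ $(a\in\mathcal A)$, let $\Delta=S^\dagger S$ be the modular operator, $\hat K=-\log\Delta$ the modular Hamiltonian, and let $a_\psi(t)=\Delta^{it}a\Delta^{-it}$ be the modular flow. For $a,b\in\mathcal A$ put $$f_{ab}(t)=\langle a\Omega,\Delta^{1/2+it}\,b\Omega\rangle ,\qquad t\in\mathbb R .$$ Say that $f_{ab}$ clusters if $f_{ab}(t)-\overline{\psi(a)}\,\psi(b)\to 0$ both as $t\to\infty$ and as $t\to-\infty$. An operator $a\in\mathcal A$ is called ($\psi$-)mixing if $f_{aa}$ clusters; let $\mathcal S_\psi\subset\mathcal A$ be the set of all mixing operators. An eigenoperator of $\hat K$ is an operator $v\in\mathcal A$ for which $v\Omega$ lies in the domain of $\hat K$ and $(\hat K-\lambda)v\Omega=0$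 for some $\lambda\in\mathbb R$. Then $\mathcal S_\psi$ is an operator system (a norm-closed, $\dagger$-closed linear subspace containing $1$), $f_{ab}$ clusters for all $a,b\in\mathcal S_\psi$, and the following hold. 1. If $a\in\mathcal S_\psi$ then $a_\psi(t)\in\mathcal S_\psi$ for all $t\in\mathbb R$. 2. Let $z\in\mathbb C$ with $|\operatorname{Im}z|<1/2$ (in particular, $\operatorname{Im}z\in[0,1/2)$). (a) If $a\in\mathcal S_\psi$ and the modular flow of $a$ continues analytically to the operator $a_\psi(z)$, then $a_\psi(z)\in\mathcal S_\psi$. Here continuation means that there is an $\mathcal A$-valued function $F$ on the closed horizontal strip between $\mathbb R$ and the line through $z$, continuous on the strip and analytic in its interior for the weak operator topology, with $F(t)=a_\psi(t)$ for $t\in\mathbb R$ and $F(z)=a_\psi(z)$. (b) For all $a,b\in\mathcal S_\psi$ the correlator $f_{ab}$ extends analytically to the strip $|\operatorname{Im}w|<1/2$, and the correlator of $a$ with $b$ evolved to complex time $z$, i.e. $s\mapsto f_{ab}(s+z)$, clusters: $f_{ab}(s+z)\to\overline{\psi(a)}\,\psi(b)$ as $s\to\pm\infty$. 3. $\mathcal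 S_\psi$ contains no operator, other than scalar multiples of the identity, that is a countable sum of eigenoperators of $\hat K$: if $a\in\mathcal S_\psi$ and $v_0,v_1,\dots$ are eigenoperators with $\sum_{k<n}v_k\Omega\to a\Omega$ weakly as $n\to\infty$ (which holds in particular if $\sum_k v_k=a$ in the weak, strong or norm topology), then $a\in\mathbb C1$. In particular, consider the KMS case: let $\mathcal K$ be a Hilbert space with an orthonormal basis of energy eigenvectors $|E_n\rangle$ of a Hamiltonian with energies $E_n\in\mathbb R$, let $\beta>0$ with $\sum_n e^{-\beta E_n}<\infty$, and let $(\mathcal A,\Omega)$ be the GNS representation, through a $*$-homomorphism $\pi$ from $B(\mathcal K)$ onto $\mathcal A$, of the thermal state, i.e. $\langle\Omega,\pi(x)\Omega\rangle=\sum_n e^{-\beta E_n}\langle E_n|x|E_n\rangle\big/\sum_n e^{-\beta E_n}$. If $x\in B(\mathcal K)$ is a countable sum $x=\sum_k\alpha_k|E_{m_k}\rangle\langle E_{n_k}|$ with $\alpha_k\in\mathbb C$, convergent in the weak operator topology, and $\pi(x)\in\mathcal S_\psi$, then $x\in\mathbb C1$. -/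

import Mathlib

open Filter Topology
open scoped InnerProductSpace ComplexConjugate

/-!
Modular theory of a von Neumann algebra `A` on a Hilbert space `H` with a vector `Ω`
(cyclic and separating in the applications). Inner products are linear in the second entry.
-/

section Modular

variable {H : Type*} [NormedAddCommGroup H] [InnerProductSpace ℂ H] [CompleteSpace H]

/-- `Ω` is a unit vector which is cyclic and separating for `A`: the pair `(A, Ω)` is the
GNS representation of the faithful normal state `a ↦ ⟪Ω, a Ω⟫`. -/
structure IsStandardVector (A : VonNeumannAlgebra H) (Ω : H) : Prop where
  norm_eq_one : ‖Ω‖ = 1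
  cyclic : Dense {ξ : H | ∃ a ∈ A, a Ω = ξ}
  separating : ∀ a ∈ A, a Ω = 0 → a = 0

/-- The graph of the Tomita operator `S`: the closure of the conjugate-linear
operator `a Ω ↦ a† Ω`, `a ∈ A`. -/
def tomitaGraph (A : VonNeumannAlgebra H) (Ω : H) : Set (H × H) :=
  closure {p | ∃ a ∈ A, p = (a Ω, star a Ω)}

/-- `IsModularImage A Ω ξ ζ` says that `ξ` lies in the domain of the modular operator
`Δ = S† S` and `Δ ξ = ζ`. The adjoint of the conjugate-linear operator `S` is given by
`S† η = ζ` iff `⟪ζ, x⟫ = ⟪S x, η⟫` for all `x` in the domain of `S`. -/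
def IsModularImage (A : VonNeumannAlgebra H) (Ω ξ ζ : H) : Prop :=
  ∃ η : H, (ξ, η) ∈ tomitaGraph A Ω ∧ ∀ p ∈ tomitaGraph A Ω, ⟪ζ, p.1⟫_ℂ = ⟪p.2, η⟫_ℂ

/-- The closure of `a Ω ↦ a† Ω` has a graph which is a real subspace. -/
lemma tomitaGraph_submodule (A : VonNeumannAlgebra H) (Ω : H) :
    ∃ G : Submodule ℝ (H × H), (G : Set (H × H)) = tomitaGraph A Ω := by
  let G₀ : Submodule ℝ (H × H) :=
    { carrier := {p | ∃ a ∈ A, p = (a Ω, star a Ω)}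
      add_mem' := by
        rintro _ _ ⟨a, ha, rfl⟩ ⟨b, hb, rfl⟩
        exact ⟨a + b, add_mem ha hb, by simp [star_add]⟩
      zero_mem' := ⟨0, zero_mem A, by simp; rfl⟩
      smul_mem' := by
        rintro r _ ⟨a, ha, rfl⟩
        refine ⟨(r : ℂ) • a, A.toStarSubalgebra.smul_mem ha (r : ℂ), ?_⟩
        simp [star_smul] }
  exact ⟨G₀.topologicalClosure, rfl⟩

/-- The graph of `S` is invariant under `(x, y) ↦ (i x, -i y)`. -/
lemma tomitaGraph_smul_I (A : VonNeumannAlgebra H) (Ω : H) (p : H × H)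
    (hp : p ∈ tomitaGraph A Ω) : (Complex.I • p.1, -(Complex.I • p.2)) ∈ tomitaGraph A Ω := by
  have hc : Continuous (fun p : H × H => (Complex.I • p.1, -(Complex.I • p.2))) := by fun_prop
  refine map_mem_closure (f := fun p : H × H => (Complex.I • p.1, -(Complex.I • p.2)))
    hc hp ?_
  rintro _ ⟨a, ha, rfl⟩
  refine ⟨Complex.I • a, A.toStarSubalgebra.smul_mem ha _, ?_⟩
  simp [star_smul]

lemma exists_modularResolvent (A : VonNeumannAlgebra H) (Ω : H) :
    ∃! T : H →L[ℂ] H, ∀ ξ : H, IsModularImage A Ω (T ξ) (ξ - T ξ) := by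
  obtain ⟨G, hG⟩ := tomitaGraph_submodule A Ω
  have hGmem : ∀ p, p ∈ tomitaGraph A Ω ↔ p ∈ G := fun p => by rw [← hG]; rfl
  have key : ∀ T T' : H, ∀ ξ, IsModularImage A Ω T (ξ - T) → IsModularImage A Ω T' (ξ - T') →
      T = T' := by
    rintro T T' ξ ⟨η, h1, h2⟩ ⟨η', h1', h2'⟩
    have hm : (T - T', η - η') ∈ tomitaGraph A Ω := by
      rw [hGmem] at h1 h1' ⊢
      exact G.sub_mem h1 h1'
    have e1 := h2 _ hm
    have e2 := h2' _ hm
    have e3 : ⟪(ξ - T) - (ξ - T'), T - T'⟫_ℂ = ⟪η - η', η - η'⟫_ℂ := by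
      rw [inner_sub_left, e1, e2, inner_sub_right]
    have e4 : (ξ - T) - (ξ - T') = -(T - T') := by abel
    rw [e4, inner_neg_left, inner_self_eq_norm_sq_to_K, inner_self_eq_norm_sq_to_K] at e3
    have e5 : -(‖T - T'‖ ^ 2) = ‖η - η'‖ ^ 2 := by exact_mod_cast e3
    have e6 : ‖T - T'‖ ^ 2 = 0 := by nlinarith [sq_nonneg ‖T - T'‖, sq_nonneg ‖η - η'‖]
    exact sub_eq_zero.1 (norm_eq_zero.1 (by simpa using e6))
  have bound : ∀ T ξ, IsModularImage A Ω T (ξ - T) → ‖T‖ ≤ ‖ξ‖ := by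
    rintro T ξ ⟨η, h1, h2⟩
    have e := h2 _ h1
    simp only [inner_sub_left, inner_self_eq_norm_sq_to_K] at e
    have e' : (⟪ξ, T⟫_ℂ) = ((‖T‖ ^ 2 + ‖η‖ ^ 2 : ℝ) : ℂ) := by
      push_cast
      linear_combination e
    have h3 : ‖T‖ ^ 2 + ‖η‖ ^ 2 ≤ ‖ξ‖ * ‖T‖ := by
      have := norm_inner_le_norm (𝕜 := ℂ) ξ T
      rw [e', Complex.norm_real, Real.norm_of_nonneg (by positivity)] at this
      exact this
    by_contra! hlt
    nlinarith [norm_nonneg T, norm_nonneg ξ, sq_nonneg ‖η‖]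
  have ex : ∀ ξ : H, ∃ T, IsModularImage A Ω T (ξ - T) := by
    intro ξ
    let : InnerProductSpace ℝ H := InnerProductSpace.rclikeToReal ℂ H
    let e := WithLp.prodContinuousLinearEquiv 2 ℝ H H
    let G' : @Submodule ℝ (WithLp 2 (H × H)) _ _ InnerProductSpace.toNormedSpace.toModule :=
      { carrier := {v | e v ∈ G}
        add_mem' := fun {u v} hu hv => G.add_mem hu hv
        zero_mem' := G.zero_mem
        smul_mem' := fun r v hv => G.smul_mem r hv }
    have hcl : IsClosed (G' : Set (WithLp 2 (H × H))) := by
      have : IsClosed (G : Set (H × H)) := by rw [hG]; exact isClosed_closure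
      exact this.preimage e.continuous
    have : CompleteSpace G' := hcl.completeSpace_coe
    obtain ⟨g, hg, hperp⟩ :=
      Submodule.HasOrthogonalProjection.exists_orthogonal (𝕜 := ℝ) (K := G') (WithLp.toLp 2 (ξ, (0 : H)))
    have hre : ∀ p ∈ tomitaGraph A Ω, (⟪ξ - g.fst, p.1⟫_ℂ).re = (⟪p.2, g.snd⟫_ℂ).re := by
      intro p hp
      have hp' : WithLp.toLp 2 p ∈ G' := (hGmem p).1 hp
      have h := hperp _ hp'
      rw [WithLp.prod_inner_apply] at h
      have h' : (⟪p.1, ξ - g.fst⟫_ℂ).re + (⟪p.2, 0 - g.snd⟫_ℂ).re = 0 := h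
      rw [zero_sub, inner_neg_right, Complex.neg_re] at h'
      have h2 : (⟪ξ - g.fst, p.1⟫_ℂ).re = (⟪p.1, ξ - g.fst⟫_ℂ).re := by
        exact inner_re_symm (𝕜 := ℂ) (ξ - g.fst) p.1
      rw [h2]
      linarith
    refine ⟨g.fst, g.snd, (hGmem _).2 hg, fun p hp => ?_⟩
    apply Complex.ext
    · exact hre p hp
    · have h := hre _ (tomitaGraph_smul_I A Ω p hp)
      simp only [inner_smul_right, inner_neg_left, inner_smul_left, Complex.conj_I,
        Complex.mul_re, Complex.I_re, Complex.I_im, Complex.neg_re, Complex.neg_im] at h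
      linarith
  choose T hT using ex
  have hsmul : ∀ (c : ℂ) T ξ, IsModularImage A Ω T ξ → IsModularImage A Ω (c • T) (c • ξ) := by
    rintro c T ξ ⟨η, h1, h2⟩
    refine ⟨conj c • η, ?_, fun p hp => ?_⟩
    · have hI := (hGmem _).1 (tomitaGraph_smul_I A Ω _ h1)
      have := G.add_mem (G.smul_mem c.re ((hGmem _).1 h1)) (G.smul_mem c.im hI)
      rw [hGmem]
      convert this using 1
      have hc : c = c.re + c.im * Complex.I := (Complex.re_add_im c).symm
      ext
      · simp only [Prod.fst_add, Prod.smul_fst]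
        conv_lhs => rw [hc]
        rw [add_smul, mul_smul]
        simp
      · simp only [Prod.snd_add, Prod.smul_snd]
        conv_lhs => rw [hc]
        rw [map_add, map_mul, Complex.conj_I, Complex.conj_ofReal, Complex.conj_ofReal,
          add_smul, mul_smul]
        simp
    · rw [inner_smul_left, inner_smul_right, h2 p hp]
  have hadd : ∀ T T' ξ ξ', IsModularImage A Ω T ξ → IsModularImage A Ω T' ξ' →
      IsModularImage A Ω (T + T') (ξ + ξ') := by
    rintro T T' ξ ξ' ⟨η, h1, h2⟩ ⟨η', h1', h2'⟩
    refine ⟨η + η', ?_, fun p hp => ?_⟩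
    · rw [hGmem] at h1 h1' ⊢
      exact G.add_mem h1 h1'
    · rw [inner_add_left, inner_add_right, h2 p hp, h2' p hp]
  let L : H →ₗ[ℂ] H :=
    { toFun := T
      map_add' := fun x y => by
        apply key _ _ (x + y) (hT _)
        have := hadd _ _ _ _ (hT x) (hT y)
        convert this using 1
        abel
      map_smul' := fun c x => by
        apply key _ _ (c • x) (hT _)
        have := hsmul c _ _ (hT x)
        rw [smul_sub] at this
        exact this }
  refine ⟨L.mkContinuous 1 (fun x => by
    rw [one_mul]
    exact bound _ _ (hT x)), fun ξ => hT ξ, ?_⟩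
  intro T' hT'
  ext ξ
  exact key _ _ ξ (hT' ξ) (hT ξ)

/-- The bounded operator `(1 + Δ)⁻¹`. -/
noncomputable def modularResolvent (A : VonNeumannAlgebra H) (Ω : H) : H →L[ℂ] H :=
  (exists_modularResolvent A Ω).choose

/-- `(1 + Δ)⁻¹` is the unique operator `T` with `Δ (T ξ) = ξ - T ξ` for all `ξ`. -/
theorem modularResolvent_spec (A : VonNeumannAlgebra H) (Ω : H) (ξ : H) :
    IsModularImage A Ω (modularResolvent A Ω ξ) (ξ - modularResolvent A Ω ξ) :=
  (exists_modularResolvent A Ω).choose_spec.1 ξ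

/-- `φ(Δ)` for a continuous function `φ` with compact support in `(0, ∞)`: since
`Δ = (1 - T) / T` with `T = (1 + Δ)⁻¹`, this is the continuous function
`x ↦ φ ((1 - x) / x)` of the bounded self-adjoint operator `T`. -/
noncomputable def modularCc (A : VonNeumannAlgebra H) (Ω : H) (φ : ℝ → ℂ) : H →L[ℂ] H :=
  cfc (fun w : ℂ => φ ((1 - w.re) / w.re)) (modularResolvent A Ω)

/-- `IsModularFun A Ω h ξ η` says that `ξ` lies in the domain of the (possibly unbounded)
operator `h(Δ)` and `h(Δ) ξ = η`, where `h` is continuous on `(0, ∞)`: for all continuous `φ`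
with compact support in `(0, ∞)` one has `(φ h)(Δ) ξ = φ(Δ) η`. -/
def IsModularFun (A : VonNeumannAlgebra H) (Ω : H) (h : ℝ → ℂ) (ξ η : H) : Prop :=
  ∀ φ : ℝ → ℂ, Continuous φ → HasCompactSupport φ → tsupport φ ⊆ Set.Ioi 0 →
    modularCc A Ω (fun x => φ x * h x) ξ = modularCc A Ω φ η

/-- `Δ ^ z ξ = η` (in particular, `ξ` lies in the domain of `Δ ^ z`). -/
def IsModularPow (A : VonNeumannAlgebra H) (Ω : H) (z : ℂ) (ξ η : H) : Prop :=
  IsModularFun A Ω (fun x => (x : ℂ) ^ z) ξ η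

/-- `K ξ = η` for the modular Hamiltonian `K = -log Δ`. -/
def IsModularHamiltonian (A : VonNeumannAlgebra H) (Ω : H) (ξ η : H) : Prop :=
  IsModularFun A Ω (fun x => ((-Real.log x : ℝ) : ℂ)) ξ η

/-- The one-point function `ψ(a) = ⟪Ω, a Ω⟫`. -/
noncomputable def vacuumState (Ω : H) (a : H →L[ℂ] H) : ℂ := ⟪Ω, a Ω⟫_ℂ

/-- The modular two-point function: `f_{ab}(t) = ⟪a Ω, Δ ^ (1/2 + i t) b Ω⟫` equals `c`. -/
def IsModularCorrelator (A : VonNeumannAlgebra H) (Ω : H) (a b : H →L[ℂ] H) (t : ℝ) (c : ℂ) :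
    Prop :=
  ∃ η : H, IsModularPow A Ω (1 / 2 + Complex.I * t) (b Ω) η ∧ c = ⟪a Ω, η⟫_ℂ

/-- The correlator `f_{ab}` clusters in modular time: its connected part
`f_{ab}(t) - conj ψ(a) * ψ(b)` tends to `0` both in the future and in the past. -/
def ClustersInModularTime (A : VonNeumannAlgebra H) (Ω : H) (a b : H →L[ℂ] H) : Prop :=
  ∃ f : ℝ → ℂ, (∀ t, IsModularCorrelator A Ω a b t (f t)) ∧
    Tendsto (fun t => f t - conj (vacuumState Ω a) * vacuumState Ω b) atTop (𝓝 0) ∧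
    Tendsto (fun t => f t - conj (vacuumState Ω a) * vacuumState Ω b) atBot (𝓝 0)

/-- The set of all mixing operators of `A` in the state given by `Ω`. -/
def maximalMixingSystem (A : VonNeumannAlgebra H) (Ω : H) : Set (H →L[ℂ] H) :=
  {a | a ∈ A ∧ ClustersInModularTime A Ω a a}

/-- An operator system: a norm-closed, adjoint-closed linear subspace of the bounded operators
that contains the identity. -/
structure IsOperatorSystem (S : Set (H →L[ℂ] H)) : Prop where
  one_mem : 1 ∈ S
  add_mem : ∀ a ∈ S, ∀ b ∈ S, a + b ∈ S
  smul_mem : ∀ (c : ℂ), ∀ a ∈ S, c • a ∈ S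
  star_mem : ∀ a ∈ S, star a ∈ S
  isClosed : IsClosed S

/-- `b` is the modular flowed operator `a_ψ(t) = Δ ^ (i t) a Δ ^ (- i t)`. -/
def IsModularFlow (A : VonNeumannAlgebra H) (Ω : H) (t : ℝ) (a b : H →L[ℂ] H) : Prop :=
  ∀ ξ : H, ∃ η : H, IsModularPow A Ω (-(Complex.I * t)) ξ η ∧
    IsModularPow A Ω (Complex.I * t) (a η) (b ξ)

/-- `b` is the analytic continuation `a_ψ(z)` of the modular flow of `a` to the complex time `z`:
`b = F z` for an `A`-valued function `F` on the closed horizontal strip between the real line and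
the line through `z` which is weakly continuous, weakly analytic in the interior of the strip,
and coincides with the modular flow of `a` on the real line. -/
def IsComplexModularFlow (A : VonNeumannAlgebra H) (Ω : H) (z : ℂ) (a b : H →L[ℂ] H) : Prop :=
  ∃ F : ℂ → H →L[ℂ] H,
    (∀ w : ℂ, w.im ∈ Set.uIcc 0 z.im → F w ∈ A) ∧
    (∀ ξ η : H, ContinuousOn (fun w => ⟪ξ, F w η⟫_ℂ) {w | w.im ∈ Set.uIcc 0 z.im}) ∧
    (∀ ξ η : H, DifferentiableOn ℂ (fun w => ⟪ξ, F w η⟫_ℂ) {w | w.im ∈ Set.uIoo 0 z.im}) ∧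
    (∀ t : ℝ, IsModularFlow A Ω t a (F t)) ∧
    F z = b

/-- `v ∈ A` is an eigenoperator of the modular Hamiltonian with eigenvalue `l`:
`(K - l) v Ω = 0`. -/
def IsModularEigenoperator (A : VonNeumannAlgebra H) (Ω : H) (l : ℝ) (v : H →L[ℂ] H) : Prop :=
  v ∈ A ∧ IsModularHamiltonian A Ω (v Ω) ((l : ℂ) • v Ω)

/-- `(A, Ω)` is, through the representation `π`, the GNS representation of the thermal (KMS) state
`x ↦ Tr (e ^ (-β h) x) / Tr (e ^ (-β h))` on the algebra of all bounded operators on a Hilbert space `K`,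
where `h` is the Hamiltonian with an orthonormal basis `e` of energy eigenvectors with
energies `E`. -/
structure IsThermalRepresentation (A : VonNeumannAlgebra H) (Ω : H)
    {K : Type*} [NormedAddCommGroup K] [InnerProductSpace ℂ K] [CompleteSpace K]
    {ι : Type*} (e : HilbertBasis ι ℂ K) (E : ι → ℝ) (β : ℝ)
    (π : (K →L[ℂ] K) →⋆ₐ[ℂ] (H →L[ℂ] H)) : Prop where
  beta_pos : 0 < β
  summable_boltzmann : Summable fun n => Real.exp (-β * E n)
  range_eq : Set.range π = (A : Set (H →L[ℂ] H))
  state_eq : ∀ x : K →L[ℂ] K, vacuumState Ω (π x) =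
    (∑' n, (Real.exp (-β * E n) : ℂ) * ⟪e n, x (e n)⟫_ℂ) / (∑' n, (Real.exp (-β * E n) : ℂ))

end Modular

/-! Write `U t = Δ^{it}`. Since `Ω` is fixed by every power of `Δ`, the connected part of `f_ab(t)`
is `⟪aΩ, U t Δ^{1/2} (b - ψ(b))Ω⟫`. Mixing of `a` is therefore a property of the single vector `ξ =
(a - ψ(a))Ω`. With `ξ₁ = Δ^{1/4} ξ` it says that the autocorrelation `⟪ξ₁, U t ξ₁⟫` decays. The
vectors decorrelated from the orbit of `ξ₁` form a closed subspace that contains the orbit and the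
orthogonal complement of that subspace, hence everything: `U t ξ₁` tends weakly to zero
(`mem_mixingSubspace_of_self`). Weak decay passes from a vector to its image under any continuous
function of `Δ` (`IsModularFun.mem_mixingSubspace`), so it passes from `ξ₁` back to `ξ`. Thus `a` is
mixing exactly when `ξ` lies in the closed subspace `mixingSubspace`
(`mem_maximalMixingSystem_iff`).

Linearity, norm-closedness and clustering of pairs are now immediate. Adjoints and real-time
evolution also need that the flow preserves `A`, which is Tomita's theorem (`modularFlow_mem`). It
is proved from the definitions: `S` is the adjoint of the Tomita operator `F` of the commutant
(`mem_tomitaGraph_iff`), so that `Δ = F S`. The resolvent `(λ + Δ)⁻¹` maps `A'Ω` into `AΩ`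
(`IsStandardVector.exists_resolvent_mem`). If `(e^s + Δ) kΩ = aΩ` with `a ∈ A'`, then formally `a =
e^s Δ^{-1/2} m Δ^{1/2} + Δ^{1/2} m Δ^{-1/2}` with `m = J k* J`. A Poisson formula on a strip turns
this into an expression of `m` as the Fourier coefficient at `s` of the flow of `a`, weighted by `1
/ cosh(π t)` (`integral_modularUnitary_commutant`). All these coefficients commute with `J A' J`,
hence so does the flow of `a`.

At complex times, uniqueness of analytic continuation gives `a_ψ(z)Ω = Δ^{iz} aΩ`, again a function
of `Δ` applied to `aΩ`. Correlators continue to the strip because `aΩ` and `bΩ` lie in the domain of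
`1 + Δ^{1/2}`, and `x^{1/2+iw} / (1 + √x)²` is bounded for `|Im w| ≤ 1/2`.

If `v` is an eigenvector of the modular Hamiltonian, `|⟪v, U t w⟫|` is constant in `t`, so mixing
vectors are orthogonal to `v`. A mixing `a` which is a sum of eigenoperators has `ξ ⊥ aΩ` and `ξ ⊥
Ω`, so `ξ = 0` and `a` is scalar. In the thermal case the operators `|E_m⟩⟨E_n|` are eigenoperators
by the KMS relation, and weak convergence on the energy space carries over to vectors in `H`. -/

/-! ### The Tomita operators of the algebra and its commutant, and the resolvent of `Δ` -/

section TomitaGraph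

variable {H : Type*} [NormedAddCommGroup H] [InnerProductSpace ℂ H] [CompleteSpace H]

lemma ContinuousLinearMap.inner_star_apply (a : H →L[ℂ] H) (x y : H) :
    ⟪star a x, y⟫_ℂ = ⟪x, a y⟫_ℂ := by
  rw [ContinuousLinearMap.star_eq_adjoint, ContinuousLinearMap.adjoint_inner_left]

lemma ContinuousLinearMap.inner_apply_star (a : H →L[ℂ] H) (x y : H) :
    ⟪x, star a y⟫_ℂ = ⟪a x, y⟫_ℂ := by
  rw [ContinuousLinearMap.star_eq_adjoint, ContinuousLinearMap.adjoint_inner_right]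

lemma VonNeumannAlgebra.smul_mem (A : VonNeumannAlgebra H) (c : ℂ) {a : H →L[ℂ] H} (ha : a ∈ A) :
    c • a ∈ A := A.toStarSubalgebra.smul_mem ha c

lemma VonNeumannAlgebra.commute_apply {A : VonNeumannAlgebra H} {a b : H →L[ℂ] H} (ha : a ∈ A)
    (hb : b ∈ A.commutant) (x : H) : a (b x) = b (a x) :=
  DFunLike.congr_fun (VonNeumannAlgebra.mem_commutant_iff.1 hb a ha) x

lemma VonNeumannAlgebra.mem_of_commute {A : VonNeumannAlgebra H} {a : H →L[ℂ] H}
    (h : ∀ b ∈ A.commutant, ∀ x, b (a x) = a (b x)) : a ∈ A := by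
  rw [← A.commutant_commutant, VonNeumannAlgebra.mem_commutant_iff]
  intro b hb
  ext x
  exact h b hb x

/-- The projection onto the cyclic subspace of `(u, v)` for the diagonal action of `A` on `H ⊕ H`,
in terms of its matrix entries, which lie in the commutant. -/
lemma VonNeumannAlgebra.exists_cyclic_projection_entries (A : VonNeumannAlgebra H) (u v : H) :
    ∃ p ∈ A.commutant, ∃ q ∈ A.commutant, p u + q v = u ∧
      (∀ x y : H, (∀ a ∈ A, ⟪x, a u⟫_ℂ + ⟪y, a v⟫_ℂ = 0) → p x + q y = 0) ∧
      ∀ x : H, 0 ≤ (⟪x, p x⟫_ℂ).re ∧ ‖x - p x‖ ^ 2 ≤ (⟪x, x - p x⟫_ℂ).re := by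
  let N₀ : Submodule ℂ (WithLp 2 (H × H)) :=
    { carrier := {w | ∃ a ∈ A, w = WithLp.toLp 2 (a u, a v)}
      add_mem' := by
        rintro _ _ ⟨a, ha, rfl⟩ ⟨b, hb, rfl⟩
        exact ⟨a + b, add_mem ha hb, rfl⟩
      zero_mem' := ⟨0, zero_mem A, rfl⟩
      smul_mem' := by
        rintro c _ ⟨a, ha, rfl⟩
        exact ⟨c • a, A.smul_mem c ha, rfl⟩ }
  let N := N₀.topologicalClosure
  have : CompleteSpace N := N₀.isClosed_topologicalClosure.completeSpace_coe
  let D : (H →L[ℂ] H) → WithLp 2 (H × H) → WithLp 2 (H × H) :=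
    fun a w => WithLp.toLp 2 (a w.fst, a w.snd)
  have hDc : ∀ a, Continuous (D a) := fun a => by
    refine (WithLp.prod_continuous_toLp 2 H H).comp ?_
    have h := WithLp.prod_continuous_ofLp 2 H H
    exact (a.continuous.comp (continuous_fst.comp h)).prodMk
      (a.continuous.comp (continuous_snd.comp h))
  have hDN : ∀ a ∈ A, ∀ w ∈ N, D a w ∈ N := by
    intro a ha w hw
    refine map_mem_closure (hDc a) hw ?_
    rintro _ ⟨b, hb, rfl⟩
    exact ⟨a * b, mul_mem ha hb, rfl⟩
  have hDin : ∀ a w w', ⟪D a w, w'⟫_ℂ = ⟪w, D (star a) w'⟫_ℂ := by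
    intro a w w'
    change ⟪a w.fst, w'.fst⟫_ℂ + ⟪a w.snd, w'.snd⟫_ℂ =
      ⟪w.fst, star a w'.fst⟫_ℂ + ⟪w.snd, star a w'.snd⟫_ℂ
    rw [ContinuousLinearMap.inner_apply_star, ContinuousLinearMap.inner_apply_star]
  have hDsub : ∀ a w w', D a (w - w') = D a w - D a w' := by
    intro a w w'
    simp only [D, WithLp.sub_fst, WithLp.sub_snd, map_sub]
    rfl
  -- The subspace `N` is invariant under a family closed under adjoints, so its projection commutes
  -- with the diagonal action; this is what places the matrix entries in the commutant.
  have hcomm : ∀ a ∈ A, ∀ w, N.starProjection (D a w) = D a (N.starProjection w) := by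
    intro a ha w
    refine Submodule.eq_starProjection_of_mem_of_inner_eq_zero
      (hDN a ha _ (N.starProjection_apply_mem w)) fun n hn => ?_
    rw [← hDsub, hDin]
    exact N.starProjection_inner_eq_zero w _ (hDN _ (star_mem ha) n hn)
  let e := WithLp.prodContinuousLinearEquiv 2 ℂ H H
  let f : (H × H) →L[ℂ] H := (ContinuousLinearMap.fst ℂ H H) ∘L (e : _ →L[ℂ] (H × H)) ∘L
    N.starProjection ∘L (e.symm : (H × H) →L[ℂ] _)
  let p : H →L[ℂ] H := f ∘L ContinuousLinearMap.inl ℂ H H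
  let q : H →L[ℂ] H := f ∘L ContinuousLinearMap.inr ℂ H H
  have hf : ∀ x y, f (x, y) = (N.starProjection (WithLp.toLp 2 (x, y))).fst := fun x y => rfl
  have hpq : ∀ x y, p x + q y = (N.starProjection (WithLp.toLp 2 (x, y))).fst := by
    intro x y
    rw [← hf]
    change f (x, 0) + f (0, y) = _
    rw [← map_add]
    simp
  have hp : ∀ x, p x = (N.starProjection (WithLp.toLp 2 (x, 0))).fst := fun x => rfl
  have hfc : ∀ a ∈ A, ∀ z, f (a z.1, a z.2) = a (f z) := by
    intro a ha z
    rw [hf]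
    exact congrArg (fun w : WithLp 2 (H × H) => w.fst) (hcomm a ha (WithLp.toLp 2 z))
  refine ⟨p, ?_, q, ?_, ?_, ?_, ?_⟩
  · rw [VonNeumannAlgebra.mem_commutant_iff]
    intro a ha
    ext x
    have := hfc a ha (x, 0)
    rw [map_zero] at this
    exact this.symm
  · rw [VonNeumannAlgebra.mem_commutant_iff]
    intro a ha
    ext x
    have := hfc a ha (0, x)
    rw [map_zero] at this
    exact this.symm
  · rw [hpq, Submodule.starProjection_eq_self_iff.2]
    · rfl
    · exact N₀.le_topologicalClosure ⟨1, one_mem A, rfl⟩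
  · intro x y h
    have h0 : N.starProjection (WithLp.toLp 2 (x, y)) = 0 := by
      rw [Submodule.starProjection_apply_eq_zero_iff, Submodule.mem_orthogonal']
      intro w hw
      have hcl : IsClosed {w : WithLp 2 (H × H) | ⟪WithLp.toLp 2 (x, y), w⟫_ℂ = 0} :=
        isClosed_eq (by fun_prop) continuous_const
      refine closure_minimal ?_ hcl hw
      rintro _ ⟨a, ha, rfl⟩
      exact h a ha
    rw [hpq, h0]
    rfl
  · intro x
    have h1 : ∀ y : WithLp 2 (H × H), ⟪x, y.fst⟫_ℂ = ⟪WithLp.toLp 2 (x, (0 : H)), y⟫_ℂ := by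
      intro y
      simp [WithLp.prod_inner_apply]
    have h2 : ∀ w : WithLp 2 (H × H), ⟪w, N.starProjection w⟫_ℂ = ((‖N.starProjection w‖ ^ 2 : ℝ) : ℂ) := by
      intro w
      have h3 := N.starProjection_inner_eq_zero w _ (N.starProjection_apply_mem w)
      rw [inner_sub_left, sub_eq_zero] at h3
      rw [h3, inner_self_eq_norm_sq_to_K]
      norm_cast
    constructor
    · rw [hp, h1, h2, Complex.ofReal_re]
      positivity
    · set w := WithLp.toLp 2 (x, (0 : H))
      have h4 : x - p x = (w - N.starProjection w).fst := rfl
      have h5 : ⟪w, w - N.starProjection w⟫_ℂ = ((‖w - N.starProjection w‖ ^ 2 : ℝ) : ℂ) := by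
        have h3 := N.starProjection_inner_eq_zero w _ (N.starProjection_apply_mem w)
        have h6 : ⟪N.starProjection w, w - N.starProjection w⟫_ℂ = 0 := by
          rw [← inner_conj_symm, h3, map_zero]
        have h7 : ⟪w - N.starProjection w, w - N.starProjection w⟫_ℂ =
            ((‖w - N.starProjection w‖ ^ 2 : ℝ) : ℂ) := by
          rw [inner_self_eq_norm_sq_to_K]
          norm_cast
        rw [← h7, inner_sub_left w, h6, sub_zero]
      rw [h4, h1, h5, Complex.ofReal_re, WithLp.prod_norm_sq_eq_of_L2]
      have := sq_nonneg ‖(w - N.starProjection w).snd‖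
      linarith

lemma IsStandardVector.ext_apply {A : VonNeumannAlgebra H} {Ω : H} (hΩ : IsStandardVector A Ω)
    {a b : H →L[ℂ] H} (ha : a ∈ A) (hb : b ∈ A) (h : a Ω = b Ω) : a = b :=
  sub_eq_zero.1 (hΩ.separating _ (sub_mem ha hb) (by simp [h]))

/-- The projection onto the closure of `A'Ω` lies in `A` and fixes `Ω`, so it is `1` because `Ω`
separates `A`. Conversely, an element of `A'` killing `Ω` kills the dense set `AΩ`. -/
theorem IsStandardVector.commutant {A : VonNeumannAlgebra H} {Ω : H} (hΩ : IsStandardVector A Ω) :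
    IsStandardVector A.commutant Ω := by
  refine ⟨hΩ.norm_eq_one, ?_, ?_⟩
  · obtain ⟨p, hp, q, hq, h1, h2, -⟩ := A.commutant.exists_cyclic_projection_entries Ω 0
    rw [A.commutant_commutant] at hp hq
    have h3 : p = 1 := hΩ.ext_apply hp (one_mem A) (by simpa using h1)
    let N : Submodule ℂ H :=
      { carrier := {ξ | ∃ a ∈ A.commutant, a Ω = ξ}
        add_mem' := by
          rintro _ _ ⟨a, ha, rfl⟩ ⟨b, hb, rfl⟩
          exact ⟨a + b, add_mem ha hb, rfl⟩
        zero_mem' := ⟨0, zero_mem _, rfl⟩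
        smul_mem' := by
          rintro c _ ⟨a, ha, rfl⟩
          exact ⟨c • a, VonNeumannAlgebra.smul_mem _ c ha, rfl⟩ }
    have h4 : N.topologicalClosure = ⊤ := by
      rw [Submodule.topologicalClosure_eq_top_iff, Submodule.eq_bot_iff]
      intro x hx
      have := h2 x 0 fun a ha => by
        rw [inner_zero_left, add_zero]
        have hm : a Ω ∈ N := ⟨a, ha, rfl⟩
        exact Submodule.inner_left_of_mem_orthogonal hm hx
      simpa [h3] using this
    exact (Submodule.dense_iff_topologicalClosure_eq_top (s := N)).2 h4
  · intro b hb h0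
    have : (b : H → H) = fun _ => 0 := by
      refine Continuous.ext_on hΩ.cyclic b.continuous continuous_const ?_
      rintro _ ⟨a, ha, rfl⟩
      rw [← VonNeumannAlgebra.commute_apply ha hb, h0, map_zero]
    ext x
    exact congrFun this x

lemma mem_tomitaGraph_of_mem {A : VonNeumannAlgebra H} (Ω : H) {a : H →L[ℂ] H} (ha : a ∈ A) :
    (a Ω, star a Ω) ∈ tomitaGraph A Ω := subset_closure ⟨a, ha, rfl⟩

lemma tomitaGraph_swap {A : VonNeumannAlgebra H} {Ω x y : H} (h : (x, y) ∈ tomitaGraph A Ω) :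
    (y, x) ∈ tomitaGraph A Ω := by
  refine map_mem_closure (f := Prod.swap) continuous_swap h ?_
  rintro _ ⟨a, ha, rfl⟩
  exact ⟨star a, star_mem ha, by simp⟩

lemma tomitaGraph_sub {A : VonNeumannAlgebra H} {Ω : H} {p q : H × H} (hp : p ∈ tomitaGraph A Ω)
    (hq : q ∈ tomitaGraph A Ω) : p - q ∈ tomitaGraph A Ω := by
  obtain ⟨G, hG⟩ := tomitaGraph_submodule A Ω
  rw [← hG] at hp hq ⊢
  exact G.sub_mem hp hq

lemma tomitaGraph_add {A : VonNeumannAlgebra H} {Ω : H} {p q : H × H} (hp : p ∈ tomitaGraph A Ω)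
    (hq : q ∈ tomitaGraph A Ω) : p + q ∈ tomitaGraph A Ω := by
  obtain ⟨G, hG⟩ := tomitaGraph_submodule A Ω
  rw [← hG] at hp hq ⊢
  exact G.add_mem hp hq

lemma tomitaGraph_smul {A : VonNeumannAlgebra H} {Ω x y : H} (c : ℂ)
    (h : (x, y) ∈ tomitaGraph A Ω) : (c • x, conj c • y) ∈ tomitaGraph A Ω := by
  refine map_mem_closure (f := fun p : H × H => (c • p.1, conj c • p.2)) (by fun_prop) h ?_
  rintro _ ⟨a, ha, rfl⟩
  refine ⟨c • a, A.smul_mem c ha, ?_⟩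
  simp [star_smul]

/-- Every pair of vectors differs from some element of the graph of `S` by an element of the
real orthogonal complement of the graph. -/
lemma exists_tomitaGraph_projection (A : VonNeumannAlgebra H) (Ω ξ η : H) :
    ∃ g ∈ tomitaGraph A Ω, ∀ p ∈ tomitaGraph A Ω, ⟪ξ - g.1, p.1⟫_ℂ + ⟪p.2, η - g.2⟫_ℂ = 0 := by
  obtain ⟨G, hG⟩ := tomitaGraph_submodule A Ω
  let : InnerProductSpace ℝ H := InnerProductSpace.rclikeToReal ℂ H
  let e := WithLp.prodContinuousLinearEquiv 2 ℝ H H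
  let G' : @Submodule ℝ (WithLp 2 (H × H)) _ _ InnerProductSpace.toNormedSpace.toModule :=
    { carrier := {v | e v ∈ G}
      add_mem' := fun {u v} hu hv => G.add_mem hu hv
      zero_mem' := G.zero_mem
      smul_mem' := fun r v hv => G.smul_mem r hv }
  have hcl : IsClosed (G' : Set (WithLp 2 (H × H))) := by
    have : IsClosed (G : Set (H × H)) := by rw [hG]; exact isClosed_closure
    exact this.preimage e.continuous
  have : CompleteSpace G' := hcl.completeSpace_coe
  obtain ⟨g, hg, hperp⟩ :=
    Submodule.HasOrthogonalProjection.exists_orthogonal (𝕜 := ℝ) (K := G') (WithLp.toLp 2 (ξ, η))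
  have hre : ∀ p ∈ tomitaGraph A Ω, (⟪ξ - g.fst, p.1⟫_ℂ).re + (⟪p.2, η - g.snd⟫_ℂ).re = 0 := by
    intro p hp
    have hp' : WithLp.toLp 2 p ∈ G' := by rw [← hG] at hp; exact hp
    have h := hperp _ hp'
    rw [WithLp.prod_inner_apply] at h
    have h' : (⟪p.1, ξ - g.fst⟫_ℂ).re + (⟪p.2, η - g.snd⟫_ℂ).re = 0 := h
    have h2 : (⟪ξ - g.fst, p.1⟫_ℂ).re = (⟪p.1, ξ - g.fst⟫_ℂ).re :=
      inner_re_symm (𝕜 := ℂ) (ξ - g.fst) p.1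
    rw [h2]
    exact h'
  refine ⟨(g.fst, g.snd), by rw [← hG]; exact hg, fun p hp => ?_⟩
  apply Complex.ext
  · exact hre p hp
  · have h := hre _ (tomitaGraph_smul_I A Ω p hp)
    simp only [inner_smul_right, inner_neg_left, inner_smul_left, Complex.conj_I,
      Complex.mul_re, Complex.I_re, Complex.I_im, Complex.neg_re, Complex.neg_im] at h
    simp only [Complex.add_im, Complex.zero_im]
    linarith

/-- The graph of `S` is contained in the graph of the adjoint of the Tomita operator of the
commutant. -/
lemma inner_eq_of_mem_tomitaGraph {A : VonNeumannAlgebra H} {Ω η ζ : H} {p : H × H}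
    (h : (η, ζ) ∈ tomitaGraph A Ω) (hp : p ∈ tomitaGraph A.commutant Ω) :
    ⟪ζ, p.1⟫_ℂ = ⟪p.2, η⟫_ℂ := by
  have hcl : ∀ p : H × H, IsClosed {q : H × H | ⟪q.2, p.1⟫_ℂ = ⟪p.2, q.1⟫_ℂ} := fun p =>
    isClosed_eq (by fun_prop) (by fun_prop)
  refine closure_minimal (t := {q : H × H | ⟪q.2, p.1⟫_ℂ = ⟪p.2, q.1⟫_ℂ}) ?_ (hcl p) h
  rintro _ ⟨a, ha, rfl⟩
  have hcl' : IsClosed {p : H × H | ⟪star a Ω, p.1⟫_ℂ = ⟪p.2, a Ω⟫_ℂ} :=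
    isClosed_eq (by fun_prop) (by fun_prop)
  refine closure_minimal ?_ hcl' hp
  rintro _ ⟨b, hb, rfl⟩
  change ⟪star a Ω, b Ω⟫_ℂ = ⟪star b Ω, a Ω⟫_ℂ
  rw [ContinuousLinearMap.inner_star_apply, ContinuousLinearMap.inner_star_apply,
    VonNeumannAlgebra.commute_apply ha hb]

/-- The Tomita operator `S` is the adjoint of the Tomita operator of the commutant. -/
theorem mem_tomitaGraph_iff {A : VonNeumannAlgebra H} {Ω : H} (hΩ : IsStandardVector A Ω)
    {η ζ : H} : (η, ζ) ∈ tomitaGraph A Ω ↔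
      ∀ p ∈ tomitaGraph A.commutant Ω, ⟪ζ, p.1⟫_ℂ = ⟪p.2, η⟫_ℂ := by
  refine ⟨fun h p hp => inner_eq_of_mem_tomitaGraph h hp, fun h => ?_⟩
  obtain ⟨g, hg, hperp⟩ := exists_tomitaGraph_projection A Ω η ζ
  set x := η - g.1 with hx
  set y := ζ - g.2 with hy
  have h' : ∀ b ∈ A.commutant, ⟪y, b Ω⟫_ℂ = ⟪star b Ω, x⟫_ℂ := by
    intro b hb
    have h1 := h _ (mem_tomitaGraph_of_mem Ω hb)
    have h2 := inner_eq_of_mem_tomitaGraph hg (mem_tomitaGraph_of_mem Ω hb)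
    rw [hx, hy, inner_sub_left, inner_sub_right, h1, h2]
  -- Orthogonality of `(x, y)` to the graph reads `⟪x, aΩ⟫ + ⟪Ω, a y⟫ = 0` for `a ∈ A`: the pair
  -- `(x, Ω)` is orthogonal to the cyclic subspace of `(Ω, y)`. The matrix entries of that
  -- projection lie in `A'`, where the hypothesis on `η` and `ζ` can be used.
  obtain ⟨p, hp, q, hq, h1, h2, h3⟩ := A.exists_cyclic_projection_entries Ω y
  have h4 : p x + q Ω = 0 := h2 x Ω fun a ha => by
    have := hperp _ (mem_tomitaGraph_of_mem Ω ha)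
    rwa [ContinuousLinearMap.inner_star_apply] at this
  -- The adjoint relation for `b = q*` links the two equations satisfied by `p` and `q`. The real
  -- part is nonnegative on the left and nonpositive on the right, so both vanish; this gives `p =
  -- 1` and then `x = 0`.
  have h5 : ⟪Ω, Ω - p Ω⟫_ℂ = -⟪x, p x⟫_ℂ := by
    have e1 : Ω - p Ω = q y := by rw [sub_eq_iff_eq_add']; exact h1.symm
    have e2 : p x = -(q Ω) := eq_neg_of_add_eq_zero_left h4
    have e3 := h' (star q) (star_mem hq)
    rw [star_star, ContinuousLinearMap.inner_apply_star] at e3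
    rw [e1, e2, inner_neg_right, neg_neg, ← inner_conj_symm, e3, inner_conj_symm]
  have h6 : ‖Ω - p Ω‖ ^ 2 = 0 ∧ (⟪x, p x⟫_ℂ).re = 0 := by
    have e1 := congrArg Complex.re h5
    rw [Complex.neg_re] at e1
    have e3 := h3 Ω
    have e4 := h3 x
    constructor <;> nlinarith [sq_nonneg ‖Ω - p Ω‖]
  have h7 : p = 1 := by
    refine hΩ.commutant.ext_apply hp (one_mem _) ?_
    have := pow_eq_zero_iff (two_ne_zero) |>.1 h6.1
    exact (sub_eq_zero.1 (norm_eq_zero.1 this)).symm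
  have hx0 : x = 0 := by
    have := h6.2
    rw [h7, one_apply_eq_self] at this
    have e : RCLike.re ⟪x, x⟫_ℂ = 0 := this
    rwa [inner_self_eq_norm_sq, sq_eq_zero_iff, norm_eq_zero] at e
  have hy0 : y = 0 := by
    refine hΩ.commutant.cyclic.eq_zero_of_inner_left (𝕜 := ℂ) fun z hz => ?_
    obtain ⟨b, hb, rfl⟩ := hz
    rw [h' b hb, hx0, inner_zero_right]
  have e1 : η = g.1 := sub_eq_zero.1 hx0
  have e2 : ζ = g.2 := sub_eq_zero.1 hy0
  rw [e1, e2]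
  exact hg

/-- The factorization `Δ = F S`, with `F = S†` the Tomita operator of the commutant. -/
lemma isModularImage_iff {A : VonNeumannAlgebra H} {Ω : H} (hΩ : IsStandardVector A Ω) {ξ ζ : H} :
    IsModularImage A Ω ξ ζ ↔
      ∃ η, (ξ, η) ∈ tomitaGraph A Ω ∧ (η, ζ) ∈ tomitaGraph A.commutant Ω := by
  simp only [IsModularImage, mem_tomitaGraph_iff hΩ.commutant, A.commutant_commutant]

/-- Closability of `aΩ ↦ a†Ω`: the adjoint is defined on the dense set `A'Ω`, and pairing with it
determines the value. -/
lemma tomitaGraph_unique {A : VonNeumannAlgebra H} {Ω : H} (hΩ : IsStandardVector A Ω) {x y y' : H}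
    (h : (x, y) ∈ tomitaGraph A Ω) (h' : (x, y') ∈ tomitaGraph A Ω) : y = y' := by
  refine hΩ.commutant.cyclic.eq_of_inner_left (𝕜 := ℂ) fun z hz => ?_
  obtain ⟨b, hb, rfl⟩ := hz
  have hb' := mem_tomitaGraph_of_mem Ω hb
  exact (inner_eq_of_mem_tomitaGraph h hb').trans (inner_eq_of_mem_tomitaGraph h' hb').symm

lemma exists_modularResolvent_eq {A : VonNeumannAlgebra H} {Ω : H} (hΩ : IsStandardVector A Ω)
    (ξ : H) : ∃ v, (modularResolvent A Ω ξ, v) ∈ tomitaGraph A Ω ∧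
      (v, ξ - modularResolvent A Ω ξ) ∈ tomitaGraph A.commutant Ω :=
  (isModularImage_iff hΩ).1 (modularResolvent_spec A Ω ξ)

/-- Positivity of `Δ`: the difference `δ` of two solutions satisfies `Δ δ = -δ`, and pairing with
`δ` gives `‖S δ‖² = -‖δ‖²`. -/
lemma modularResolvent_eq_of_isModularImage {A : VonNeumannAlgebra H} {Ω ξ u : H}
    (h : IsModularImage A Ω u (ξ - u)) : modularResolvent A Ω ξ = u := by
  obtain ⟨η, h1, h2⟩ := modularResolvent_spec A Ω ξ
  obtain ⟨η', h1', h2'⟩ := h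
  set T := modularResolvent A Ω ξ
  have hm := tomitaGraph_sub h1 h1'
  have e1 := h2 _ hm
  have e2 := h2' _ hm
  have e3 : ⟪(ξ - T) - (ξ - u), T - u⟫_ℂ = ⟪η - η', η - η'⟫_ℂ := by
    rw [inner_sub_left (ξ - T), inner_sub_right (η - η') η η']
    exact congrArg₂ (· - ·) e1 e2
  have e4 : (ξ - T) - (ξ - u) = -(T - u) := by abel
  rw [e4, inner_neg_left, inner_self_eq_norm_sq_to_K, inner_self_eq_norm_sq_to_K] at e3
  have e5 : -(‖T - u‖ ^ 2) = ‖η - η'‖ ^ 2 := by exact_mod_cast e3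
  have e6 : ‖T - u‖ ^ 2 = 0 := by nlinarith [sq_nonneg ‖T - u‖, sq_nonneg ‖η - η'‖]
  exact sub_eq_zero.1 (norm_eq_zero.1 (by simpa using e6))

/-- The modular operator of the commutant is the inverse of the modular operator. -/
theorem modularResolvent_commutant {A : VonNeumannAlgebra H} {Ω : H} (hΩ : IsStandardVector A Ω) :
    modularResolvent A.commutant Ω = 1 - modularResolvent A Ω := by
  ext ξ
  refine modularResolvent_eq_of_isModularImage ((isModularImage_iff hΩ.commutant).2 ?_)
  obtain ⟨v, h1, h2⟩ := exists_modularResolvent_eq hΩ ξ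
  refine ⟨v, tomitaGraph_swap h2, ?_⟩
  rw [A.commutant_commutant]
  convert tomitaGraph_swap h1 using 2
  simp

/-- This is `S T = (1 - T) S` on the domain of `S`, the resolvent form of `S Δ S⁻¹ = Δ⁻¹`. With `v =
S T x`, the vector `y - v` solves the equation characterizing `T y`, since `S` and `F` are
involutive. -/
lemma modularResolvent_intertwine {A : VonNeumannAlgebra H} {Ω x y : H}
    (hΩ : IsStandardVector A Ω) (h : (x, y) ∈ tomitaGraph A Ω) :
    (modularResolvent A Ω x, y - modularResolvent A Ω y) ∈ tomitaGraph A Ω ∧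
    (y - modularResolvent A Ω y, x - modularResolvent A Ω x) ∈ tomitaGraph A.commutant Ω := by
  obtain ⟨v, h1, h2⟩ := exists_modularResolvent_eq hΩ x
  have h3 : modularResolvent A Ω y = y - v := by
    refine modularResolvent_eq_of_isModularImage ((isModularImage_iff hΩ).2 ?_)
    refine ⟨x - modularResolvent A Ω x, tomitaGraph_swap (tomitaGraph_sub h h1), ?_⟩
    simpa using tomitaGraph_swap h2
  rw [h3, sub_sub_cancel]
  exact ⟨h1, h2⟩

/-- For `(x, y)` in the graph of the Tomita operator `F` of the commutant, `T x` lies in the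
domains of both `S` and `F`, with `S T x = T y` and `F T x = y - T y`. -/
lemma modularResolvent_intertwine_commutant {A : VonNeumannAlgebra H} {Ω x y : H}
    (hΩ : IsStandardVector A Ω) (h : (x, y) ∈ tomitaGraph A.commutant Ω) :
    (modularResolvent A Ω x, modularResolvent A Ω y) ∈ tomitaGraph A Ω ∧
    (modularResolvent A Ω x, y - modularResolvent A Ω y) ∈ tomitaGraph A.commutant Ω := by
  have h1 := modularResolvent_intertwine hΩ.commutant h
  rw [A.commutant_commutant, modularResolvent_commutant hΩ] at h1
  simp only [sub_apply, one_apply_eq_self, sub_sub_cancel] at h1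
  refine ⟨tomitaGraph_swap h1.2, ?_⟩
  simpa using tomitaGraph_sub h h1.1

lemma inner_modularResolvent_left (A : VonNeumannAlgebra H) (Ω x y : H) :
    ⟪modularResolvent A Ω x, y⟫_ℂ = ⟪x, modularResolvent A Ω y⟫_ℂ := by
  obtain ⟨η, h1, h2⟩ := modularResolvent_spec A Ω x
  obtain ⟨ζ, h3, h4⟩ := modularResolvent_spec A Ω y
  have e1 := h2 _ h3
  have e2 := h4 _ h1
  simp only [inner_sub_left] at e1 e2
  have e3 := congrArg conj e2
  simp only [map_sub, inner_conj_symm] at e3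
  linear_combination e3 - e1

lemma modularResolvent_nonneg (A : VonNeumannAlgebra H) (Ω : H) : 0 ≤ modularResolvent A Ω := by
  rw [ContinuousLinearMap.nonneg_iff_isPositive, ContinuousLinearMap.isPositive_iff_complex]
  intro x
  obtain ⟨η, h1, h2⟩ := modularResolvent_spec A Ω x
  have e := h2 _ h1
  have e' : ⟪modularResolvent A Ω x, x⟫_ℂ =
      ((‖modularResolvent A Ω x‖ ^ 2 + ‖η‖ ^ 2 : ℝ) : ℂ) := by
    rw [inner_modularResolvent_left, ← inner_modularResolvent_left]
    rw [inner_modularResolvent_left]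
    simp only [inner_sub_left, inner_self_eq_norm_sq_to_K] at e
    push_cast
    linear_combination e
  rw [e', RCLike.re_eq_complex_re, Complex.ofReal_re]
  exact ⟨rfl, by positivity⟩

lemma modularResolvent_le_one (A : VonNeumannAlgebra H) (Ω : H) : modularResolvent A Ω ≤ 1 := by
  rw [← sub_nonneg, ContinuousLinearMap.nonneg_iff_isPositive,
    ContinuousLinearMap.isPositive_iff_complex]
  intro x
  obtain ⟨η, h1, h2⟩ := modularResolvent_spec A Ω x
  have e := h2 _ h1
  set u := modularResolvent A Ω x with hu
  have e' : ⟪x - u, x⟫_ℂ = ((‖x - u‖ ^ 2 + ‖η‖ ^ 2 : ℝ) : ℂ) := by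
    have : ⟪x - u, x - u⟫_ℂ = ((‖x - u‖ ^ 2 : ℝ) : ℂ) := by
      rw [inner_self_eq_norm_sq_to_K]; norm_cast
    rw [inner_sub_right (x - u) x u] at this
    have e2 : ⟪η, η⟫_ℂ = ((‖η‖ ^ 2 : ℝ) : ℂ) := by
      rw [inner_self_eq_norm_sq_to_K]; norm_cast
    rw [Complex.ofReal_add, ← this, ← e2]
    linear_combination e
  rw [sub_apply, one_apply_eq_self, ← hu, e', RCLike.re_eq_complex_re,
    Complex.ofReal_re]
  exact ⟨rfl, by positivity⟩

/-- If `T x = 0`, then `x = F S T x = 0`, because `S` and `F` are single-valued. -/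
lemma modularResolvent_injective {A : VonNeumannAlgebra H} {Ω : H} (hΩ : IsStandardVector A Ω)
    {x : H} (h : modularResolvent A Ω x = 0) : x = 0 := by
  obtain ⟨v, h1, h2⟩ := exists_modularResolvent_eq hΩ x
  have h3 : ((0 : H), (0 : H)) ∈ tomitaGraph A Ω := by simpa using! tomitaGraph_sub h1 h1
  rw [h] at h1 h2
  obtain rfl := tomitaGraph_unique hΩ h3 h1
  have h4 : ((0 : H), (0 : H)) ∈ tomitaGraph A.commutant Ω := by simpa using! tomitaGraph_sub h2 h2
  have := tomitaGraph_unique hΩ.commutant h4 h2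
  simpa using this.symm

lemma eq_zero_of_modularResolvent_eq_self {A : VonNeumannAlgebra H} {Ω : H}
    (hΩ : IsStandardVector A Ω) {x : H} (h : modularResolvent A Ω x = x) : x = 0 := by
  refine modularResolvent_injective hΩ.commutant ?_
  rw [modularResolvent_commutant hΩ]
  simp [h]

end TomitaGraph

/-! ### Compactly supported functions of `Δ` through its resolvent -/

section FunctionalCalculus

variable {H : Type*} [NormedAddCommGroup H] [InnerProductSpace ℂ H] [CompleteSpace H]

/-- Continuous functions with compact support in `(0, ∞)`. -/
structure IsCc (φ : ℝ → ℂ) : Prop where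
  continuous : Continuous φ
  compact : HasCompactSupport φ
  support : tsupport φ ⊆ Set.Ioi 0

namespace IsCc

variable {φ ψ : ℝ → ℂ}

lemma eq_zero (hφ : IsCc φ) {x : ℝ} (hx : x ≤ 0) : φ x = 0 :=
  image_eq_zero_of_notMem_tsupport fun h => not_lt.2 hx (hφ.support h)

lemma mul (hφ : IsCc φ) {h : ℝ → ℂ} (hh : ContinuousOn h (Set.Ioi 0)) :
    IsCc fun x => φ x * h x := by
  have hs : tsupport (fun x => φ x * h x) ⊆ tsupport φ := tsupport_mul_subset_left
  refine ⟨continuous_of_tsupport fun x hx => ?_, hφ.compact.mul_right, hs.trans hφ.support⟩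
  exact hφ.continuous.continuousAt.mul (hh.continuousAt (Ioi_mem_nhds (hφ.support (hs hx))))

lemma add (hφ : IsCc φ) (hψ : IsCc ψ) : IsCc fun x => φ x + ψ x :=
  ⟨hφ.continuous.add hψ.continuous, hφ.compact.add hψ.compact,
    (tsupport_add φ ψ).trans (Set.union_subset hφ.support hψ.support)⟩

lemma star (hφ : IsCc φ) : IsCc fun x => conj (φ x) := by
  have hs : tsupport (fun x => conj (φ x)) = tsupport φ := by
    refine congrArg closure ?_
    ext x
    simp
  refine ⟨Complex.continuous_conj.comp hφ.continuous, ?_, hs ▸ hφ.support⟩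
  rw [HasCompactSupport, hs]
  exact hφ.compact

lemma exists_bounds (hφ : IsCc φ) : ∃ δ R : ℝ, 0 < δ ∧ ∀ x, φ x ≠ 0 → δ ≤ x ∧ x ≤ R := by
  rcases (tsupport φ).eq_empty_or_nonempty with h | h
  · refine ⟨1, 0, one_pos, fun x hx => ?_⟩
    have := subset_tsupport φ hx
    simp [h] at this
  · obtain ⟨a, ha, ha'⟩ := hφ.compact.exists_isMinOn h continuous_id.continuousOn
    obtain ⟨b, hb, hb'⟩ := hφ.compact.exists_isMaxOn h continuous_id.continuousOn
    exact ⟨a, b, hφ.support ha, fun x hx =>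
      ⟨ha' (subset_tsupport φ hx), hb' (subset_tsupport φ hx)⟩⟩

lemma exists_norm_le (hφ : IsCc φ) : ∃ C, ∀ x, ‖φ x‖ ≤ C :=
  hφ.continuous.bounded_above_of_compact_support hφ.compact

lemma continuous_comp (hφ : IsCc φ) : Continuous fun w : ℂ => φ ((1 - w.re) / w.re) := by
  obtain ⟨δ, R, hδ, hR⟩ := hφ.exists_bounds
  rw [continuous_iff_continuousAt]
  intro w
  by_cases hw : w.re = 0
  -- The pole at `w.re = 0` is harmless: for small positive `w.re` the argument exceeds the bound
  -- `R` of the support, and for `w.re ≤ 0` it is not positive.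
  · have hev : (fun w : ℂ => φ ((1 - w.re) / w.re)) =ᶠ[𝓝 w] fun _ => 0 := by
      have h1 : ∀ᶠ v : ℂ in 𝓝 w, |v.re| < 1 / (|R| + 2) := by
        have : ContinuousAt (fun v : ℂ => |v.re|) w := by fun_prop
        refine this.eventually_lt continuousAt_const ?_
        rw [hw, abs_zero]
        positivity
      filter_upwards [h1] with v hv
      by_contra hne
      obtain ⟨h2, h3⟩ := hR _ hne
      have hpos : 0 < (1 - v.re) / v.re := hδ.trans_le h2
      have hv0 : 0 < v.re := by
        by_contra! hle
        exact absurd hpos (not_lt.2 (div_nonpos_of_nonneg_of_nonpos (by linarith) hle))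
      rw [abs_of_pos hv0, lt_div_iff₀ (by positivity)] at hv
      rw [div_le_iff₀ hv0] at h3
      nlinarith [le_abs_self R]
    exact (continuousAt_const.congr hev.symm)
  · refine hφ.continuous.continuousAt.comp ?_
    exact ContinuousAt.div (by fun_prop) (by fun_prop) hw

end IsCc

/-- A continuous cutoff function with compact support in `(0, ∞)`. -/
noncomputable def modularCutoff (n : ℕ) (x : ℝ) : ℂ :=
  ((max 0 (min 1 (n * (x / (1 + x ^ 2)) - 1)) : ℝ) : ℂ)

lemma isCc_modularCutoff (n : ℕ) : IsCc (modularCutoff n) := by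
  have hc : Continuous (modularCutoff n) := by
    unfold modularCutoff
    have : Continuous fun x : ℝ => x / (1 + x ^ 2) :=
      continuous_id.div (by fun_prop) fun x => by positivity
    fun_prop
  have hs : tsupport (modularCutoff n) ⊆ {x | 1 + x ^ 2 ≤ n * x} := by
    refine closure_minimal (fun x hx => ?_) (isClosed_le (by fun_prop) (by fun_prop))
    by_contra hlt
    rw [Set.mem_ofPred_eq, not_le] at hlt
    refine hx ?_
    have h1 : (n : ℝ) * (x / (1 + x ^ 2)) - 1 ≤ 0 := by
      rw [← mul_div_assoc, sub_nonpos, div_le_one (by positivity)]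
      exact hlt.le
    rw [modularCutoff, max_eq_left ((min_le_right _ _).trans h1), Complex.ofReal_zero]
  refine ⟨hc, ?_, hs.trans fun x hx => ?_⟩
  · refine (isCompact_Icc (a := (0 : ℝ)) (b := n)).of_isClosed_subset (isClosed_tsupport _)
      (hs.trans fun x hx => ?_)
    have hx : 1 + x ^ 2 ≤ n * x := hx
    have hn : (0 : ℝ) ≤ n := n.cast_nonneg
    constructor <;> by_contra! <;> nlinarith
  · have hx : 1 + x ^ 2 ≤ n * x := hx
    have hn : (0 : ℝ) ≤ n := n.cast_nonneg
    change 0 < x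
    by_contra!
    nlinarith

lemma norm_modularCutoff_le (n : ℕ) (x : ℝ) : ‖modularCutoff n x‖ ≤ 1 := by
  rw [modularCutoff, Complex.norm_real, Real.norm_of_nonneg (le_max_left _ _)]
  exact max_le zero_le_one (min_le_left _ _)

lemma norm_modularCutoff_sub_one_le (n : ℕ) (x : ℝ) : ‖modularCutoff n x - 1‖ ≤ 1 := by
  rw [modularCutoff, ← Complex.ofReal_one, ← Complex.ofReal_sub, Complex.norm_real, Real.norm_eq_abs,
    abs_le]
  constructor
  · linarith [le_max_left (0 : ℝ) (min 1 (n * (x / (1 + x ^ 2)) - 1))]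
  · have := max_le zero_le_one (min_le_left (1 : ℝ) (n * (x / (1 + x ^ 2)) - 1))
    linarith

lemma modularCutoff_eq_one {n : ℕ} {x : ℝ} (h : 2 ≤ n * (x / (1 + x ^ 2))) :
    modularCutoff n x = 1 := by
  rw [modularCutoff, min_eq_left (by linarith), max_eq_right zero_le_one, Complex.ofReal_one]

lemma IsCc.exists_cutoff {φ : ℝ → ℂ} (hφ : IsCc φ) :
    ∃ n, ∀ x, φ x ≠ 0 → modularCutoff n x = 1 := by
  obtain ⟨δ, R, hδ, hR⟩ := hφ.exists_bounds
  obtain ⟨n, hn⟩ := exists_nat_ge (2 * (1 + R ^ 2) / δ)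
  refine ⟨n, fun x hx => modularCutoff_eq_one ?_⟩
  obtain ⟨h1, h2⟩ := hR x hx
  rw [div_le_iff₀ hδ] at hn
  rw [← mul_div_assoc, le_div_iff₀ (by positivity)]
  have : x ^ 2 ≤ R ^ 2 := by nlinarith
  have : (n : ℝ) * δ ≤ n * x := by gcongr
  linarith

section Resolvent

variable (A : VonNeumannAlgebra H) (Ω : H)

lemma isSelfAdjoint_modularResolvent : IsSelfAdjoint (modularResolvent A Ω) :=
  IsSelfAdjoint.of_nonneg (modularResolvent_nonneg A Ω)

lemma spectrum_modularResolvent {w : ℂ} (hw : w ∈ spectrum ℂ (modularResolvent A Ω)) :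
    w = (w.re : ℂ) ∧ 0 ≤ w.re ∧ w.re ≤ 1 := by
  have hsa := isSelfAdjoint_modularResolvent A Ω
  have h1 : w = (w.re : ℂ) := hsa.mem_spectrum_eq_re hw
  have h2 : w.re ∈ spectrum ℝ (modularResolvent A Ω) := by
    rw [← spectrum.algebraMap_mem_iff ℂ]
    change (w.re : ℂ) ∈ _
    rwa [← h1]
  refine ⟨h1, spectrum_nonneg_of_nonneg (modularResolvent_nonneg A Ω) h2, ?_⟩
  have := (le_algebraMap_iff_spectrum_le (R := ℝ) (A := H →L[ℂ] H) (r := 1) (a := modularResolvent A Ω)).1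
    (by simpa using modularResolvent_le_one A Ω)
  exact this _ h2

variable {A Ω}

/-- Translates between functions `g` of `T` and functions `k` of `Δ` under `x = (1 - r) / r`. The
endpoint `r = 0`, where no value of `x` corresponds, is removed by the factor `φ`. -/
lemma modularCc_mul_cfc {φ : ℝ → ℂ} (hφ : IsCc φ) {g : ℂ → ℂ} (hg : Continuous g) {k : ℝ → ℂ}
    (hk : ∀ r : ℝ, 0 < r → r ≤ 1 → g r = k ((1 - r) / r)) :
    modularCc A Ω φ * cfc g (modularResolvent A Ω) = modularCc A Ω fun x => φ x * k x := by
  have := (isSelfAdjoint_modularResolvent A Ω).isStarNormal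
  rw [modularCc, modularCc, ← cfc_mul _ _ _ hφ.continuous_comp.continuousOn hg.continuousOn]
  refine cfc_congr fun w hw => ?_
  obtain ⟨h1, h2, h3⟩ := spectrum_modularResolvent A Ω hw
  rcases h2.eq_or_lt with h0 | h0
  · simp [← h0, hφ.eq_zero le_rfl]
  · change φ _ * g w = φ _ * k _
    rw [← hk _ h0 h3, ← h1]

lemma modularCc_mul {φ ψ : ℝ → ℂ} (hφ : IsCc φ) (hψ : IsCc ψ) :
    modularCc A Ω (fun x => φ x * ψ x) = modularCc A Ω φ * modularCc A Ω ψ :=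
  cfc_mul _ _ _ hφ.continuous_comp.continuousOn hψ.continuous_comp.continuousOn

lemma modularCc_mul_apply {φ ψ : ℝ → ℂ} (hφ : IsCc φ) (hψ : IsCc ψ) (ξ : H) :
    modularCc A Ω (fun x => φ x * ψ x) ξ = modularCc A Ω φ (modularCc A Ω ψ ξ) := by
  rw [modularCc_mul hφ hψ]
  rfl

lemma modularCc_add {φ ψ : ℝ → ℂ} (hφ : IsCc φ) (hψ : IsCc ψ) :
    modularCc A Ω (fun x => φ x + ψ x) = modularCc A Ω φ + modularCc A Ω ψ :=
  cfc_add _ _ _ hφ.continuous_comp.continuousOn hψ.continuous_comp.continuousOn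

lemma modularCc_const_mul {φ : ℝ → ℂ} (c : ℂ) :
    modularCc A Ω (fun x => c * φ x) = c • modularCc A Ω φ := by
  have := (isSelfAdjoint_modularResolvent A Ω).isStarNormal
  by_cases hc : c = 0
  · simp only [hc, zero_mul, zero_smul, modularCc]
    exact cfc_const_zero ℂ _
  by_cases hφ : ContinuousOn (fun w : ℂ => φ ((1 - w.re) / w.re)) (spectrum ℂ (modularResolvent A Ω))
  · exact cfc_const_mul c _ _ hφ
  · rw [modularCc, modularCc, cfc_apply_of_not_continuousOn _ hφ, smul_zero,
      cfc_apply_of_not_continuousOn]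
    intro h
    apply hφ
    have := h.const_smul c⁻¹
    refine this.congr fun w _ => ?_
    simp [hc]

lemma modularCc_conj {φ : ℝ → ℂ} :
    modularCc A Ω (fun x => conj (φ x)) = star (modularCc A Ω φ) :=
  cfc_star _ _

lemma modularCc_congr {φ ψ : ℝ → ℂ} (hφ : IsCc φ) (hψ : IsCc ψ) (h : ∀ x, 0 < x → φ x = ψ x) :
    modularCc A Ω φ = modularCc A Ω ψ := by
  congr 1
  ext x
  rcases lt_or_ge 0 x with hx | hx
  · exact h x hx
  · rw [hφ.eq_zero hx, hψ.eq_zero hx]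

lemma norm_modularCc_le {φ : ℝ → ℂ} (hφ : IsCc φ) {C : ℝ} (h : ∀ x, 0 < x → ‖φ x‖ ≤ C) :
    ‖modularCc A Ω φ‖ ≤ C := by
  have hC : 0 ≤ C := (norm_nonneg _).trans (h 1 one_pos)
  refine norm_cfc_le hC fun w _ => ?_
  rcases lt_or_ge 0 ((1 - w.re) / w.re) with hx | hx
  · exact h _ hx
  · rw [hφ.eq_zero hx, norm_zero]
    exact hC

lemma norm_modularCc_apply_le {φ : ℝ → ℂ} (hφ : IsCc φ) {C : ℝ} (h : ∀ x, 0 < x → ‖φ x‖ ≤ C) (ξ : H) :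
    ‖modularCc A Ω φ ξ‖ ≤ C * ‖ξ‖ :=
  (modularCc A Ω φ).le_of_opNorm_le (norm_modularCc_le hφ h) ξ

lemma inner_modularCc_left (φ : ℝ → ℂ) (x y : H) :
    ⟪modularCc A Ω φ x, y⟫_ℂ = ⟪x, modularCc A Ω (fun x => conj (φ x)) y⟫_ℂ := by
  rw [modularCc_conj, ContinuousLinearMap.inner_apply_star]

lemma modularCc_resolvent {φ : ℝ → ℂ} (hφ : IsCc φ) (ξ : H) :
    modularCc A Ω φ (modularResolvent A Ω ξ) =
      modularCc A Ω (fun x => φ x * ((1 / (1 + x) : ℝ) : ℂ)) ξ := by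
  have := (isSelfAdjoint_modularResolvent A Ω).isStarNormal
  have h := modularCc_mul_cfc (A := A) (Ω := Ω) hφ continuous_id
    (k := fun x => ((1 / (1 + x) : ℝ) : ℂ)) fun r hr _ => by
      rw [id]
      congr 1
      field_simp
      ring
  rw [← h, cfc_id ℂ (modularResolvent A Ω)]
  rfl

/-- The operator `(T (1 - T)) ^ (1/2) = Δ ^ (1/2) (1 + Δ)⁻¹`. -/
noncomputable def modularWeight (A : VonNeumannAlgebra H) (Ω : H) : H →L[ℂ] H :=
  cfc (fun r : ℝ => √(r * (1 - r))) (modularResolvent A Ω)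

lemma modularCc_weight {φ : ℝ → ℂ} (hφ : IsCc φ) (ξ : H) :
    modularCc A Ω φ (modularWeight A Ω ξ) =
      modularCc A Ω (fun x => φ x * ((√x / (1 + x) : ℝ) : ℂ)) ξ := by
  have hsa := isSelfAdjoint_modularResolvent A Ω
  have h := modularCc_mul_cfc (A := A) (Ω := Ω) hφ
    (g := fun w : ℂ => ((√(w.re * (1 - w.re)) : ℝ) : ℂ)) (by fun_prop)
    (k := fun x => ((√x / (1 + x) : ℝ) : ℂ)) fun r hr _ => by
      rw [Complex.ofReal_re]
      congr 1
      have : 1 + (1 - r) / r = 1 / r := by field_simp; ring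
      rw [this, Real.sqrt_div' _ hr.le, Real.sqrt_mul hr.le]
      have := Real.sq_sqrt hr.le
      have h2 : √r ≠ 0 := (Real.sqrt_pos.2 hr).ne'
      field_simp
      rw [this]
  rw [← h, modularWeight, cfc_real_eq_complex _ hsa]
  rfl

lemma modularWeight_mul_self (A : VonNeumannAlgebra H) (Ω : H) :
    modularWeight A Ω * modularWeight A Ω = modularResolvent A Ω * (1 - modularResolvent A Ω) := by
  have hsa := isSelfAdjoint_modularResolvent A Ω
  have h1 : modularResolvent A Ω * (1 - modularResolvent A Ω) =
      cfc (fun r : ℝ => r * (1 - r)) (modularResolvent A Ω) := by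
    rw [cfc_mul (fun r : ℝ => r) (fun r : ℝ => 1 - r) (modularResolvent A Ω), cfc_sub (fun _ : ℝ => (1 : ℝ)) (fun r : ℝ => r),
      cfc_id' ℝ (modularResolvent A Ω), cfc_const_one ℝ (modularResolvent A Ω)]
  rw [h1, modularWeight, ← cfc_mul _ _ _ (by fun_prop) (by fun_prop)]
  refine cfc_congr fun r hr => ?_
  have h2 := spectrum_nonneg_of_nonneg (modularResolvent_nonneg A Ω) hr
  have h3 := (le_algebraMap_iff_spectrum_le (R := ℝ) (A := H →L[ℂ] H) (r := 1)
    (a := modularResolvent A Ω)).1 (by simpa using modularResolvent_le_one A Ω) _ hr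
  exact Real.mul_self_sqrt (mul_nonneg h2 (by linarith))

lemma isSelfAdjoint_modularWeight (A : VonNeumannAlgebra H) (Ω : H) :
    IsSelfAdjoint (modularWeight A Ω) := cfc_predicate _ _

/-- The real elemental algebra matters: a conjugate-linear operator commuting with `T (1 - T)`
commutes with its real polynomials and their limits, but not with complex ones in general. -/
lemma modularWeight_mem_elemental (A : VonNeumannAlgebra H) (Ω : H) :
    modularWeight A Ω ∈
      StarAlgebra.elemental ℝ (modularResolvent A Ω * (1 - modularResolvent A Ω)) := by
  have hsa := isSelfAdjoint_modularResolvent A Ω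
  have h1 : modularResolvent A Ω * (1 - modularResolvent A Ω) =
      cfc (fun r : ℝ => r * (1 - r)) (modularResolvent A Ω) := by
    rw [cfc_mul (fun r : ℝ => r) (fun r : ℝ => 1 - r) (modularResolvent A Ω), cfc_sub (fun _ : ℝ => (1 : ℝ)) (fun r : ℝ => r),
      cfc_id' ℝ (modularResolvent A Ω), cfc_const_one ℝ (modularResolvent A Ω)]
  have h2 : modularWeight A Ω =
      cfc (fun r : ℝ => √r) (modularResolvent A Ω * (1 - modularResolvent A Ω)) := by
    rw [h1, modularWeight, ← cfc_comp' (fun r : ℝ => √r) (fun r : ℝ => r * (1 - r)) (modularResolvent A Ω)]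
  rw [h2]
  exact cfc_mem_elemental _ _

lemma modularWeight_injective (hΩ : IsStandardVector A Ω) {x : H} (h : modularWeight A Ω x = 0) :
    x = 0 := by
  have h1 := DFunLike.congr_fun (modularWeight_mul_self A Ω) x
  rw [mul_apply_eq_comp, h, map_zero] at h1
  have h2 : x - modularResolvent A Ω x = 0 := modularResolvent_injective hΩ h1.symm
  exact eq_zero_of_modularResolvent_eq_self hΩ (sub_eq_zero.1 h2).symm

lemma IsSelfAdjoint.denseRange_of_injective {W : H →L[ℂ] H} (hW : IsSelfAdjoint W)
    (h : ∀ x, W x = 0 → x = 0) : DenseRange W := by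
  have : (LinearMap.range (W : H →ₗ[ℂ] H)).topologicalClosure = ⊤ := by
    rw [Submodule.topologicalClosure_eq_top_iff, Submodule.eq_bot_iff]
    intro x hx
    refine h x (ext_inner_left ℂ fun y => ?_)
    rw [inner_zero_right, ← ContinuousLinearMap.inner_star_apply, hW.star_eq]
    exact Submodule.inner_right_of_mem_orthogonal (LinearMap.mem_range_self _ y) hx
  exact Submodule.dense_iff_topologicalClosure_eq_top.2 this

lemma denseRange_modularWeight (hΩ : IsStandardVector A Ω) : DenseRange (modularWeight A Ω) :=
  (isSelfAdjoint_modularWeight A Ω).denseRange_of_injective fun _ => modularWeight_injective hΩ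

/-- Where the cutoff differs from `1`, the function `r (1 - r)` is at most `2 / n`, so multiplying
by `T (1 - T)` turns the pointwise approximation of `1` into a norm approximation. -/
lemma norm_modularCutoff_mul_weight_sub_le (n : ℕ) (hn : 0 < n) :
    ‖modularCc A Ω (modularCutoff n) * (modularResolvent A Ω * (1 - modularResolvent A Ω)) -
      modularResolvent A Ω * (1 - modularResolvent A Ω)‖ ≤ 2 / n := by
  have := (isSelfAdjoint_modularResolvent A Ω).isStarNormal
  have hc := (isCc_modularCutoff n).continuous_comp
  have h1 : modularCc A Ω (modularCutoff n) * (modularResolvent A Ω * (1 - modularResolvent A Ω)) -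
      modularResolvent A Ω * (1 - modularResolvent A Ω) =
      cfc (fun w : ℂ => (modularCutoff n ((1 - w.re) / w.re) - 1) * (w * (1 - w)))
        (modularResolvent A Ω) := by
    rw [cfc_mul (fun w : ℂ => modularCutoff n ((1 - w.re) / w.re) - 1) (fun w : ℂ => w * (1 - w)) _
      (hc.sub continuous_const).continuousOn (by fun_prop), cfc_mul (fun w : ℂ => w) (fun w : ℂ => 1 - w) _ (by fun_prop)
      (by fun_prop), cfc_sub (fun w : ℂ => modularCutoff n ((1 - w.re) / w.re)) (fun _ => 1) _
      hc.continuousOn (by fun_prop), cfc_sub (fun _ : ℂ => (1 : ℂ)) (fun w : ℂ => w),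
      cfc_id' ℂ (modularResolvent A Ω), cfc_const_one ℂ (modularResolvent A Ω), sub_mul, one_mul]
    rfl
  rw [h1]
  have hn' : (0 : ℝ) < n := by exact_mod_cast hn
  refine norm_cfc_le (by positivity) fun w hw => ?_
  obtain ⟨e1, e2, e3⟩ := spectrum_modularResolvent A Ω hw
  set r := w.re with hr
  rw [norm_mul]
  have hnr : ‖w * (1 - w)‖ = r * (1 - r) := by
    rw [e1, ← Complex.ofReal_one, ← Complex.ofReal_sub, ← Complex.ofReal_mul, Complex.norm_real,
      Real.norm_of_nonneg (mul_nonneg e2 (by linarith))]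
  rw [hnr]
  rcases e2.eq_or_lt with h0 | h0
  · rw [← h0, zero_mul, mul_zero]
    positivity
  by_cases hx : 2 ≤ n * ((1 - r) / r / (1 + ((1 - r) / r) ^ 2))
  · rw [modularCutoff_eq_one hx, sub_self, norm_zero, zero_mul]
    positivity
  · push Not at hx
    have h2 : r * (1 - r) ≤ 2 / n := by
      rw [le_div_iff₀ hn']
      -- In terms of `r` the cutoff depends only on this symmetric quotient, whose denominator is at
      -- most `1`.
      have e : (1 - r) / r / (1 + ((1 - r) / r) ^ 2) = r * (1 - r) / (r ^ 2 + (1 - r) ^ 2) := by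
        field_simp
      rw [e, ← mul_div_assoc, div_lt_iff₀ (by positivity)] at hx
      have : r ^ 2 + (1 - r) ^ 2 ≤ 1 := by nlinarith
      nlinarith
    calc _ ≤ 1 * (r * (1 - r)) :=
          mul_le_mul_of_nonneg_right (norm_modularCutoff_sub_one_le _ _)
            (mul_nonneg e2 (by linarith))
      _ ≤ _ := by rwa [one_mul]

lemma denseRange_modularResolvent_mul (hΩ : IsStandardVector A Ω) :
    DenseRange ⇑(modularResolvent A Ω * (1 - modularResolvent A Ω)) := by
  refine IsSelfAdjoint.denseRange_of_injective ?_ fun x hx => ?_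
  · rw [← modularWeight_mul_self]
    have := isSelfAdjoint_modularWeight A Ω
    rw [isSelfAdjoint_iff] at this ⊢
    rw [star_mul, this]
  · rw [← modularWeight_mul_self] at hx
    exact modularWeight_injective hΩ (modularWeight_injective hΩ hx)

/-- The spectral measure of `Δ` lives on `(0, ∞)`: the cutoffs are contractions that converge on the
range of `T (1 - T)`, which is dense because `T` and `1 - T` are injective. Identities for unbounded
functions of `Δ` are checked against these cutoffs. -/
theorem tendsto_modularCutoff (hΩ : IsStandardVector A Ω) (ξ : H) :
    Tendsto (fun n => modularCc A Ω (modularCutoff n) ξ) atTop (𝓝 ξ) := by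
  set R := modularResolvent A Ω * (1 - modularResolvent A Ω) with hR
  have hb : ∀ n x, ‖modularCc A Ω (modularCutoff n) x‖ ≤ 1 * ‖x‖ := fun n x =>
    norm_modularCc_apply_le (isCc_modularCutoff n) (fun y _ => norm_modularCutoff_le n y) x
  rw [Metric.tendsto_atTop]
  intro ε hε
  obtain ⟨ζ, hζ⟩ := (denseRange_modularResolvent_mul hΩ).exists_dist_lt ξ (ε := ε / 3) (by positivity)
  rw [dist_eq_norm] at hζ
  have h0 : Tendsto (fun n : ℕ => 2 / (n : ℝ) * ‖ζ‖) atTop (𝓝 0) := by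
    have := (tendsto_const_div_atTop_nhds_zero_nat 2).mul_const ‖ζ‖
    rwa [zero_mul] at this
  obtain ⟨N, hN⟩ := Filter.eventually_atTop.1 ((h0.eventually_lt_const (show 0 < ε / 3 by positivity)).and
    (eventually_gt_atTop 0))
  refine ⟨N, fun n hn => ?_⟩
  obtain ⟨h1, h2⟩ := hN n hn
  have h3 : ‖modularCc A Ω (modularCutoff n) (R ζ) - R ζ‖ < ε / 3 := by
    refine lt_of_le_of_lt ?_ h1
    have := (modularCc A Ω (modularCutoff n) * R - R).le_of_opNorm_le
      (norm_modularCutoff_mul_weight_sub_le n h2) ζ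
    simpa using this
  have h4 := hb n (ξ - R ζ)
  rw [map_sub, one_mul] at h4
  rw [dist_eq_norm]
  calc _ = ‖(modularCc A Ω (modularCutoff n) ξ - modularCc A Ω (modularCutoff n) (R ζ)) +
        (modularCc A Ω (modularCutoff n) (R ζ) - R ζ) - (ξ - R ζ)‖ := by congr 1; abel
    _ ≤ ‖ξ - R ζ‖ + ‖modularCc A Ω (modularCutoff n) (R ζ) - R ζ‖ + ‖ξ - R ζ‖ :=
        (norm_sub_le _ _).trans (by gcongr; exact (norm_add_le _ _).trans (by gcongr))
    _ < ε := by linarith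

end Resolvent

end FunctionalCalculus

/-! ### Unbounded functions of `Δ`, complex powers and the modular unitary group -/

section ModularFun

variable {H : Type*} [NormedAddCommGroup H] [InnerProductSpace ℂ H] [CompleteSpace H]
  {A : VonNeumannAlgebra H} {Ω : H}

lemma IsModularFun.apply {h : ℝ → ℂ} {ξ η : H} (hξ : IsModularFun A Ω h ξ η) {φ : ℝ → ℂ}
    (hφ : IsCc φ) : modularCc A Ω (fun x => φ x * h x) ξ = modularCc A Ω φ η :=
  hξ φ hφ.continuous hφ.compact hφ.support

lemma isModularFun_of_forall {h : ℝ → ℂ} {ξ η : H}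
    (H : ∀ φ, IsCc φ → modularCc A Ω (fun x => φ x * h x) ξ = modularCc A Ω φ η) :
    IsModularFun A Ω h ξ η :=
  fun φ h1 h2 h3 => H φ ⟨h1, h2, h3⟩

lemma eq_of_forall_modularCc (hΩ : IsStandardVector A Ω) {x y : H}
    (h : ∀ φ, IsCc φ → modularCc A Ω φ x = modularCc A Ω φ y) : x = y := by
  refine tendsto_nhds_unique (tendsto_modularCutoff hΩ x) ?_
  simp only [h _ (isCc_modularCutoff _)]
  exact tendsto_modularCutoff hΩ y

namespace IsModularFun

lemma unique (hΩ : IsStandardVector A Ω) {h : ℝ → ℂ} {ξ η η' : H} (h1 : IsModularFun A Ω h ξ η)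
    (h2 : IsModularFun A Ω h ξ η') : η = η' :=
  eq_of_forall_modularCc hΩ fun _ hφ => (h1.apply hφ).symm.trans (h2.apply hφ)

lemma congr {h g : ℝ → ℂ} (hh : ContinuousOn h (Set.Ioi 0)) (hg : ContinuousOn g (Set.Ioi 0))
    {ξ η : H} (h1 : IsModularFun A Ω h ξ η) (e : ∀ x, 0 < x → h x = g x) :
    IsModularFun A Ω g ξ η :=
  isModularFun_of_forall fun φ hφ => by
    rw [← h1.apply hφ]
    exact DFunLike.congr_fun (modularCc_congr (hφ.mul hg) (hφ.mul hh) fun x hx => by rw [e x hx]) ξ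

lemma add {h : ℝ → ℂ} {ξ η ξ' η' : H} (h1 : IsModularFun A Ω h ξ η)
    (h2 : IsModularFun A Ω h ξ' η') : IsModularFun A Ω h (ξ + ξ') (η + η') :=
  isModularFun_of_forall fun φ hφ => by rw [map_add, map_add, h1.apply hφ, h2.apply hφ]

lemma smul {h : ℝ → ℂ} {ξ η : H} (c : ℂ) (h1 : IsModularFun A Ω h ξ η) :
    IsModularFun A Ω h (c • ξ) (c • η) :=
  isModularFun_of_forall fun φ hφ => by rw [map_smul, map_smul, h1.apply hφ]

lemma sub {h : ℝ → ℂ} {ξ η ξ' η' : H} (h1 : IsModularFun A Ω h ξ η)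
    (h2 : IsModularFun A Ω h ξ' η') : IsModularFun A Ω h (ξ - ξ') (η - η') :=
  isModularFun_of_forall fun φ hφ => by rw [map_sub, map_sub, h1.apply hφ, h2.apply hφ]

lemma zero (h : ℝ → ℂ) : IsModularFun A Ω h 0 0 :=
  isModularFun_of_forall fun φ hφ => by rw [map_zero, map_zero]

lemma fun_add {h g : ℝ → ℂ} (hh : ContinuousOn h (Set.Ioi 0)) (hg : ContinuousOn g (Set.Ioi 0))
    {ξ η η' : H} (h1 : IsModularFun A Ω h ξ η) (h2 : IsModularFun A Ω g ξ η') :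
    IsModularFun A Ω (fun x => h x + g x) ξ (η + η') :=
  isModularFun_of_forall fun φ hφ => by
    simp only [mul_add]
    rw [modularCc_add (hφ.mul hh) (hφ.mul hg), map_add, ← h1.apply hφ, ← h2.apply hφ]
    rfl

lemma const (c : ℂ) (ξ : H) : IsModularFun A Ω (fun _ => c) ξ (c • ξ) :=
  isModularFun_of_forall fun φ _ => by
    simp only [mul_comm _ c]
    rw [modularCc_const_mul, map_smul]
    rfl

lemma one (ξ : H) : IsModularFun A Ω (fun _ => 1) ξ ξ := by
  have := const (A := A) (Ω := Ω) 1 ξ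
  rwa [one_smul] at this

lemma comp {h g : ℝ → ℂ} (hg : ContinuousOn g (Set.Ioi 0)) {ξ η ζ : H}
    (h1 : IsModularFun A Ω h ξ η) (h2 : IsModularFun A Ω g η ζ) :
    IsModularFun A Ω (fun x => g x * h x) ξ ζ :=
  isModularFun_of_forall fun φ hφ => by
    rw [← h2.apply hφ, ← h1.apply (hφ.mul hg)]
    simp only [mul_assoc]

lemma cc {h : ℝ → ℂ} (hh : ContinuousOn h (Set.Ioi 0)) {φ : ℝ → ℂ} (hφ : IsCc φ) (ξ : H) :
    IsModularFun A Ω h (modularCc A Ω φ ξ) (modularCc A Ω (fun x => φ x * h x) ξ) :=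
  isModularFun_of_forall fun ψ hψ => by
    rw [← modularCc_mul_apply (hψ.mul hh) hφ, ← modularCc_mul_apply hψ (hφ.mul hh)]
    congr 2
    ext x
    ring

/-- A bounded operator which commutes with all `φ(Δ)` preserves the graph of `h(Δ)`. -/
lemma map {h : ℝ → ℂ} (hh : ContinuousOn h (Set.Ioi 0)) {ξ η : H} (h1 : IsModularFun A Ω h ξ η)
    {P : H →L[ℂ] H} (hP : ∀ φ, IsCc φ → ∀ x, modularCc A Ω φ (P x) = P (modularCc A Ω φ x)) :
    IsModularFun A Ω h (P ξ) (P η) :=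
  isModularFun_of_forall fun φ hφ => by
    rw [hP _ hφ, hP _ (hφ.mul hh), h1.apply hφ]

/-- The relation `h(Δ)* = conj h (Δ)` on the two domains: real cutoffs reduce it to bounded
operators, where conjugating the function gives the adjoint. -/
lemma inner_eq (hΩ : IsStandardVector A Ω) {h : ℝ → ℂ} {ξ η ξ' η' : H} (h1 : IsModularFun A Ω h ξ η)
    (h2 : IsModularFun A Ω (fun x => conj (h x)) ξ' η') : ⟪η', ξ⟫_ℂ = ⟪ξ', η⟫_ℂ := by
  have l1 := (tendsto_modularCutoff hΩ η').inner (𝕜 := ℂ) (tendsto_const_nhds (x := ξ))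
  have l2 := (tendsto_const_nhds (x := ξ')).inner (𝕜 := ℂ) (tendsto_modularCutoff hΩ η)
  refine tendsto_nhds_unique l1 (l2.congr fun n => ?_)
  have hn := isCc_modularCutoff n
  have hc : (fun x => conj (modularCutoff n x)) = modularCutoff n := by
    ext x
    rw [modularCutoff, Complex.conj_ofReal]
  rw [← h1.apply hn, ← h2.apply hn]
  have : (fun x => modularCutoff n x * h x) = fun x => conj (modularCutoff n x * conj (h x)) := by
    ext x
    rw [map_mul, Complex.conj_conj, congrFun hc x]
  rw [this, ← inner_modularCc_left]

end IsModularFun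

lemma isModularFun_resolvent (ξ : H) :
    IsModularFun A Ω (fun x => ((1 / (1 + x) : ℝ) : ℂ)) ξ (modularResolvent A Ω ξ) :=
  isModularFun_of_forall fun _ hφ => (modularCc_resolvent hφ ξ).symm

lemma isModularFun_weight (ξ : H) :
    IsModularFun A Ω (fun x => ((√x / (1 + x) : ℝ) : ℂ)) ξ (modularWeight A Ω ξ) :=
  isModularFun_of_forall fun _ hφ => (modularCc_weight hφ ξ).symm

/-- Bounded continuous functions of the modular operator are everywhere defined. -/
theorem exists_isModularFun_of_bounded (hΩ : IsStandardVector A Ω) {q : ℝ → ℂ}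
    (hq : ContinuousOn q (Set.Ioi 0)) {C : ℝ} (hC : ∀ x, 0 < x → ‖q x‖ ≤ C) :
    ∃ Q : H →L[ℂ] H, (∀ ξ, IsModularFun A Ω q ξ (Q ξ)) ∧ ∀ ξ, ‖Q ξ‖ ≤ C * ‖ξ‖ := by
  have hC0 : 0 ≤ C := (norm_nonneg _).trans (hC 1 one_pos)
  have hcq := fun n => (isCc_modularCutoff n).mul hq
  have hb : ∀ n ξ, ‖modularCc A Ω (fun x => modularCutoff n x * q x) ξ‖ ≤ C * ‖ξ‖ := fun n ξ =>
    norm_modularCc_apply_le (hcq n) (fun x hx => by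
      rw [norm_mul]
      exact (mul_le_mul (norm_modularCutoff_le n x) (hC x hx) (norm_nonneg _) zero_le_one).trans_eq
        (one_mul C)) ξ
  have ex : ∀ ξ, ∃ η, IsModularFun A Ω q ξ η ∧ ‖η‖ ≤ C * ‖ξ‖ := by
    intro ξ
    have hcau : CauchySeq fun n => modularCc A Ω (fun x => modularCutoff n x * q x) ξ := by
      rw [Metric.cauchySeq_iff]
      intro ε hε
      -- The cut-off functions of `q` are uniformly bounded operators, so convergence is only needed
      -- on a nearby vector `χ_k(Δ)ξ`; there it reduces to convergence of the cutoffs on `(χ_k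
      -- q)(Δ)ξ`.
      obtain ⟨k, hk⟩ := ((tendsto_iff_norm_sub_tendsto_zero.1
        (tendsto_modularCutoff hΩ ξ)).eventually_lt_const
        (show 0 < ε / (4 * (C + 1)) by positivity)).exists
      have hl := tendsto_modularCutoff hΩ (modularCc A Ω (fun x => modularCutoff k x * q x) ξ)
      obtain ⟨N, hN⟩ := eventually_atTop.1 ((tendsto_iff_norm_sub_tendsto_zero.1 hl).eventually_lt_const
        (show 0 < ε / 4 by positivity))
      have key : ∀ n ≥ N, ‖modularCc A Ω (fun x => modularCutoff n x * q x) ξ -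
          modularCc A Ω (fun x => modularCutoff k x * q x) ξ‖ < ε / 2 := by
        intro n hn
        have e1 : modularCc A Ω (fun x => modularCutoff n x * q x) (modularCc A Ω (modularCutoff k) ξ) =
            modularCc A Ω (modularCutoff n) (modularCc A Ω (fun x => modularCutoff k x * q x) ξ) := by
          rw [← modularCc_mul_apply (hcq n) (isCc_modularCutoff k),
            ← modularCc_mul_apply (isCc_modularCutoff n) (hcq k)]
          congr 2
          ext x
          ring
        have e2 := hb n (modularCc A Ω (modularCutoff k) ξ - ξ)
        rw [map_sub, e1] at e2
        have e3 := hN n hn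
        have e4 : C * ‖modularCc A Ω (modularCutoff k) ξ - ξ‖ ≤ ε / 4 := by
          calc _ ≤ (C + 1) * (ε / (4 * (C + 1))) := by gcongr; linarith
            _ = ε / 4 := by field_simp
        set a := modularCc A Ω (fun x => modularCutoff n x * q x) ξ
        set b := modularCc A Ω (fun x => modularCutoff k x * q x) ξ
        set c := modularCc A Ω (modularCutoff n) b
        calc ‖a - b‖ = ‖(c - b) - (c - a)‖ := by congr 1; abel
          _ ≤ ‖c - b‖ + ‖c - a‖ := norm_sub_le _ _
          _ < ε / 2 := by linarith
      refine ⟨N, fun m hm n hn => ?_⟩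
      set b := modularCc A Ω (fun x => modularCutoff k x * q x) ξ
      have := dist_triangle_right (modularCc A Ω (fun x => modularCutoff m x * q x) ξ)
        (modularCc A Ω (fun x => modularCutoff n x * q x) ξ) b
      rw [dist_eq_norm _ b, dist_eq_norm _ b] at this
      linarith [key m hm, key n hn]
    obtain ⟨η, hη⟩ := cauchySeq_tendsto_of_complete hcau
    refine ⟨η, isModularFun_of_forall fun φ hφ => ?_, le_of_tendsto hη.norm
      (Eventually.of_forall fun n => hb n ξ)⟩
    have l1 := ((modularCc A Ω φ).continuous.tendsto _).comp hη
    refine tendsto_nhds_unique (tendsto_modularCutoff hΩ _) (l1.congr fun n => ?_)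
    rw [Function.comp_apply, ← modularCc_mul_apply hφ (hcq n),
      ← modularCc_mul_apply (isCc_modularCutoff n) (hφ.mul hq)]
    congr 2
    ext x
    ring
  choose Q hQ hQn using ex
  let L : H →ₗ[ℂ] H :=
    { toFun := Q
      map_add' := fun x y => (hQ _).unique hΩ ((hQ x).add (hQ y))
      map_smul' := fun c x => (hQ _).unique hΩ ((hQ x).smul c) }
  exact ⟨L.mkContinuous C hQn, hQ, hQn⟩

/-- If `|g| ≤ C (1 + h)` for a nonnegative function `h`, then the domain of `h(Δ)` is contained in
the domain of `g(Δ)`. -/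
lemma IsModularFun.exists_of_le (hΩ : IsStandardVector A Ω) {h : ℝ → ℝ} {g : ℝ → ℂ}
    (hh : ContinuousOn h (Set.Ioi 0)) (hg : ContinuousOn g (Set.Ioi 0)) {C : ℝ}
    (h0 : ∀ x, 0 < x → 0 ≤ h x) (hle : ∀ x, 0 < x → ‖g x‖ ≤ C * (1 + h x)) {ξ η : H}
    (h1 : IsModularFun A Ω (fun x => (h x : ℂ)) ξ η) : ∃ ζ, IsModularFun A Ω g ξ ζ := by
  have hne : ∀ x ∈ Set.Ioi (0 : ℝ), (1 + (h x : ℂ)) ≠ 0 := fun x hx => by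
    have := h0 x hx
    exact_mod_cast (by positivity : (1 + h x : ℝ) ≠ 0)
  have hh' : ContinuousOn (fun x => (h x : ℂ)) (Set.Ioi 0) :=
    Complex.continuous_ofReal.comp_continuousOn hh
  have hs : ContinuousOn (fun x => 1 + (h x : ℂ)) (Set.Ioi 0) := continuousOn_const.add hh'
  have hq : ContinuousOn (fun x => g x / (1 + (h x : ℂ))) (Set.Ioi 0) := hg.div hs hne
  obtain ⟨Q, hQ, -⟩ := exists_isModularFun_of_bounded hΩ hq (C := C) fun x hx => by
    have := h0 x hx
    have e : ‖1 + (h x : ℂ)‖ = 1 + h x := by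
      rw [← Complex.ofReal_one, ← Complex.ofReal_add, Complex.norm_real, Real.norm_of_nonneg]
      positivity
    rw [norm_div, e, div_le_iff₀ (by positivity)]
    exact hle x hx
  exact ⟨_, (((IsModularFun.one ξ).fun_add continuousOn_const hh' h1).comp hq (hQ _)).congr
    (hq.mul hs) hg fun x hx => div_mul_cancel₀ _ (hne x hx)⟩

section Cpow

lemma continuousOn_ofReal_cpow (z : ℂ) : ContinuousOn (fun x : ℝ => (x : ℂ) ^ z) (Set.Ioi 0) :=
  fun x hx => (Complex.continuousAt_ofReal_cpow_const x z (Or.inr (ne_of_gt hx))).continuousWithinAt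

lemma norm_ofReal_cpow {x : ℝ} (hx : 0 < x) (z : ℂ) : ‖(x : ℂ) ^ z‖ = x ^ z.re :=
  Complex.norm_cpow_eq_rpow_re_of_pos hx z

lemma conj_ofReal_cpow {x : ℝ} (hx : 0 < x) (z : ℂ) : conj ((x : ℂ) ^ z) = (x : ℂ) ^ conj z := by
  rw [Complex.cpow_conj _ _ (by rw [Complex.arg_ofReal_of_nonneg hx.le]; exact Real.pi_pos.ne),
    Complex.conj_ofReal]

lemma ofReal_cpow_add {x : ℝ} (hx : 0 < x) (z w : ℂ) :
    (x : ℂ) ^ (z + w) = (x : ℂ) ^ z * (x : ℂ) ^ w :=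
  Complex.cpow_add _ _ (by exact_mod_cast hx.ne')

end Cpow

section Pow

variable (hΩ : IsStandardVector A Ω)

/-- The modular unitary group `Δ ^ (i t)`. -/
noncomputable def modularUnitary {A : VonNeumannAlgebra H} {Ω : H} (hΩ : IsStandardVector A Ω)
    (t : ℝ) : H →L[ℂ] H :=
  (exists_isModularFun_of_bounded hΩ (continuousOn_ofReal_cpow (Complex.I * t)) (C := 1)
    fun x hx => by rw [norm_ofReal_cpow hx]; simp).choose

lemma isModularPow_modularUnitary (t : ℝ) (ξ : H) :
    IsModularPow A Ω (Complex.I * t) ξ (modularUnitary hΩ t ξ) :=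
  (exists_isModularFun_of_bounded hΩ (continuousOn_ofReal_cpow (Complex.I * t)) (C := 1)
    fun x hx => by rw [norm_ofReal_cpow hx]; simp).choose_spec.1 ξ

lemma IsModularPow.comp {z w : ℂ} {ξ η ζ : H} (h1 : IsModularPow A Ω z ξ η)
    (h2 : IsModularPow A Ω w η ζ) : IsModularPow A Ω (w + z) ξ ζ :=
  (IsModularFun.comp (continuousOn_ofReal_cpow w) h1 h2).congr
    ((continuousOn_ofReal_cpow w).mul (continuousOn_ofReal_cpow z)) (continuousOn_ofReal_cpow _)
    fun _ hx => (ofReal_cpow_add hx w z).symm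

lemma isModularPow_zero (ξ : H) : IsModularPow A Ω 0 ξ ξ := by
  have := IsModularFun.one (A := A) (Ω := Ω) ξ
  simpa [IsModularPow] using this

lemma modularUnitary_add (s t : ℝ) (ξ : H) :
    modularUnitary hΩ (s + t) ξ = modularUnitary hΩ s (modularUnitary hΩ t ξ) := by
  have h1 := (isModularPow_modularUnitary hΩ t ξ).comp (isModularPow_modularUnitary hΩ s _)
  have h2 := isModularPow_modularUnitary hΩ (s + t) ξ
  rw [Complex.ofReal_add, mul_add] at h2
  exact IsModularFun.unique hΩ h2 h1

lemma modularUnitary_zero (ξ : H) : modularUnitary hΩ 0 ξ = ξ := by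
  have h1 := isModularPow_modularUnitary hΩ 0 ξ
  rw [Complex.ofReal_zero, mul_zero] at h1
  exact IsModularFun.unique hΩ h1 (isModularPow_zero ξ)

lemma modularUnitary_neg_apply (t : ℝ) (ξ : H) :
    modularUnitary hΩ (-t) (modularUnitary hΩ t ξ) = ξ := by
  rw [← modularUnitary_add, neg_add_cancel, modularUnitary_zero]

lemma modularUnitary_apply_neg (t : ℝ) (ξ : H) :
    modularUnitary hΩ t (modularUnitary hΩ (-t) ξ) = ξ := by
  rw [← modularUnitary_add, add_neg_cancel, modularUnitary_zero]

lemma inner_modularUnitary_left (t : ℝ) (x y : H) :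
    ⟪modularUnitary hΩ t x, y⟫_ℂ = ⟪x, modularUnitary hΩ (-t) y⟫_ℂ := by
  refine IsModularFun.inner_eq hΩ (isModularPow_modularUnitary hΩ (-t) y) ?_
  refine (isModularPow_modularUnitary hΩ t x).congr (continuousOn_ofReal_cpow _)
    (Complex.continuous_conj.comp_continuousOn (continuousOn_ofReal_cpow _)) fun x hx => ?_
  rw [Function.comp_apply, conj_ofReal_cpow hx]
  simp

lemma norm_modularUnitary (t : ℝ) (x : H) : ‖modularUnitary hΩ t x‖ = ‖x‖ := by
  have : ⟪modularUnitary hΩ t x, modularUnitary hΩ t x⟫_ℂ = ⟪x, x⟫_ℂ := by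
    rw [inner_modularUnitary_left, modularUnitary_neg_apply]
  rw [inner_self_eq_norm_sq_to_K, inner_self_eq_norm_sq_to_K] at this
  have h : ‖modularUnitary hΩ t x‖ ^ 2 = ‖x‖ ^ 2 := by exact_mod_cast this
  exact (sq_eq_sq₀ (norm_nonneg _) (norm_nonneg _)).1 h

lemma modularUnitary_modularCc (t : ℝ) {φ : ℝ → ℂ} (hφ : IsCc φ) (ξ : H) :
    modularUnitary hΩ t (modularCc A Ω φ ξ) =
      modularCc A Ω (fun x => φ x * (x : ℂ) ^ (Complex.I * t)) ξ :=
  IsModularFun.unique hΩ (isModularPow_modularUnitary hΩ t _)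
    (IsModularFun.cc (continuousOn_ofReal_cpow _) hφ ξ)

lemma modularCc_modularUnitary (t : ℝ) {φ : ℝ → ℂ} (hφ : IsCc φ) (ξ : H) :
    modularCc A Ω φ (modularUnitary hΩ t ξ) = modularUnitary hΩ t (modularCc A Ω φ ξ) := by
  rw [modularUnitary_modularCc hΩ t hφ, ← (isModularPow_modularUnitary hΩ t ξ).apply hφ]

/-- The operators `φ(Δ) Δ ^ z` depend holomorphically on `z`. -/
theorem differentiable_modularCc_cpow (A : VonNeumannAlgebra H) (Ω : H) {φ : ℝ → ℂ} (hφ : IsCc φ) :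
    Differentiable ℂ fun z : ℂ => modularCc A Ω fun x => φ x * (x : ℂ) ^ z := by
  have hsa := (isSelfAdjoint_modularResolvent A Ω).isStarNormal
  -- Where `φ ≠ 0` the logarithm agrees with its cut-off version `L`, a bounded operator. There
  -- `Δ^z` becomes the entire function `exp (z L)`.
  obtain ⟨n, hn⟩ := hφ.exists_cutoff
  have hlog : ContinuousOn (fun x : ℝ => (Real.log x : ℂ)) (Set.Ioi 0) :=
    Complex.continuous_ofReal.comp_continuousOn
      (Real.continuousOn_log.mono fun x hx => ne_of_gt hx)
  have hL := (isCc_modularCutoff n).mul hlog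
  set L := modularCc A Ω fun x => modularCutoff n x * (Real.log x : ℂ) with hLdef
  have key : ∀ z : ℂ, modularCc A Ω (fun x => φ x * (x : ℂ) ^ z) =
      modularCc A Ω φ * NormedSpace.exp (z • L) := by
    intro z
    have e1 : z • L = cfc (fun w : ℂ => z * (modularCutoff n ((1 - w.re) / w.re) *
        (Real.log ((1 - w.re) / w.re) : ℂ))) (modularResolvent A Ω) :=
      (cfc_const_mul z _ _ hL.continuous_comp.continuousOn).symm
    have hn' : IsStarNormal (z • L) := by rw [e1]; exact cfc_predicate _ _
    rw [← CFC.complex_exp_eq_normedSpace_exp hn', e1,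
      ← cfc_comp' Complex.exp (fun w : ℂ => z * (modularCutoff n ((1 - w.re) / w.re) *
        (Real.log ((1 - w.re) / w.re) : ℂ))) (modularResolvent A Ω) (by fun_prop)
        (continuous_const.mul hL.continuous_comp).continuousOn, modularCc, modularCc,
      ← cfc_mul _ (fun w : ℂ => Complex.exp (z * (modularCutoff n ((1 - w.re) / w.re) *
        (Real.log ((1 - w.re) / w.re) : ℂ)))) _ hφ.continuous_comp.continuousOn
        (Complex.continuous_exp.comp (continuous_const.mul hL.continuous_comp)).continuousOn]
    congr 1
    ext w
    set x := (1 - w.re) / w.re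
    by_cases hx : φ x = 0
    · simp [hx]
    · have hx0 : 0 < x := by
        by_contra! h
        exact hx (hφ.eq_zero h)
      have hx1 : (x : ℂ) ≠ 0 := by exact_mod_cast hx0.ne'
      rw [hn x hx, one_mul, Complex.cpow_def_of_ne_zero hx1, ← Complex.ofReal_log hx0.le, mul_comm z]
  simp only [key]
  intro z
  exact (hasDerivAt_exp_smul_const (𝕂 := ℂ) L z).differentiableAt.const_mul _

/-- For `|Re z| ≤ 1` one has `|x^z| ≤ x + x⁻¹`, which is bounded against `φ`. This supplies the
uniform bound on a strip required by the Poisson formula. -/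
lemma IsCc.exists_norm_mul_cpow_le {φ : ℝ → ℂ} (hφ : IsCc φ) :
    ∃ C, ∀ z : ℂ, |z.re| ≤ 1 → ∀ x, 0 < x → ‖φ x * (x : ℂ) ^ z‖ ≤ C := by
  have h1 : ContinuousOn (fun x : ℝ => ((x + x⁻¹ : ℝ) : ℂ)) (Set.Ioi 0) :=
    Complex.continuous_ofReal.comp_continuousOn
      (continuousOn_id.add (continuousOn_inv₀.mono fun x hx => ne_of_gt hx))
  obtain ⟨C, hC⟩ := (hφ.mul h1).exists_norm_le
  refine ⟨C, fun z hz x hx => le_trans ?_ (hC x)⟩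
  rw [norm_mul, norm_mul, norm_ofReal_cpow hx, Complex.norm_real, Real.norm_of_nonneg (by positivity)]
  gcongr
  obtain ⟨h2, h3⟩ := abs_le.1 hz
  rcases le_total 1 x with h | h
  · calc x ^ z.re ≤ x ^ (1 : ℝ) := Real.rpow_le_rpow_of_exponent_le h h3
      _ ≤ _ := by rw [Real.rpow_one]; linarith [inv_pos.2 hx]
  · calc x ^ z.re ≤ x ^ (-1 : ℝ) := Real.rpow_le_rpow_of_exponent_ge hx h h2
      _ ≤ _ := by rw [Real.rpow_neg_one]; linarith

/-- On cut-off vectors the orbit is holomorphic in `t`, and unitarity makes the approximation by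
such vectors uniform in `t`. -/
lemma continuous_modularUnitary_apply (ξ : H) : Continuous fun t : ℝ => modularUnitary hΩ t ξ := by
  have h1 : ∀ n, Continuous fun t : ℝ => modularUnitary hΩ t (modularCc A Ω (modularCutoff n) ξ) := by
    intro n
    simp only [modularUnitary_modularCc hΩ _ (isCc_modularCutoff n)]
    have := (differentiable_modularCc_cpow A Ω (isCc_modularCutoff n)).continuous
    have h2 : Continuous fun t : ℝ => modularCc A Ω
        (fun x => modularCutoff n x * (x : ℂ) ^ (Complex.I * t)) :=
      this.comp (by fun_prop : Continuous fun t : ℝ => Complex.I * (t : ℂ))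
    exact h2.clm_apply continuous_const
  have h3 : TendstoUniformly (fun n (t : ℝ) => modularUnitary hΩ t (modularCc A Ω (modularCutoff n) ξ))
      (fun t => modularUnitary hΩ t ξ) atTop := by
    rw [Metric.tendstoUniformly_iff]
    intro ε hε
    have := (tendsto_iff_norm_sub_tendsto_zero.1 (tendsto_modularCutoff hΩ ξ)).eventually_lt_const hε
    filter_upwards [this] with n hn t
    rw [dist_comm, dist_eq_norm, ← map_sub, norm_modularUnitary]
    exact hn
  exact h3.continuous (Frequently.of_forall h1)

end Pow

end ModularFun

/-! ### The modular conjugation and the polar decomposition of `S` -/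

section ModularConjugation

variable {H : Type*} [NormedAddCommGroup H] [InnerProductSpace ℂ H] [CompleteSpace H]
  {A : VonNeumannAlgebra H} {Ω : H}

lemma modularResolvent_weight_comm (A : VonNeumannAlgebra H) (Ω ξ : H) :
    modularResolvent A Ω (modularWeight A Ω ξ) = modularWeight A Ω (modularResolvent A Ω ξ) := by
  have hsa := isSelfAdjoint_modularResolvent A Ω
  have h := cfc_commute_cfc (fun r : ℝ => r) (fun r : ℝ => √(r * (1 - r))) (modularResolvent A Ω)
  rw [cfc_id' ℝ (modularResolvent A Ω)] at h
  exact DFunLike.congr_fun h ξ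

lemma modularWeight_weight (A : VonNeumannAlgebra H) (Ω ξ : H) :
    modularWeight A Ω (modularWeight A Ω ξ) =
      modularResolvent A Ω ξ - modularResolvent A Ω (modularResolvent A Ω ξ) := by
  have := DFunLike.congr_fun (modularWeight_mul_self A Ω) ξ
  simpa using this

lemma inner_modularWeight_left (A : VonNeumannAlgebra H) (Ω x y : H) :
    ⟪modularWeight A Ω x, y⟫_ℂ = ⟪x, modularWeight A Ω y⟫_ℂ := by
  rw [← ContinuousLinearMap.inner_star_apply, (isSelfAdjoint_modularWeight A Ω).star_eq]

lemma modularWeight_commutant (hΩ : IsStandardVector A Ω) :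
    modularWeight A.commutant Ω = modularWeight A Ω := by
  have h : ∀ A : VonNeumannAlgebra H, modularWeight A Ω =
      cfc (fun r : ℝ => √r) (modularResolvent A Ω * (1 - modularResolvent A Ω)) := by
    intro A
    have hsa := isSelfAdjoint_modularResolvent A Ω
    have h1 : modularResolvent A Ω * (1 - modularResolvent A Ω) =
        cfc (fun r : ℝ => r * (1 - r)) (modularResolvent A Ω) := by
      rw [cfc_mul (fun r : ℝ => r) (fun r : ℝ => 1 - r) (modularResolvent A Ω),
        cfc_sub (fun _ : ℝ => (1 : ℝ)) (fun r : ℝ => r),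
        cfc_id' ℝ (modularResolvent A Ω), cfc_const_one ℝ (modularResolvent A Ω)]
    rw [h1, modularWeight,
      ← cfc_comp' (fun r : ℝ => √r) (fun r : ℝ => r * (1 - r)) (modularResolvent A Ω)]
  rw [h, h, modularResolvent_commutant hΩ, sub_sub_cancel]
  congr 1
  noncomm_ring

/-- The conjugate-linear operator `S (1 + Δ)⁻¹`. -/
noncomputable def tomitaResolvent (hΩ : IsStandardVector A Ω) : H →ₛₗ[starRingEnd ℂ] H where
  toFun ξ := (exists_modularResolvent_eq hΩ ξ).choose
  map_add' x y := by
    refine tomitaGraph_unique hΩ (exists_modularResolvent_eq hΩ (x + y)).choose_spec.1 ?_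
    have := tomitaGraph_add (exists_modularResolvent_eq hΩ x).choose_spec.1
      (exists_modularResolvent_eq hΩ y).choose_spec.1
    rwa [Prod.mk_add_mk, ← map_add] at this
  map_smul' c x := by
    refine tomitaGraph_unique hΩ (exists_modularResolvent_eq hΩ (c • x)).choose_spec.1 ?_
    have := tomitaGraph_smul c (exists_modularResolvent_eq hΩ x).choose_spec.1
    rwa [← map_smul] at this

lemma tomitaResolvent_spec (hΩ : IsStandardVector A Ω) (ξ : H) :
    (modularResolvent A Ω ξ, tomitaResolvent hΩ ξ) ∈ tomitaGraph A Ω ∧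
      (tomitaResolvent hΩ ξ, ξ - modularResolvent A Ω ξ) ∈ tomitaGraph A.commutant Ω :=
  (exists_modularResolvent_eq hΩ ξ).choose_spec

/-- The form of `S T` is `T Δ T = T (1 - T) = W²`, with `W` the modular weight. Hence `W ξ ↦ S T ξ`
is conjugate-isometric on the dense range of `W`, and its extension is `J`. -/
lemma inner_tomitaResolvent (hΩ : IsStandardVector A Ω) (ξ η : H) :
    ⟪tomitaResolvent hΩ ξ, tomitaResolvent hΩ η⟫_ℂ = ⟪modularWeight A Ω η, modularWeight A Ω ξ⟫_ℂ := by
  obtain ⟨h1, -⟩ := tomitaResolvent_spec hΩ ξ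
  obtain ⟨-, h2⟩ := tomitaResolvent_spec hΩ η
  have h3 := inner_eq_of_mem_tomitaGraph h1 h2
  rw [h3, inner_modularWeight_left, modularWeight_weight]
  simp only [inner_sub_left, inner_sub_right, inner_modularResolvent_left]

/-- The modular conjugation `J`, the antiunitary part of the Tomita operator. -/
noncomputable def modularConjugation (hΩ : IsStandardVector A Ω) : H →SL[starRingEnd ℂ] H :=
  (tomitaResolvent hΩ).extendOfNorm (modularWeight A Ω : H →ₗ[ℂ] H)

lemma modularConjugation_weight (hΩ : IsStandardVector A Ω) (ξ : H) :
    modularConjugation hΩ (modularWeight A Ω ξ) = tomitaResolvent hΩ ξ := by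
  refine LinearMap.extendOfNorm_eq (e := (modularWeight A Ω : H →ₗ[ℂ] H))
    (denseRange_modularWeight hΩ) ⟨1, fun x => ?_⟩ ξ
  have h := inner_tomitaResolvent hΩ x x
  rw [inner_self_eq_norm_sq_to_K, inner_self_eq_norm_sq_to_K] at h
  have h' : ‖tomitaResolvent hΩ x‖ ^ 2 = ‖modularWeight A Ω x‖ ^ 2 := by exact_mod_cast h
  rw [one_mul]
  exact ((sq_eq_sq₀ (norm_nonneg _) (norm_nonneg _)).1 h').le

lemma modularConjugation_weight_mem (hΩ : IsStandardVector A Ω) (ξ : H) :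
    (modularResolvent A Ω ξ, modularConjugation hΩ (modularWeight A Ω ξ)) ∈ tomitaGraph A Ω ∧
      (modularConjugation hΩ (modularWeight A Ω ξ), ξ - modularResolvent A Ω ξ) ∈
        tomitaGraph A.commutant Ω := by
  rw [modularConjugation_weight]
  exact tomitaResolvent_spec hΩ ξ

lemma inner_modularConjugation (hΩ : IsStandardVector A Ω) (x y : H) :
    ⟪modularConjugation hΩ x, modularConjugation hΩ y⟫_ℂ = ⟪y, x⟫_ℂ := by
  refine (denseRange_modularWeight hΩ).induction_on₂ (p := fun x y =>
    ⟪modularConjugation hΩ x, modularConjugation hΩ y⟫_ℂ = ⟪y, x⟫_ℂ)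
    (isClosed_eq (by fun_prop) (by fun_prop)) (fun ξ η => ?_) x y
  rw [modularConjugation_weight, modularConjugation_weight, inner_tomitaResolvent]

lemma modularConjugation_weight_of_mem (hΩ : IsStandardVector A Ω) {x y : H}
    (h : (x, y) ∈ tomitaGraph A Ω) :
    modularConjugation hΩ (modularWeight A Ω x) = y - modularResolvent A Ω y :=
  tomitaGraph_unique hΩ (modularConjugation_weight_mem hΩ x).1 (modularResolvent_intertwine hΩ h).1

/-- The bounded form of `J Δ J = Δ⁻¹`. It follows on the range of the weight from the intertwining
of `S` with the resolvent. -/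
lemma modularConjugation_resolvent (hΩ : IsStandardVector A Ω) (x : H) :
    modularConjugation hΩ (modularResolvent A Ω x) =
      modularConjugation hΩ x - modularResolvent A Ω (modularConjugation hΩ x) := by
  refine (denseRange_modularWeight hΩ).induction_on (p := fun x =>
    modularConjugation hΩ (modularResolvent A Ω x) =
      modularConjugation hΩ x - modularResolvent A Ω (modularConjugation hΩ x)) x
    (isClosed_eq (by fun_prop) (by fun_prop)) fun ξ => ?_
  rw [modularResolvent_weight_comm,
    modularConjugation_weight_of_mem hΩ (modularConjugation_weight_mem hΩ ξ).1]

lemma modularConjugation_weight_comm (hΩ : IsStandardVector A Ω) (ξ : H) :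
    modularConjugation hΩ (modularWeight A Ω ξ) = modularWeight A Ω (modularConjugation hΩ ξ) := by
  set J := modularConjugation hΩ
  -- The operators commuting with `J` together with their adjoints form a norm-closed real algebra.
  -- It contains `T (1 - T)`, since `J` exchanges `T` and `1 - T`, and hence also the square root
  -- `W`.
  let S : StarSubalgebra ℝ (H →L[ℂ] H) :=
    { carrier := {X | (∀ x, J (X x) = X (J x)) ∧ ∀ x, J (star X x) = star X (J x)}
      mul_mem' := fun {X Y} hX hY => ⟨fun x => by
        rw [mul_apply_eq_comp, hX.1, hY.1, mul_apply_eq_comp], fun x => by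
        rw [star_mul, mul_apply_eq_comp, hY.2, hX.2, mul_apply_eq_comp]⟩
      add_mem' := fun {X Y} hX hY => ⟨fun x => by
        rw [add_apply, map_add, hX.1, hY.1, add_apply], fun x => by
        rw [star_add, add_apply, map_add, hX.2, hY.2, add_apply]⟩
      algebraMap_mem' := fun r => by
        have h : ∀ x : H, (algebraMap ℝ (H →L[ℂ] H) r) x = (r : ℂ) • x := fun x => by
          rw [Algebra.algebraMap_eq_smul_one]
          simp
        have h2 : star (algebraMap ℝ (H →L[ℂ] H) r) = algebraMap ℝ (H →L[ℂ] H) r := by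
          rw [← algebraMap_star_comm, star_trivial]
        have h3 : ∀ x, J (algebraMap ℝ (H →L[ℂ] H) r x) = algebraMap ℝ (H →L[ℂ] H) r (J x) :=
          fun x => by rw [h, h, map_smulₛₗ, Complex.conj_ofReal]
        exact ⟨h3, by rwa [h2]⟩
      star_mem' := fun {X} hX => ⟨hX.2, by rw [star_star]; exact hX.1⟩ }
  have hS : IsClosed (S : Set (H →L[ℂ] H)) := by
    have : (S : Set (H →L[ℂ] H)) =
        (⋂ x, {X | J (X x) = X (J x)}) ∩ ⋂ x, {X : H →L[ℂ] H | J (star X x) = star X (J x)} := by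
      ext X
      simp only [Set.mem_inter_iff, Set.mem_iInter]
      rfl
    rw [this]
    refine (isClosed_iInter fun x => isClosed_eq ?_ ?_).inter
      (isClosed_iInter fun x => isClosed_eq ?_ ?_) <;> fun_prop
  have hR : modularResolvent A Ω * (1 - modularResolvent A Ω) ∈ S := by
    have hRs : star (modularResolvent A Ω * (1 - modularResolvent A Ω)) =
        modularResolvent A Ω * (1 - modularResolvent A Ω) := by
      rw [← modularWeight_mul_self, star_mul, (isSelfAdjoint_modularWeight A Ω).star_eq]
    have h : ∀ x, J ((modularResolvent A Ω * (1 - modularResolvent A Ω)) x) =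
        (modularResolvent A Ω * (1 - modularResolvent A Ω)) (J x) := by
      intro x
      have hJ : ∀ x, J (modularResolvent A Ω x) = J x - modularResolvent A Ω (J x) :=
        modularConjugation_resolvent hΩ
      simp only [mul_apply_eq_comp, sub_apply, one_apply_eq_self, map_sub, hJ]
      abel
    exact ⟨h, by rwa [hRs]⟩
  have := StarAlgebra.elemental.le_of_mem hS hR (modularWeight_mem_elemental A Ω)
  exact this.1 ξ

/-- `S² = 1` in disguise: the pair `(J W ξ, T ξ)` is in the graph of `S`, so `W J J W ξ = J W (J W
ξ) = (1 - T) T ξ = W² ξ`, and `W` can be cancelled. -/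
theorem modularConjugation_involutive (hΩ : IsStandardVector A Ω) (x : H) :
    modularConjugation hΩ (modularConjugation hΩ x) = x := by
  have h1 : ∀ ξ, modularWeight A Ω (modularConjugation hΩ (modularConjugation hΩ (modularWeight A Ω ξ))) =
      modularWeight A Ω (modularWeight A Ω ξ) := by
    intro ξ
    rw [← modularConjugation_weight_comm, modularConjugation_weight_of_mem hΩ
      (tomitaGraph_swap (modularConjugation_weight_mem hΩ ξ).1), modularWeight_weight]
  refine (denseRange_modularWeight hΩ).induction_on (p := fun x =>
    modularConjugation hΩ (modularConjugation hΩ x) = x) x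
    (isClosed_eq (by fun_prop) (by fun_prop)) fun ξ => ?_
  rw [← sub_eq_zero]
  refine modularWeight_injective hΩ ?_
  rw [map_sub, h1, sub_self]

lemma inner_modularConjugation_left (hΩ : IsStandardVector A Ω) (x y : H) :
    ⟪modularConjugation hΩ x, y⟫_ℂ = ⟪modularConjugation hΩ y, x⟫_ℂ := by
  have := inner_modularConjugation hΩ x (modularConjugation hΩ y)
  rwa [modularConjugation_involutive] at this

/-- The polar decomposition `Δ ^ (1/2) = J S`. -/
theorem isModularFun_sqrt (hΩ : IsStandardVector A Ω) {x y : H} (h : (x, y) ∈ tomitaGraph A Ω) :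
    IsModularFun A Ω (fun r => (√r : ℂ)) x (modularConjugation hΩ y) := by
  have h1 : modularWeight A Ω x = modularResolvent A Ω (modularConjugation hΩ y) := by
    have := congrArg (modularConjugation hΩ) (modularConjugation_weight_of_mem hΩ h)
    rw [modularConjugation_involutive, map_sub, modularConjugation_resolvent, sub_sub_cancel] at this
    exact this
  have hs : ContinuousOn (fun r : ℝ => (√r : ℂ)) (Set.Ioi 0) := by fun_prop
  have h1x : ContinuousOn (fun r : ℝ => ((1 + r : ℝ) : ℂ)) (Set.Ioi 0) := by fun_prop
  refine isModularFun_of_forall fun φ hφ => ?_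
  have h2 := congrArg (modularCc A Ω fun r => φ r * ((1 + r : ℝ) : ℂ)) h1
  rw [modularCc_weight (hφ.mul h1x), modularCc_resolvent (hφ.mul h1x)] at h2
  have e : ∀ (k : ℝ → ℝ) (ζ : H), modularCc A Ω (fun r => φ r * ((1 + r : ℝ) : ℂ) * ((k r / (1 + r) : ℝ) : ℂ)) ζ =
      modularCc A Ω (fun r => φ r * (k r : ℂ)) ζ := by
    intro k ζ
    congr 2
    ext r
    rcases lt_or_ge 0 r with hr | hr
    · have : (1 + r : ℝ) ≠ 0 := by positivity
      rw [mul_assoc, ← Complex.ofReal_mul, mul_div_cancel₀ _ this]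
    · simp [hφ.eq_zero hr]
  rw [e (fun r => √r), e (fun _ => 1)] at h2
  simpa using h2

/-- Both conjugations send `W ξ` to the value of `F` at `(1 - T) ξ`. -/
theorem modularConjugation_commutant (hΩ : IsStandardVector A Ω) :
    modularConjugation hΩ.commutant = modularConjugation hΩ := by
  refine DFunLike.coe_injective ((denseRange_modularWeight hΩ).equalizer (by fun_prop) (by fun_prop) ?_)
  ext ξ
  have h1 := (modularConjugation_weight_mem hΩ.commutant ξ).1
  have h2 := tomitaGraph_swap (modularConjugation_weight_mem hΩ ξ).2
  rw [modularWeight_commutant hΩ, modularResolvent_commutant hΩ] at h1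
  exact tomitaGraph_unique hΩ.commutant h1 h2

end ModularConjugation

/-! ### The resolvents of `Δ` map `A'Ω` into `AΩ` -/

section TomitaResolvent

variable {H : Type*} [NormedAddCommGroup H] [InnerProductSpace ℂ H] [CompleteSpace H]
  {A : VonNeumannAlgebra H} {Ω : H}

lemma VonNeumannAlgebra.cfc_mem (A : VonNeumannAlgebra H) {c : H →L[ℂ] H} (hc : c ∈ A) (f : ℝ → ℝ) :
    cfc f c ∈ A := by
  refine VonNeumannAlgebra.mem_of_commute fun b hb x => ?_
  have h : Commute c b := VonNeumannAlgebra.mem_commutant_iff.1 hb c hc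
  exact (DFunLike.congr_fun (h.cfc_real f).eq x).symm

/-- An approximate polar decomposition `y ≈ k |y|` inside a von Neumann algebra. -/
lemma VonNeumannAlgebra.exists_approx_polar (A : VonNeumannAlgebra H) {y : H →L[ℂ] H} (hy : y ∈ A)
    {ε : ℝ} (hε : 0 < ε) : ∃ s ∈ A, ∃ r ∈ A, IsSelfAdjoint s ∧ IsSelfAdjoint r ∧ r * s = 1 ∧
      ‖s * s * y‖ ≤ 1 ∧ r * r = s * s * (y * star y) + (ε ^ 2 : ℝ) • (s * s) ∧
      ‖(ε ^ 2 : ℝ) • (s * s)‖ ≤ ε := by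
  set c := y * star y with hc
  have hcA : c ∈ A := mul_mem hy (star_mem hy)
  have hc0 : 0 ≤ c := mul_star_self_nonneg y
  have hcs : IsSelfAdjoint c := IsSelfAdjoint.of_nonneg hc0
  -- The fourth root: `r² = (y y* + ε²)^{1/2}` and `s² = r⁻²`, so `k = s² y` is the regularized
  -- polar part of `y`. The constant `ε²` keeps `r` invertible.
  let g : ℝ → ℝ := fun x => √(√(|x| + ε ^ 2))
  have hg0 : ∀ x, 0 < g x := fun x => Real.sqrt_pos.2 (Real.sqrt_pos.2 (by positivity))
  have hgc : Continuous g := by fun_prop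
  have hgi : Continuous fun x => (g x)⁻¹ := hgc.inv₀ fun x => (hg0 x).ne'
  have hg4 : ∀ x, 0 ≤ x → g x * g x * (g x * g x) = x + ε ^ 2 := fun x hx => by
    have h1 : g x * g x = √(|x| + ε ^ 2) := Real.mul_self_sqrt (Real.sqrt_nonneg _)
    rw [h1, Real.mul_self_sqrt (by positivity), abs_of_nonneg hx]
  refine ⟨cfc (fun x => (g x)⁻¹) c, A.cfc_mem hcA _, cfc g c, A.cfc_mem hcA _, cfc_predicate _ _,
    cfc_predicate _ _, ?_, ?_, ?_, ?_⟩
  · rw [← cfc_mul _ _ _ hgc.continuousOn hgi.continuousOn]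
    have : (fun x => g x * (g x)⁻¹) = fun _ => 1 := by
      ext x
      exact mul_inv_cancel₀ (hg0 x).ne'
    rw [this, cfc_const_one ℝ c]
  · have h1 : (cfc (fun x => (g x)⁻¹) c * cfc (fun x => (g x)⁻¹) c * y) *
        star (cfc (fun x => (g x)⁻¹) c * cfc (fun x => (g x)⁻¹) c * y) =
        cfc (fun x => ((g x)⁻¹ * (g x)⁻¹) * x * ((g x)⁻¹ * (g x)⁻¹)) c := by
      have hs : star (cfc (fun x => (g x)⁻¹) c) = cfc (fun x => (g x)⁻¹) c :=
        (cfc_predicate (fun x => (g x)⁻¹) c : IsSelfAdjoint _).star_eq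
      rw [cfc_mul (fun x => ((g x)⁻¹ * (g x)⁻¹) * x) (fun x => (g x)⁻¹ * (g x)⁻¹) c
        ((hgi.mul hgi).mul continuous_id).continuousOn (hgi.mul hgi).continuousOn,
        cfc_mul (fun x => (g x)⁻¹ * (g x)⁻¹) (fun x => x) c (hgi.mul hgi).continuousOn
        continuous_id.continuousOn, cfc_mul _ _ c hgi.continuousOn hgi.continuousOn, cfc_id' ℝ c,
        star_mul, star_mul, hs, hc]
      simp only [mul_assoc]
    have h2 : ‖cfc (fun x => (g x)⁻¹) c * cfc (fun x => (g x)⁻¹) c * y‖ *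
        ‖cfc (fun x => (g x)⁻¹) c * cfc (fun x => (g x)⁻¹) c * y‖ ≤ 1 := by
      rw [← CStarRing.norm_self_mul_star, h1]
      refine norm_cfc_le zero_le_one fun x hx => ?_
      have hx0 := spectrum_nonneg_of_nonneg hc0 hx
      have e : (g x)⁻¹ * (g x)⁻¹ * x * ((g x)⁻¹ * (g x)⁻¹) = x / (x + ε ^ 2) := by
        rw [← hg4 x hx0]
        have := (hg0 x).ne'
        field_simp
      rw [e, Real.norm_of_nonneg (by positivity), div_le_one (by positivity)]
      nlinarith
    nlinarith [norm_nonneg (cfc (fun x => (g x)⁻¹) c * cfc (fun x => (g x)⁻¹) c * y)]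
  · have e1 : cfc (fun x => (g x)⁻¹) c * cfc (fun x => (g x)⁻¹) c =
        cfc (fun x => (g x)⁻¹ * (g x)⁻¹) c := (cfc_mul _ _ c hgi.continuousOn hgi.continuousOn).symm
    have e2 : cfc g c * cfc g c = cfc (fun x => g x * g x) c :=
      (cfc_mul _ _ c hgc.continuousOn hgc.continuousOn).symm
    have e3 : cfc (fun x => (g x)⁻¹ * (g x)⁻¹) c * c = cfc (fun x => (g x)⁻¹ * (g x)⁻¹ * x) c := by
      rw [cfc_mul (fun x => (g x)⁻¹ * (g x)⁻¹) (fun x => x) c (hgi.mul hgi).continuousOn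
        continuous_id.continuousOn, cfc_id' ℝ c]
    rw [e1, e2, e3, ← cfc_const_mul (ε ^ 2) (fun x => (g x)⁻¹ * (g x)⁻¹) c (hgi.mul hgi).continuousOn,
      ← cfc_add c (fun x => (g x)⁻¹ * (g x)⁻¹ * x) (fun x => ε ^ 2 * ((g x)⁻¹ * (g x)⁻¹)) ((hgi.mul hgi).mul continuous_id).continuousOn
        (continuous_const.mul (hgi.mul hgi)).continuousOn]
    refine cfc_congr fun x hx => ?_
    have hx0 := spectrum_nonneg_of_nonneg hc0 hx
    have h4 := hg4 x hx0
    have := (hg0 x).ne'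
    change g x * g x = (g x)⁻¹ * (g x)⁻¹ * x + ε ^ 2 * ((g x)⁻¹ * (g x)⁻¹)
    field_simp
    linear_combination h4
  · rw [← cfc_mul _ _ c hgi.continuousOn hgi.continuousOn,
      ← cfc_const_mul (ε ^ 2) (fun x => (g x)⁻¹ * (g x)⁻¹) c (hgi.mul hgi).continuousOn]
    refine norm_cfc_le hε.le fun x _ => ?_
    have h1 : g x * g x = √(|x| + ε ^ 2) := Real.mul_self_sqrt (Real.sqrt_nonneg _)
    have h2 : ε ≤ √(|x| + ε ^ 2) := Real.le_sqrt_of_sq_le (by linarith [abs_nonneg x])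
    rw [← mul_inv, h1, Real.norm_of_nonneg (by positivity), ← div_eq_mul_inv, div_le_iff₀ (by positivity)]
    nlinarith

/-- Take `k` to be the approximate polar part of `y`. Then `⟪yΩ, kΩ⟫ = ‖s yΩ‖²` and `⟪k*Ω, y*Ω⟫` is
`‖rΩ‖²` up to `ε`, while `|⟪yΩ, bΩ⟫| ≤ ‖b‖ ‖s yΩ‖ ‖rΩ‖`. The arithmetic-geometric mean inequality
compares them and produces the factor `2√λ`. -/
lemma IsStandardVector.exists_polar_estimate (hΩ : IsStandardVector A Ω) {y : H →L[ℂ] H}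
    (hy : y ∈ A) {lam : ℝ} (hlam : 0 < lam) {ε : ℝ} (hε : 0 < ε) :
    ∃ k ∈ A, ‖k‖ ≤ 1 ∧ ∀ b ∈ A.commutant, 2 * √lam * ‖⟪y Ω, b Ω⟫_ℂ‖ ≤
      ‖b‖ * ((lam * ⟪y Ω, k Ω⟫_ℂ + ⟪star k Ω, star y Ω⟫_ℂ).re + ε) := by
  obtain ⟨s, hs, r, hr, hss, hrs, h1, h2, h3, h4⟩ := A.exists_approx_polar hy hε
  refine ⟨s * s * y, mul_mem (mul_mem hs hs) hy, h2, fun b hb => ?_⟩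
  have e1 : ⟪y Ω, (s * s * y) Ω⟫_ℂ = ((‖s (y Ω)‖ ^ 2 : ℝ) : ℂ) := by
    rw [mul_apply_eq_comp, mul_apply_eq_comp, ← ContinuousLinearMap.inner_star_apply, hss.star_eq,
      inner_self_eq_norm_sq_to_K]
    norm_cast
  have e2 : ‖r Ω‖ ^ 2 ≤ (⟪star (s * s * y) Ω, star y Ω⟫_ℂ).re + ε := by
    have e3 : ((‖r Ω‖ ^ 2 : ℝ) : ℂ) = ⟪Ω, (r * r) Ω⟫_ℂ := by
      rw [mul_apply_eq_comp, ← ContinuousLinearMap.inner_star_apply, hrs.star_eq,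
        inner_self_eq_norm_sq_to_K]
      norm_cast
    have e4 : ‖⟪Ω, ((ε ^ 2 : ℝ) • (s * s)) Ω⟫_ℂ‖ ≤ ε := by
      refine (norm_inner_le_norm _ _).trans ?_
      rw [hΩ.norm_eq_one, one_mul]
      refine (ContinuousLinearMap.le_of_opNorm_le _ h4 Ω).trans ?_
      rw [hΩ.norm_eq_one, mul_one]
    rw [h3, add_apply, inner_add_right] at e3
    have e5 := congrArg Complex.re e3
    rw [Complex.ofReal_re, Complex.add_re] at e5
    have e6 : ⟪star (s * s * y) Ω, star y Ω⟫_ℂ = ⟪Ω, (s * s * (y * star y)) Ω⟫_ℂ := by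
      rw [ContinuousLinearMap.inner_star_apply, ← mul_assoc]
      rfl
    rw [e5, e6]
    linarith [(Complex.re_le_norm ⟪Ω, ((ε ^ 2 : ℝ) • (s * s)) Ω⟫_ℂ)]
  have e7 : ‖⟪y Ω, b Ω⟫_ℂ‖ ≤ ‖b‖ * (‖s (y Ω)‖ * ‖r Ω‖) := by
    -- Insert `r s = 1` before `yΩ` and move `r` through `b ∈ A'`.
    have : ⟪y Ω, b Ω⟫_ℂ = ⟪s (y Ω), b (r Ω)⟫_ℂ := by
      rw [← VonNeumannAlgebra.commute_apply hr hb, ← ContinuousLinearMap.inner_star_apply r,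
        hrs.star_eq]
      have := DFunLike.congr_fun h1 (y Ω)
      rw [mul_apply_eq_comp] at this
      rw [this]
      rfl
    rw [this]
    calc _ ≤ ‖s (y Ω)‖ * ‖b (r Ω)‖ := norm_inner_le_norm _ _
      _ ≤ ‖s (y Ω)‖ * (‖b‖ * ‖r Ω‖) := by gcongr; exact b.le_opNorm _
      _ = _ := by ring
  have e8 : (lam * ⟪y Ω, (s * s * y) Ω⟫_ℂ + ⟪star (s * s * y) Ω, star y Ω⟫_ℂ).re =
      lam * ‖s (y Ω)‖ ^ 2 + (⟪star (s * s * y) Ω, star y Ω⟫_ℂ).re := by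
    rw [e1, Complex.add_re, ← Complex.ofReal_mul, Complex.ofReal_re]
  rw [e8]
  have hsq := Real.sq_sqrt hlam.le
  calc 2 * √lam * ‖⟪y Ω, b Ω⟫_ℂ‖ ≤ 2 * √lam * (‖b‖ * (‖s (y Ω)‖ * ‖r Ω‖)) := by gcongr
    _ = ‖b‖ * (2 * (√lam * ‖s (y Ω)‖) * ‖r Ω‖) := by ring
    _ ≤ ‖b‖ * ((√lam * ‖s (y Ω)‖) ^ 2 + ‖r Ω‖ ^ 2) := by gcongr; exact two_mul_le_add_sq _ _
    _ ≤ _ := by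
      rw [mul_pow, hsq]
      gcongr ‖b‖ * ?_
      linarith

/-- The vectors `k Ω` with `k ∈ A` in a ball of operators form a closed set. -/
lemma IsStandardVector.isClosed_ball (hΩ : IsStandardVector A Ω) {C : ℝ} (hC : 0 ≤ C) :
    IsClosed {x | ∃ k ∈ A, ‖k‖ ≤ C ∧ k Ω = x} := by
  refine isClosed_of_closure_subset fun x hx => ?_
  let S := A.commutant.toStarSubalgebra
  let e : S →ₗ[ℂ] H :=
    { toFun := fun b => (b : H →L[ℂ] H) Ω
      map_add' := fun _ _ => rfl
      map_smul' := fun _ _ => rfl }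
  let f : S →ₗ[ℂ] H :=
    { toFun := fun b => (b : H →L[ℂ] H) x
      map_add' := fun _ _ => rfl
      map_smul' := fun _ _ => rfl }
  have hd : DenseRange e := by
    refine hΩ.commutant.cyclic.mono ?_
    rintro _ ⟨b, hb, rfl⟩
    exact ⟨⟨b, hb⟩, rfl⟩
  -- For `x = kΩ` this is `b kΩ = k bΩ`, and the bound survives limits in `x`. It allows `bΩ ↦ b x`
  -- to extend to a bounded operator, which commutes with `A'` and sends `Ω` to `x`.
  have hf : ∀ b : S, ‖f b‖ ≤ C * ‖e b‖ := by
    intro b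
    refine closure_minimal (t := {x | ‖(b : H →L[ℂ] H) x‖ ≤ C * ‖e b‖}) ?_
      (isClosed_le (by fun_prop) (by fun_prop)) hx
    rintro _ ⟨k, hk, hkC, rfl⟩
    have := VonNeumannAlgebra.commute_apply hk b.2 Ω
    change ‖(b : H →L[ℂ] H) (k Ω)‖ ≤ _
    rw [← this]
    exact k.le_of_opNorm_le hkC _
  let k : H →L[ℂ] H := f.extendOfNorm e
  have hke : ∀ b ∈ A.commutant, k (b Ω) = b x := fun b hb =>
    LinearMap.extendOfNorm_eq hd ⟨C, hf⟩ ⟨b, hb⟩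
  refine ⟨k, ?_, LinearMap.opNorm_extendOfNorm_le hd hC hf, hke 1 (one_mem _)⟩
  refine VonNeumannAlgebra.mem_of_commute fun b hb z => ?_
  refine congrFun (Continuous.ext_on hΩ.commutant.cyclic (f := fun z => b (k z))
    (g := fun z => k (b z)) (by fun_prop) (by fun_prop) ?_) z
  rintro _ ⟨c, hc, rfl⟩
  change b (k (c Ω)) = k ((b * c) Ω)
  rw [hke c hc, hke _ (mul_mem hb hc)]
  rfl

/-- `(λ + Δ)⁻¹ = T Q` with the bounded function `Q = (1 + Δ) / (λ + Δ)`. -/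
lemma exists_isModularImage_add (hΩ : IsStandardVector A Ω) {lam : ℝ} (hlam : 0 < lam) (η : H) :
    ∃ ζ, IsModularImage A Ω ζ (η - (lam : ℂ) • ζ) := by
  have hc1 : ContinuousOn (fun x : ℝ => (((1 + x) / (lam + x) : ℝ) : ℂ)) (Set.Ioi 0) := by
    refine Complex.continuous_ofReal.comp_continuousOn (ContinuousOn.div (by fun_prop) (by fun_prop) ?_)
    intro x hx
    have : 0 < x := hx
    positivity
  have hc2 : ContinuousOn (fun x : ℝ => (((lam - 1) * (1 / (1 + x)) : ℝ) : ℂ)) (Set.Ioi 0) := by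
    refine Complex.continuous_ofReal.comp_continuousOn
      (continuousOn_const.mul (ContinuousOn.div (by fun_prop) (by fun_prop) ?_))
    intro x hx
    have : 0 < x := hx
    positivity
  obtain ⟨Q, hQ, -⟩ := exists_isModularFun_of_bounded hΩ hc1 (C := 1 + lam⁻¹) fun x hx => by
    rw [Complex.norm_real, Real.norm_of_nonneg (by positivity), div_le_iff₀ (by positivity)]
    have : lam⁻¹ * lam = 1 := inv_mul_cancel₀ hlam.ne'
    nlinarith [inv_pos.2 hlam]
  have h1 : IsModularFun A Ω (fun x => (((lam - 1) * (1 / (1 + x)) : ℝ) : ℂ)) (Q η)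
      (((lam - 1 : ℝ) : ℂ) • modularResolvent A Ω (Q η)) := by
    have h := (isModularFun_resolvent (A := A) (Ω := Ω) (Q η)).comp continuousOn_const
      (IsModularFun.const ((lam - 1 : ℝ) : ℂ) _)
    simpa using h
  have h2 := (hQ η).comp (continuousOn_const.add hc2)
    ((IsModularFun.one (Q η)).fun_add continuousOn_const hc2 h1)
  have h3 := h2.congr ((continuousOn_const.add hc2).mul hc1) continuousOn_const (g := fun _ => 1)
    fun x hx => by
      change (1 + (((lam - 1) * (1 / (1 + x)) : ℝ) : ℂ)) * (((1 + x) / (lam + x) : ℝ) : ℂ) = 1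
      rw [← Complex.ofReal_one, ← Complex.ofReal_add, ← Complex.ofReal_mul]
      congr 1
      field_simp
      ring
  have h4 := (IsModularFun.one η).unique hΩ h3
  refine ⟨modularResolvent A Ω (Q η), ?_⟩
  have h5 := modularResolvent_spec A Ω (Q η)
  have h6 : η - (lam : ℂ) • modularResolvent A Ω (Q η) = Q η - modularResolvent A Ω (Q η) := by
    generalize modularResolvent A Ω (Q η) = u at *
    rw [eq_sub_of_add_eq h4.symm]
    push_cast
    module
  rwa [h6]

/-- The resolvent of the modular operator maps `A' Ω` into `A Ω`. -/
theorem IsStandardVector.exists_resolvent_mem (hΩ : IsStandardVector A Ω) {b : H →L[ℂ] H}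
    (hb : b ∈ A.commutant) {lam : ℝ} (hlam : 0 < lam) :
    ∃ k ∈ A, IsModularImage A Ω (k Ω) (b Ω - (lam : ℂ) • k Ω) := by
  obtain ⟨ξ, hξ⟩ := exists_isModularImage_add hΩ hlam (b Ω)
  have hs : 0 < √lam := Real.sqrt_pos.2 hlam
  -- This radius is dictated by the polar estimate. It suffices that `ξ = (λ + Δ)⁻¹ bΩ` lies in the
  -- closed convex set of vectors `kΩ` with `‖k‖ ≤ C`; otherwise a functional separates the two.
  set C := ‖b‖ / (2 * √lam) with hC
  have hC0 : 0 ≤ C := by positivity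
  suffices h : ξ ∈ {x | ∃ k ∈ A, ‖k‖ ≤ C ∧ k Ω = x} by
    obtain ⟨k, hk, -, rfl⟩ := h
    exact ⟨k, hk, hξ⟩
  by_contra hnot
  have hconv : Convex ℝ {x | ∃ k ∈ A, ‖k‖ ≤ C ∧ k Ω = x} := by
    rintro _ ⟨k, hk, hkC, rfl⟩ _ ⟨l, hl, hlC, rfl⟩ p q hp hq hpq
    refine ⟨(p : ℂ) • k + (q : ℂ) • l, add_mem (A.smul_mem _ hk) (A.smul_mem _ hl), ?_, ?_⟩
    · refine (norm_add_le _ _).trans ?_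
      rw [norm_smul, norm_smul, Complex.norm_real, Complex.norm_real, Real.norm_of_nonneg hp,
        Real.norm_of_nonneg hq]
      calc _ ≤ p * C + q * C := by gcongr
        _ = C := by rw [← add_mul, hpq, one_mul]
    · simp
  obtain ⟨f, u, hfu, huf⟩ := RCLike.geometric_hahn_banach_closed_point (𝕜 := ℂ) hconv
    (hΩ.isClosed_ball hC0) hnot
  obtain ⟨η, rfl⟩ := (InnerProductSpace.toDual ℂ H).surjective f
  simp only [InnerProductSpace.toDual_apply_apply] at hfu huf
  -- Apply the resolvent to the separating vector: with `ζ = (λ + Δ)⁻¹ η` and `w = S ζ`, pairings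
  -- with `η` become exactly the expressions of the polar estimate, with `(ζ, w)` in place of `(yΩ,
  -- y*Ω)`.
  obtain ⟨ζ, w, hζw, hζ⟩ := exists_isModularImage_add hΩ hlam η
  have e1 : ∀ k ∈ A, ⟪η, k Ω⟫_ℂ = lam * ⟪ζ, k Ω⟫_ℂ + ⟪star k Ω, w⟫_ℂ := by
    intro k hk
    have := hζ _ (mem_tomitaGraph_of_mem Ω hk)
    simp only [inner_sub_left, inner_smul_left, Complex.conj_ofReal] at this
    linear_combination this
  have e2 : ⟪η, ξ⟫_ℂ = ⟪ζ, b Ω⟫_ℂ := by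
    obtain ⟨v, hv, hξ'⟩ := hξ
    have h1 := hζ _ hv
    have h2 := congrArg conj (hξ' _ hζw)
    simp only [inner_sub_left, inner_smul_left, Complex.conj_ofReal, map_sub, map_mul,
      inner_conj_symm] at h1 h2
    linear_combination h1 - h2
  rw [e2] at huf
  set γ := RCLike.re ⟪ζ, b Ω⟫_ℂ - u with hγ
  have hγ0 : 0 < γ := sub_pos.2 huf
  -- The error budget: `(λ + 1) C ε` from replacing `(ζ, w)` by `(yΩ, y*Ω)`, `C ε` from the polar
  -- estimate and `‖b‖ ε` from `⟪ζ, bΩ⟫`. The extra `1` keeps the denominator positive.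
  set ε := γ / ((lam + 1) * C + C + ‖b‖ + 1) with hε
  have hε0 : 0 < ε := by positivity
  obtain ⟨p, ⟨y, hy, rfl⟩, hdist⟩ := Metric.mem_closure_iff.1 hζw ε hε0
  rw [Prod.dist_eq, max_lt_iff, dist_eq_norm, dist_eq_norm] at hdist
  obtain ⟨d1, d2⟩ := hdist
  change ‖ζ - y Ω‖ < ε at d1
  change ‖w - star y Ω‖ < ε at d2
  obtain ⟨k, hk, hk1, hkb⟩ := hΩ.exists_polar_estimate hy hlam hε0
  have h1 := hkb b hb
  have h2 := hfu _ ⟨(C : ℂ) • k, A.smul_mem _ hk, by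
    rw [norm_smul, Complex.norm_real, Real.norm_of_nonneg hC0]
    nlinarith, rfl⟩
  rw [e1 _ (A.smul_mem _ hk)] at h2
  have h3 : ((lam : ℂ) * ⟪ζ, ((C : ℂ) • k) Ω⟫_ℂ + ⟪star ((C : ℂ) • k) Ω, w⟫_ℂ) =
      C * ((lam * ⟪y Ω, k Ω⟫_ℂ + ⟪star k Ω, star y Ω⟫_ℂ) +
        (lam * ⟪ζ - y Ω, k Ω⟫_ℂ + ⟪star k Ω, w - star y Ω⟫_ℂ)) := by
    rw [star_smul, smul_apply, smul_apply, inner_smul_left, inner_smul_right, inner_sub_left,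
      inner_sub_right]
    simp only [RCLike.star_def, Complex.conj_ofReal]
    ring
  have hkn : ∀ l : H →L[ℂ] H, ‖l‖ ≤ 1 → ‖l Ω‖ ≤ 1 := fun l hl => by
    have := l.le_of_opNorm_le hl Ω
    rwa [hΩ.norm_eq_one, mul_one] at this
  have h4 : ‖(lam * ⟪ζ - y Ω, k Ω⟫_ℂ + ⟪star k Ω, w - star y Ω⟫_ℂ)‖ ≤ (lam + 1) * ε := by
    refine (norm_add_le _ _).trans ?_
    rw [norm_mul, Complex.norm_real, Real.norm_of_nonneg hlam.le, add_mul, one_mul]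
    have i1 := norm_inner_le_norm (𝕜 := ℂ) (ζ - y Ω) (k Ω)
    have i2 := norm_inner_le_norm (𝕜 := ℂ) (star k Ω) (w - star y Ω)
    have i3 := hkn k hk1
    have i4 := hkn (star k) (by rwa [norm_star])
    have i5 : ‖⟪ζ - y Ω, k Ω⟫_ℂ‖ ≤ ε := i1.trans (by nlinarith [norm_nonneg (ζ - y Ω), norm_nonneg (k Ω)])
    have i6 : ‖⟪star k Ω, w - star y Ω⟫_ℂ‖ ≤ ε :=
      i2.trans (by nlinarith [norm_nonneg (w - star y Ω), norm_nonneg (star k Ω)])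
    gcongr
  set X := (lam * ⟪y Ω, k Ω⟫_ℂ + ⟪star k Ω, star y Ω⟫_ℂ) with hX
  set Z := (lam * ⟪ζ - y Ω, k Ω⟫_ℂ + ⟪star k Ω, w - star y Ω⟫_ℂ) with hZ
  have h5 : C * (X.re + Z.re) < u := by
    rw [h3] at h2
    simpa using h2
  have h6 : -((lam + 1) * ε) ≤ Z.re := by
    have := (abs_le.1 (Complex.abs_re_le_norm Z)).1
    linarith
  have h7 : RCLike.re ⟪ζ, b Ω⟫_ℂ ≤ ‖⟪y Ω, b Ω⟫_ℂ‖ + ε * ‖b‖ := by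
    have i1 : ⟪ζ, b Ω⟫_ℂ = ⟪y Ω, b Ω⟫_ℂ + ⟪ζ - y Ω, b Ω⟫_ℂ := by rw [inner_sub_left]; ring
    have i2 := norm_inner_le_norm (𝕜 := ℂ) (ζ - y Ω) (b Ω)
    have i3 := b.le_opNorm Ω
    rw [hΩ.norm_eq_one, mul_one] at i3
    calc _ ≤ ‖⟪ζ, b Ω⟫_ℂ‖ := RCLike.re_le_norm _
      _ ≤ ‖⟪y Ω, b Ω⟫_ℂ‖ + ‖⟪ζ - y Ω, b Ω⟫_ℂ‖ := by rw [i1]; exact norm_add_le _ _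
      _ ≤ _ := by
        gcongr
        exact i2.trans (mul_le_mul d1.le i3 (norm_nonneg _) hε0.le)
  have h8 : ‖⟪y Ω, b Ω⟫_ℂ‖ ≤ C * (X.re + ε) := by
    rw [hC, div_mul_eq_mul_div, le_div_iff₀ (by positivity)]
    linarith
  have h9 : ε * ((lam + 1) * C + C + ‖b‖ + 1) = γ := by
    rw [hε, div_mul_cancel₀]
    positivity
  have h10 : C * (-((lam + 1) * ε)) ≤ C * Z.re := mul_le_mul_of_nonneg_left h6 hC0
  linarith

end TomitaResolvent

/-! ### A Poisson formula on a strip and uniqueness of weighted Fourier transforms -/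

section StripIntegral

open MeasureTheory

lemma Real.one_add_sq_le_cosh_pi_mul (t : ℝ) : 1 + t ^ 2 ≤ Real.cosh (Real.pi * t) := by
  have h1 : Real.cosh (Real.pi * t) = 1 + 2 * Real.sinh (Real.pi * t / 2) ^ 2 := by
    have := Real.cosh_two_mul (Real.pi * t / 2)
    rw [mul_div_cancel₀ _ (two_ne_zero)] at this
    rw [this, Real.cosh_sq]
    ring
  have h2 : |Real.pi * t / 2| ≤ |Real.sinh (Real.pi * t / 2)| := by
    rw [Real.abs_sinh]
    exact Real.self_le_sinh_iff.2 (abs_nonneg _)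
  have h3 := sq_le_sq.2 h2
  have h4 := Real.pi_gt_three
  have h5 : 9 ≤ Real.pi ^ 2 := by nlinarith
  rw [h1]
  nlinarith [sq_nonneg t, mul_le_mul_of_nonneg_right h5 (sq_nonneg t)]

lemma Real.integrable_inv_cosh_pi_mul : Integrable fun t : ℝ => (Real.cosh (Real.pi * t))⁻¹ := by
  refine integrable_inv_one_add_sq.mono' (by
    refine (Continuous.inv₀ (by fun_prop) fun t => (Real.cosh_pos _).ne').aestronglyMeasurable) ?_
  refine Eventually.of_forall fun t => ?_
  rw [Real.norm_of_nonneg (inv_nonneg.2 (Real.cosh_pos _).le)]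
  exact inv_anti₀ (by positivity) (Real.one_add_sq_le_cosh_pi_mul t)

/-- A bounded continuous function is integrable with respect to the weight `1 / cosh (π t)`. -/
lemma integrable_div_cosh {h : ℝ → ℂ} (hc : Continuous h) {C : ℝ} (hC : ∀ t, ‖h t‖ ≤ C) :
    Integrable fun t : ℝ => h t / (Real.cosh (Real.pi * t) : ℂ) := by
  refine (Real.integrable_inv_cosh_pi_mul.const_mul C).mono' ?_ (Eventually.of_forall fun t => ?_)
  · refine (hc.div (by fun_prop) fun t => ?_).aestronglyMeasurable
    exact_mod_cast (Real.cosh_pos _).ne'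
  · rw [norm_div, Complex.norm_real, Real.norm_of_nonneg (Real.cosh_pos _).le, div_eq_mul_inv]
    exact mul_le_mul_of_nonneg_right (hC t) (inv_nonneg.2 (Real.cosh_pos _).le)

/-- Used twice: it locates the zeros of `sinh (π z)` in the strip and bounds it below on vertical
segments. -/
lemma Complex.sq_norm_sinh (z : ℂ) : ‖Complex.sinh z‖ ^ 2 = Real.sinh z.re ^ 2 + Real.sin z.im ^ 2 := by
  have h : Complex.sinh z = ((Real.sinh z.re * Real.cos z.im : ℝ) : ℂ) +
      ((Real.cosh z.re * Real.sin z.im : ℝ) : ℂ) * Complex.I := by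
    conv_lhs => rw [← Complex.re_add_im z]
    rw [Complex.sinh_add, Complex.sinh_mul_I, Complex.cosh_mul_I]
    push_cast
    ring
  rw [h, Complex.sq_norm, Complex.normSq_add_mul_I, mul_pow, mul_pow, Real.cosh_sq, Real.cos_sq']
  ring

/-- The Poisson formula for the strip `|Im z| ≤ 1/2`, at the origin. -/
theorem integral_strip_div_cosh {N : ℂ → ℂ} (hN : Differentiable ℂ N) {C : ℝ}
    (hC : ∀ z : ℂ, |z.im| ≤ 1 / 2 → ‖N z‖ ≤ C) :
    ∫ t : ℝ, (N (t + Complex.I / 2) + N (t - Complex.I / 2)) / (Real.cosh (Real.pi * t) : ℂ) =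
      2 * N 0 * ∫ t : ℝ, 1 / (Real.cosh (Real.pi * t) : ℂ) := by
  have hC0 : 0 ≤ C := (norm_nonneg _).trans (hC 0 (by simp))
  let S : ℂ → ℂ := fun z => Complex.sinh (Real.pi * z)
  have hS : Differentiable ℂ S := by fun_prop
  have hS0 : ∀ z : ℂ, |z.im| ≤ 1 / 2 → z ≠ 0 → S z ≠ 0 := by
    intro z hz hne h0
    have h1 := Complex.sq_norm_sinh (Real.pi * z)
    change Complex.sinh (Real.pi * z) = 0 at h0
    rw [h0, norm_zero, Complex.re_ofReal_mul, Complex.im_ofReal_mul] at h1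
    have h2 : Real.sinh (Real.pi * z.re) = 0 := by nlinarith [sq_nonneg (Real.sin (Real.pi * z.im)), sq_nonneg (Real.sinh (Real.pi * z.re))]
    have h3 : Real.sin (Real.pi * z.im) = 0 := by nlinarith [sq_nonneg (Real.sin (Real.pi * z.im)), sq_nonneg (Real.sinh (Real.pi * z.re))]
    rw [Real.sinh_eq_zero, mul_eq_zero, or_iff_right Real.pi_pos.ne'] at h2
    obtain ⟨h4, h5⟩ := abs_le.1 hz
    rw [Real.sin_eq_zero_iff_of_lt_of_lt (by nlinarith [Real.pi_pos]) (by nlinarith [Real.pi_pos]),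
      mul_eq_zero, or_iff_right Real.pi_pos.ne'] at h3
    exact hne (Complex.ext h2 h3)
  have hds : ∀ f : ℂ → ℂ, Differentiable ℂ f → Differentiable ℂ (dslope f 0) := fun f hf => by
    rw [← differentiableOn_univ] at hf ⊢
    exact (Complex.differentiableOn_dslope univ_mem).2 hf
  -- This is `(N z - N 0) / sinh (π z)` with the singularity at `0` removed. On the edges `Im z =
  -- ±1/2` one has `sinh (π z) = ± i cosh (π t)`, so Cauchy's theorem on long rectangles gives the
  -- formula.
  let P : ℂ → ℂ := fun z => dslope N 0 z / dslope S 0 z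
  have hP : ∀ z : ℂ, z ≠ 0 → P z = (N z - N 0) / S z := by
    intro z hz
    have : S 0 = 0 := by simp [S]
    simp only [P]
    rw [dslope_of_ne _ hz, dslope_of_ne _ hz, slope_def_field, slope_def_field, this, sub_zero,
      sub_zero, div_div_div_cancel_right₀ hz]
  have hPd : ∀ z : ℂ, |z.im| ≤ 1 / 2 → DifferentiableAt ℂ P z := by
    intro z hz
    refine (hds N hN z).div (hds S hS z) ?_
    by_cases h0 : z = 0
    · rw [h0, dslope_same]
      have : HasDerivAt S (Real.pi : ℂ) 0 := by
        have := ((hasDerivAt_id (0 : ℂ)).const_mul (Real.pi : ℂ)).csinh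
        simpa using this
      rw [this.deriv]
      exact_mod_cast Real.pi_pos.ne'
    · rw [dslope_of_ne _ h0, slope_def_field]
      have : S 0 = 0 := by simp [S]
      rw [this, sub_zero, sub_zero]
      exact div_ne_zero (hS0 z hz h0) h0
  have hne : ∀ t : ℝ, (Real.cosh (Real.pi * t) : ℂ) ≠ 0 := fun t => by
    exact_mod_cast (Real.cosh_pos _).ne'
  have hsin : ∀ t : ℝ, ∀ σ : ℂ, (σ = 1 ∨ σ = -1) →
      P (t + σ * (Complex.I / 2)) =
        -σ * Complex.I * ((N (t + σ * (Complex.I / 2)) - N 0) / (Real.cosh (Real.pi * t) : ℂ)) := by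
    intro t σ hσ
    have hσ2 : σ * σ = 1 := by rcases hσ with rfl | rfl <;> norm_num
    have hσ0 : σ ≠ 0 := by rcases hσ with rfl | rfl <;> norm_num
    rw [hP]
    · have : S (t + σ * (Complex.I / 2)) = σ * Complex.I * (Real.cosh (Real.pi * t) : ℂ) := by
        have e : (Real.pi : ℂ) * (t + σ * (Complex.I / 2)) = Real.pi * t + (σ * (Real.pi / 2)) * Complex.I := by ring
        simp only [S]
        rw [e, Complex.sinh_add, Complex.cosh_mul_I, Complex.sinh_mul_I]
        have e1 : Complex.cos (σ * (Real.pi / 2)) = 0 := by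
          rcases hσ with rfl | rfl <;> simp
        have e2 : Complex.sin (σ * (Real.pi / 2)) = σ := by
          rcases hσ with rfl | rfl <;> simp
        rw [e1, e2]
        push_cast
        ring
      rw [this]
      have hI := Complex.I_mul_I
      have := hne t
      generalize N (t + σ * (Complex.I / 2)) = n
      field_simp
      linear_combination (n - N 0) * (hσ2 * Complex.I ^ 2 + hI)
    · intro h0
      have := congrArg Complex.im h0
      rcases hσ with rfl | rfl <;> simp at this
  have hint : ∀ σ : ℂ, (σ = 1 ∨ σ = -1) →
      Integrable fun t : ℝ => P (t + σ * (Complex.I / 2)) := by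
    intro σ hσ
    simp only [hsin _ σ hσ]
    refine (integrable_div_cosh (C := C + C) ?_ fun t => ?_).const_mul _
    · have := hN.continuous
      fun_prop
    · refine (norm_sub_le _ _).trans (add_le_add (hC _ ?_) (hC _ (by simp)))
      rcases hσ with rfl | rfl <;> simp [abs_of_pos]
  -- The vertical sides vanish in the limit, since `|sinh (π z)| ≥ |sinh (π R)| ≥ |R|` on them.
  have hvert : ∀ R : ℝ, 1 ≤ |R| → ‖∫ y : ℝ in (-(1 / 2) : ℝ)..(1 / 2), P (R + y * Complex.I)‖ ≤ (C + C) / |R| := by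
    intro R hR
    refine (intervalIntegral.norm_integral_le_of_norm_le_const (C := (C + C) / |R|)
      fun y hy => ?_).trans (by norm_num)
    rw [Set.uIoc_of_le (by norm_num)] at hy
    have him : |((R : ℂ) + y * Complex.I).im| ≤ 1 / 2 := by
      simp only [Complex.add_im, Complex.ofReal_im, Complex.mul_im, Complex.I_im, Complex.ofReal_re,
        Complex.I_re, mul_zero, mul_one, zero_add, add_zero]
      exact abs_le.2 ⟨by linarith [hy.1], hy.2⟩
    have h0 : (R : ℂ) + y * Complex.I ≠ 0 := by
      intro h
      have := congrArg Complex.re h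
      simp at this
      rw [this, abs_zero] at hR
      linarith
    rw [hP _ h0, norm_div]
    have h2 : |R| ≤ ‖S (R + y * Complex.I)‖ := by
      refine abs_le_of_sq_le_sq' ?_ (norm_nonneg _) |>.2
      have := Complex.sq_norm_sinh (Real.pi * (R + y * Complex.I))
      rw [sq_abs]
      change _ ≤ ‖Complex.sinh (Real.pi * (R + y * Complex.I))‖ ^ 2
      rw [this, Complex.re_ofReal_mul]
      simp only [Complex.add_re, Complex.ofReal_re, Complex.mul_re, Complex.I_re, mul_zero,
        Complex.ofReal_im, Complex.I_im, mul_one, sub_self, add_zero]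
      have h3 : |Real.pi * R| ≤ |Real.sinh (Real.pi * R)| := by
        rw [Real.abs_sinh]
        exact Real.self_le_sinh_iff.2 (abs_nonneg _)
      have h4 := sq_le_sq.2 h3
      have h5 : 9 ≤ Real.pi ^ 2 := by nlinarith [Real.pi_gt_three]
      nlinarith [sq_nonneg (Real.sin (Real.pi * (R + y * Complex.I)).im), sq_nonneg R,
        mul_le_mul_of_nonneg_right h5 (sq_nonneg R)]
    have : 0 < |R| := by linarith
    exact div_le_div₀ (by linarith) ((norm_sub_le _ _).trans (add_le_add (hC _ him) (hC _ (by simp)))) this h2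
  have hrect : ∀ n : ℕ, (∫ x : ℝ in (-(n : ℝ))..n, P (x + (-1) * (Complex.I / 2))) -
      (∫ x : ℝ in (-(n : ℝ))..n, P (x + 1 * (Complex.I / 2))) =
      -(Complex.I * (∫ y : ℝ in (-(1 / 2) : ℝ)..(1 / 2), P ((n : ℝ) + y * Complex.I))) +
      Complex.I * (∫ y : ℝ in (-(1 / 2) : ℝ)..(1 / 2), P ((-n : ℝ) + y * Complex.I)) := by
    intro n
    have h := Complex.integral_boundary_rect_eq_zero_of_differentiableOn P
      ⟨-n, -(1 / 2)⟩ ⟨n, 1 / 2⟩ fun z hz => (hPd z ?_).differentiableWithinAt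
    · simp only [smul_eq_mul] at h
      have e1 : ∀ x : ℝ, (x : ℂ) + ((-(1 / 2) : ℝ) : ℂ) * Complex.I = x + (-1) * (Complex.I / 2) := by
        intro x; push_cast; ring
      have e2 : ∀ x : ℝ, (x : ℂ) + ((1 / 2 : ℝ) : ℂ) * Complex.I = x + 1 * (Complex.I / 2) := by
        intro x; push_cast; ring
      simp only [e1, e2] at h
      linear_combination h
    · have := hz.2
      change z.im ∈ Set.uIcc (-(1 / 2)) (1 / 2) at this
      rw [Set.uIcc_of_le (by norm_num)] at this
      exact abs_le.2 this
  have hlim0 : Tendsto (fun n : ℕ =>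
      -(Complex.I * (∫ y : ℝ in (-(1 / 2) : ℝ)..(1 / 2), P ((n : ℝ) + y * Complex.I))) +
      Complex.I * (∫ y : ℝ in (-(1 / 2) : ℝ)..(1 / 2), P ((-n : ℝ) + y * Complex.I))) atTop (𝓝 0) := by
    have hd : Tendsto (fun n : ℕ => (C + C) / (n : ℝ)) atTop (𝓝 0) :=
      tendsto_const_div_atTop_nhds_zero_nat _
    have h1 : Tendsto (fun n : ℕ => ∫ y : ℝ in (-(1 / 2) : ℝ)..(1 / 2), P ((n : ℝ) + y * Complex.I)) atTop (𝓝 0) := by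
      refine squeeze_zero_norm' ?_ hd
      filter_upwards [eventually_ge_atTop 1] with n hn
      have hn' : (1 : ℝ) ≤ n := by exact_mod_cast hn
      have := hvert n (by rwa [abs_of_nonneg (by linarith)])
      rwa [abs_of_nonneg (by linarith)] at this
    have h2 : Tendsto (fun n : ℕ => ∫ y : ℝ in (-(1 / 2) : ℝ)..(1 / 2), P ((-n : ℝ) + y * Complex.I)) atTop (𝓝 0) := by
      refine squeeze_zero_norm' ?_ hd
      filter_upwards [eventually_ge_atTop 1] with n hn
      have hn' : (1 : ℝ) ≤ n := by exact_mod_cast hn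
      have := hvert (-n) (by rwa [abs_neg, abs_of_nonneg (by linarith)])
      rw [abs_neg, abs_of_nonneg (by linarith)] at this
      exact this
    have := (h1.const_mul Complex.I).neg.add (h2.const_mul Complex.I)
    simpa using this
  have hlim1 := fun σ hσ => intervalIntegral_tendsto_integral (hint σ hσ)
    (tendsto_neg_atTop_atBot.comp tendsto_natCast_atTop_atTop) tendsto_natCast_atTop_atTop (l := atTop (α := ℕ))
  have hkey := tendsto_nhds_unique ((hlim1 (-1) (Or.inr rfl)).sub (hlim1 1 (Or.inl rfl)))
    (hlim0.congr fun n => (hrect n).symm)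
  rw [← integral_sub (hint _ (Or.inr rfl)) (hint _ (Or.inl rfl))] at hkey
  simp only [hsin _ _ (Or.inr rfl), hsin _ _ (Or.inl rfl)] at hkey
  have h1i : Integrable fun t : ℝ => (1 : ℂ) / (Real.cosh (Real.pi * t) : ℂ) :=
    integrable_div_cosh continuous_const (C := 1) fun t => by simp
  have e1 : ∀ t : ℝ, (N (t + Complex.I / 2) + N (t - Complex.I / 2)) / (Real.cosh (Real.pi * t) : ℂ) =
      -Complex.I * ((-(-1 : ℂ) * Complex.I * ((N (t + (-1) * (Complex.I / 2)) - N 0) / (Real.cosh (Real.pi * t) : ℂ)) -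
        -1 * Complex.I * ((N (t + 1 * (Complex.I / 2)) - N 0) / (Real.cosh (Real.pi * t) : ℂ)))) +
      2 * N 0 * (1 / (Real.cosh (Real.pi * t) : ℂ)) := by
    intro t
    have e2 : (t : ℂ) + (-1) * (Complex.I / 2) = t - Complex.I / 2 := by ring
    have e3 : (t : ℂ) + 1 * (Complex.I / 2) = t + Complex.I / 2 := by ring
    rw [e2, e3]
    have := hne t
    have hI := Complex.I_mul_I
    generalize N (t + Complex.I / 2) = n
    generalize N (t - Complex.I / 2) = m
    field_simp
    linear_combination (n + m - 2 * N 0) * hI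
  simp only [e1]
  rw [integral_add, integral_const_mul, integral_const_mul, hkey, mul_zero, zero_add]
  · refine Integrable.const_mul ?_ _
    have := (hint _ (Or.inr rfl)).sub (hint _ (Or.inl rfl))
    simp only [hsin _ _ (Or.inr rfl), hsin _ _ (Or.inl rfl)] at this
    exact this
  · exact h1i.const_mul _

open FourierTransform in
/-- A bounded continuous function is determined by the Fourier transform of its product with the
weight `1 / cosh (π t)`. -/
theorem eq_zero_of_fourier_div_cosh {h : ℝ → ℂ} (hc : Continuous h) {C : ℝ} (hC : ∀ t, ‖h t‖ ≤ C)
    (h0 : ∀ s : ℝ, ∫ t : ℝ, Complex.exp (-Complex.I * s * t) * h t / (Real.cosh (Real.pi * t) : ℂ) = 0)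
    (t : ℝ) : h t = 0 := by
  have hne : ∀ t : ℝ, (Real.cosh (Real.pi * t) : ℂ) ≠ 0 := fun t => by
    exact_mod_cast (Real.cosh_pos _).ne'
  let g : ℝ → ℂ := fun t => h t / (Real.cosh (Real.pi * t) : ℂ)
  have hg : Continuous g := hc.div (by fun_prop) hne
  have hF : 𝓕 g = 0 := by
    ext w
    rw [Real.fourier_real_eq_integral_exp_smul, Pi.zero_apply, ← h0 (2 * Real.pi * w)]
    congr 1
    ext v
    simp only [g, smul_eq_mul, mul_div_assoc]
    congr 2
    push_cast
    ring
  have h1 := hg.fourierInv_fourier_eq (integrable_div_cosh hc hC) (by rw [hF]; exact integrable_zero _ _ _)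
  have h2 : 𝓕⁻ (0 : ℝ → ℂ) = 0 := by
    ext w
    simp [Real.fourierInv_eq]
  rw [hF, h2] at h1
  have h3 : g t = 0 := (congrFun h1 t).symm
  exact (div_eq_zero_iff.1 h3).resolve_right (hne t)

end StripIntegral

/-! ### Tomita's theorem -/

section Tomita

open MeasureTheory

variable {H : Type*} [NormedAddCommGroup H] [InnerProductSpace ℂ H] [CompleteSpace H]
  {A : VonNeumannAlgebra H} {Ω : H}

/-- The operator `J a J`. -/
noncomputable def modularConj (hΩ : IsStandardVector A Ω) (a : H →L[ℂ] H) : H →L[ℂ] H :=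
  (modularConjugation hΩ).comp (a.comp (modularConjugation hΩ))

lemma modularConj_apply (hΩ : IsStandardVector A Ω) (a : H →L[ℂ] H) (x : H) :
    modularConj hΩ a x = modularConjugation hΩ (a (modularConjugation hΩ x)) := rfl

lemma modularConj_modularConj (hΩ : IsStandardVector A Ω) (a : H →L[ℂ] H) :
    modularConj hΩ (modularConj hΩ a) = a := by
  ext x
  simp only [modularConj_apply, modularConjugation_involutive]

lemma inner_modularConj_left (hΩ : IsStandardVector A Ω) (a : H →L[ℂ] H) (x y : H) :
    ⟪modularConj hΩ a x, y⟫_ℂ = ⟪x, modularConj hΩ (star a) y⟫_ℂ := by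
  rw [modularConj_apply, modularConj_apply, inner_modularConjugation_left,
    ← inner_conj_symm x, inner_modularConjugation_left hΩ (star a _), inner_conj_symm,
    ContinuousLinearMap.inner_star_apply]

/-- Moving `d` across `a` gives `⟪cΩ, a dΩ⟫ = ⟪d* cΩ, aΩ⟫`. Substituting `aΩ = λ kΩ + Δ kΩ` with `Δ
kΩ = F k*Ω`, each term is rewritten by the adjoint relation between `S` and `F`. -/
lemma inner_commutant_apply (hΩ : IsStandardVector A Ω) {a k : H →L[ℂ] H} (ha : a ∈ A.commutant)
    (hk : k ∈ A) {lam : ℝ} (hak : IsModularImage A Ω (k Ω) (a Ω - (lam : ℂ) • k Ω))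
    {c d : H →L[ℂ] H} (hc : c ∈ A) (hd : d ∈ A) {f g : H}
    (hf : (c Ω, f) ∈ tomitaGraph A.commutant Ω) (hg : (d Ω, g) ∈ tomitaGraph A.commutant Ω) :
    ⟪c Ω, a (d Ω)⟫_ℂ = lam * ⟪star d Ω, k f⟫_ℂ + ⟪g, k (star c Ω)⟫_ℂ := by
  obtain ⟨v, hv, hv'⟩ := (isModularImage_iff hΩ).1 hak
  obtain rfl := tomitaGraph_unique hΩ (mem_tomitaGraph_of_mem Ω hk) hv
  have e1 : ⟪c Ω, d (k Ω)⟫_ℂ = ⟪star d Ω, k f⟫_ℂ := by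
    have h := inner_eq_of_mem_tomitaGraph
      (mem_tomitaGraph_of_mem Ω (star_mem (mul_mem hd hk))) hf
    rw [star_star, star_mul] at h
    have h' := congrArg conj h
    rw [inner_conj_symm, inner_conj_symm] at h'
    exact h'.trans (ContinuousLinearMap.inner_star_apply _ _ _)
  have e2 : ⟪c (star k Ω), d Ω⟫_ℂ = ⟪g, k (star c Ω)⟫_ℂ := by
    have h := inner_eq_of_mem_tomitaGraph
      (mem_tomitaGraph_of_mem Ω (mul_mem hk (star_mem hc))) hg
    rw [star_mul, star_star] at h
    exact h
  have e3 : ⟪star d (c Ω), a Ω - (lam : ℂ) • k Ω⟫_ℂ = ⟪c (star k Ω), d Ω⟫_ℂ := by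
    have h := inner_eq_of_mem_tomitaGraph
      (mem_tomitaGraph_of_mem Ω (mul_mem (star_mem hd) hc)) hv'
    rw [star_mul, star_star] at h
    have h' := congrArg conj h
    rw [inner_conj_symm, inner_conj_symm] at h'
    refine h'.symm.trans ?_
    exact ContinuousLinearMap.inner_apply_star c (star k Ω) (d Ω)
  rw [← e2, ← e3, ← e1, inner_sub_right, inner_smul_right, ContinuousLinearMap.inner_star_apply,
    ContinuousLinearMap.inner_star_apply, VonNeumannAlgebra.commute_apply hd ha]
  ring

/-- The resolvent at `λ = 1` provides the required elements of `A`: for `b ∈ A'`, `T bΩ = cΩ` with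
`c ∈ A`, `c*Ω = T b*Ω` and `F cΩ = (1 - T) b*Ω`. All maps are now bounded, so the identity extends
to the whole graph of `F`. -/
lemma inner_resolvent_commutant_apply (hΩ : IsStandardVector A Ω) {a k : H →L[ℂ] H}
    (ha : a ∈ A.commutant) (hk : k ∈ A) {lam : ℝ}
    (hak : IsModularImage A Ω (k Ω) (a Ω - (lam : ℂ) • k Ω)) {p q : H × H}
    (hp : p ∈ tomitaGraph A.commutant Ω) (hq : q ∈ tomitaGraph A.commutant Ω) :
    ⟪modularResolvent A Ω p.1, a (modularResolvent A Ω q.1)⟫_ℂ =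
      lam * ⟪modularResolvent A Ω q.2, k (p.2 - modularResolvent A Ω p.2)⟫_ℂ +
      ⟪q.2 - modularResolvent A Ω q.2, k (modularResolvent A Ω p.2)⟫_ℂ := by
  have hgen : ∀ b ∈ A.commutant, ∃ c ∈ A, c Ω = modularResolvent A Ω (b Ω) ∧
      star c Ω = modularResolvent A Ω (star b Ω) ∧
      (c Ω, star b Ω - modularResolvent A Ω (star b Ω)) ∈ tomitaGraph A.commutant Ω := by
    intro b hb
    obtain ⟨c, hc, hcb⟩ := hΩ.exists_resolvent_mem hb one_pos
    rw [Complex.ofReal_one, one_smul] at hcb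
    have h1 : c Ω = modularResolvent A Ω (b Ω) := (modularResolvent_eq_of_isModularImage hcb).symm
    obtain ⟨h2, h3⟩ := modularResolvent_intertwine_commutant hΩ (mem_tomitaGraph_of_mem Ω hb)
    rw [← h1] at h2 h3
    exact ⟨c, hc, h1, tomitaGraph_unique hΩ (mem_tomitaGraph_of_mem Ω hc) h2, h3⟩
  have hclosed : ∀ q : H × H, IsClosed {p : H × H | ⟪modularResolvent A Ω p.1, a (modularResolvent A Ω q.1)⟫_ℂ =
      lam * ⟪modularResolvent A Ω q.2, k (p.2 - modularResolvent A Ω p.2)⟫_ℂ +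
      ⟪q.2 - modularResolvent A Ω q.2, k (modularResolvent A Ω p.2)⟫_ℂ} := fun q =>
    isClosed_eq (by fun_prop) (by fun_prop)
  refine closure_minimal ?_ (hclosed q) hp
  rintro _ ⟨b, hb, rfl⟩
  have hclosed' : IsClosed {q : H × H | ⟪modularResolvent A Ω (b Ω), a (modularResolvent A Ω q.1)⟫_ℂ =
      lam * ⟪modularResolvent A Ω q.2, k (star b Ω - modularResolvent A Ω (star b Ω))⟫_ℂ +
      ⟪q.2 - modularResolvent A Ω q.2, k (modularResolvent A Ω (star b Ω))⟫_ℂ} :=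
    isClosed_eq (by fun_prop) (by fun_prop)
  refine closure_minimal ?_ hclosed' hq
  rintro _ ⟨b', hb', rfl⟩
  obtain ⟨c, hc, h1, h2, h3⟩ := hgen b hb
  obtain ⟨d, hd, h1', h2', h3'⟩ := hgen b' hb'
  have := inner_commutant_apply hΩ ha hk hak hc hd h3 h3'
  rw [h1, h2, h1', h2'] at this
  exact this

/-- The operator form of the equation `(λ + Δ) k Ω = a Ω` for `a ∈ A'` and `k ∈ A`. -/
theorem inner_weight_commutant_apply (hΩ : IsStandardVector A Ω) {a k : H →L[ℂ] H}
    (ha : a ∈ A.commutant) (hk : k ∈ A) {lam : ℝ}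
    (hak : IsModularImage A Ω (k Ω) (a Ω - (lam : ℂ) • k Ω)) (x y : H) :
    ⟪modularWeight A Ω (modularWeight A Ω x), a (modularWeight A Ω (modularWeight A Ω y))⟫_ℂ =
      lam * ⟪modularResolvent A Ω (modularWeight A Ω x), modularConj hΩ (star k)
        (modularWeight A Ω y - modularResolvent A Ω (modularWeight A Ω y))⟫_ℂ +
      ⟪modularWeight A Ω x - modularResolvent A Ω (modularWeight A Ω x), modularConj hΩ (star k)
        (modularResolvent A Ω (modularWeight A Ω y))⟫_ℂ := by
  have h := inner_resolvent_commutant_apply hΩ ha hk hak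
    (tomitaGraph_swap (modularConjugation_weight_mem hΩ x).2)
    (tomitaGraph_swap (modularConjugation_weight_mem hΩ y).2)
  simp only at h
  have hJ : ∀ z, modularResolvent A Ω (modularConjugation hΩ z) =
      modularConjugation hΩ (z - modularResolvent A Ω z) := fun z => by
    rw [map_sub, modularConjugation_resolvent, sub_sub_cancel]
  have hJ' : ∀ z, modularConjugation hΩ z - modularResolvent A Ω (modularConjugation hΩ z) =
      modularConjugation hΩ (modularResolvent A Ω z) := fun z =>
    (modularConjugation_resolvent hΩ z).symm
  have hk' : ∀ z w, ⟪modularConjugation hΩ z, k (modularConjugation hΩ w)⟫_ℂ =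
      ⟪w, modularConj hΩ (star k) z⟫_ℂ := fun z w => by
    rw [← ContinuousLinearMap.inner_star_apply, modularConj_apply,
      ← inner_modularConjugation hΩ _ w, modularConjugation_involutive]
  rw [hJ', hJ', hJ, hJ, hk', hk'] at h
  rw [modularWeight_weight, modularWeight_weight, ← map_sub, ← map_sub, h]

/-- The rigorous form of `a = λ Δ^{-1/2} m Δ^{1/2} + Δ^{1/2} m Δ^{-1/2}` with `m = J k* J`. Cutting
off with `φ` on both sides makes every power of `Δ` bounded. -/
lemma inner_modularCc_commutant_apply (hΩ : IsStandardVector A Ω) {a k : H →L[ℂ] H}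
    (ha : a ∈ A.commutant) (hk : k ∈ A) {lam : ℝ}
    (hak : IsModularImage A Ω (k Ω) (a Ω - (lam : ℂ) • k Ω)) {φ : ℝ → ℂ} (hφ : IsCc φ) (z w : ℂ)
    (x y : H) :
    ⟪modularCc A Ω (fun r => φ r * (r : ℂ) ^ z) x, a (modularCc A Ω (fun r => φ r * (r : ℂ) ^ w) y)⟫_ℂ =
      lam * ⟪modularCc A Ω (fun r => φ r * (r : ℂ) ^ (z - 1 / 2)) x, modularConj hΩ (star k)
        (modularCc A Ω (fun r => φ r * (r : ℂ) ^ (w + 1 / 2)) y)⟫_ℂ +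
      ⟪modularCc A Ω (fun r => φ r * (r : ℂ) ^ (z + 1 / 2)) x, modularConj hΩ (star k)
        (modularCc A Ω (fun r => φ r * (r : ℂ) ^ (w - 1 / 2)) y)⟫_ℂ := by
  have hcont : ∀ f : ℝ → ℝ, ContinuousOn f (Set.Ioi 0) → ContinuousOn (fun r => (f r : ℂ)) (Set.Ioi 0) :=
    fun f hf => Complex.continuous_ofReal.comp_continuousOn hf
  have hw0 : ContinuousOn (fun r : ℝ => ((√r / (1 + r) : ℝ) : ℂ)) (Set.Ioi 0) :=
    hcont _ (ContinuousOn.div (by fun_prop) (by fun_prop) fun r hr => by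
      have : 0 < r := hr
      positivity)
  have hr0 : ContinuousOn (fun r : ℝ => ((1 / (1 + r) : ℝ) : ℂ)) (Set.Ioi 0) :=
    hcont _ (ContinuousOn.div (by fun_prop) (by fun_prop) fun r hr => by
      have : 0 < r := hr
      positivity)
  have hg0 : ContinuousOn (fun r : ℝ => (((1 + r) ^ 2 / r : ℝ) : ℂ)) (Set.Ioi 0) :=
    hcont _ (ContinuousOn.div (by fun_prop) (by fun_prop) fun r hr => ne_of_gt hr)
  have hwφ : ∀ ψ : ℝ → ℂ, IsCc ψ → ∀ x, modularWeight A Ω (modularCc A Ω ψ x) =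
      modularCc A Ω (fun r => ψ r * ((√r / (1 + r) : ℝ) : ℂ)) x := fun ψ hψ x =>
    (isModularFun_weight _).unique hΩ (IsModularFun.cc hw0 hψ x)
  have hrφ : ∀ ψ : ℝ → ℂ, IsCc ψ → ∀ x, modularResolvent A Ω (modularCc A Ω ψ x) =
      modularCc A Ω (fun r => ψ r * ((1 / (1 + r) : ℝ) : ℂ)) x := fun ψ hψ x =>
    (isModularFun_resolvent _).unique hΩ (IsModularFun.cc hr0 hψ x)
  -- The factor `(1 + r)² / r` is the inverse of the symbol `r / (1 + r)²` of the squared weight, so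
  -- it cancels the weights in `inner_weight_commutant_apply`.
  have hz : ∀ z : ℂ, IsCc fun r => φ r * (r : ℂ) ^ z * (((1 + r) ^ 2 / r : ℝ) : ℂ) := fun z =>
    (hφ.mul (continuousOn_ofReal_cpow z)).mul hg0
  have hsqrt : ∀ r : ℝ, 0 < r → (√r : ℂ) = (r : ℂ) ^ (1 / 2 : ℂ) := fun r hr => by
    rw [Real.sqrt_eq_rpow, Complex.ofReal_cpow hr.le]
    norm_num
  have e1 : ∀ (z : ℂ) x, modularWeight A Ω (modularWeight A Ω (modularCc A Ω
      (fun r => φ r * (r : ℂ) ^ z * (((1 + r) ^ 2 / r : ℝ) : ℂ)) x)) =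
      modularCc A Ω (fun r => φ r * (r : ℂ) ^ z) x := by
    intro z x
    rw [hwφ _ (hz z), hwφ _ ((hz z).mul hw0)]
    refine DFunLike.congr_fun (modularCc_congr (((hz z).mul hw0).mul hw0)
      (hφ.mul (continuousOn_ofReal_cpow z)) fun r hr => ?_) x
    have : (1 + r) ^ 2 / r * (√r / (1 + r)) * (√r / (1 + r)) = 1 := by
      have := Real.mul_self_sqrt hr.le
      field_simp
      rw [sq, this]
    rw [mul_assoc, mul_assoc, ← mul_assoc (((1 + r) ^ 2 / r : ℝ) : ℂ), ← Complex.ofReal_mul,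
      ← Complex.ofReal_mul, this, Complex.ofReal_one, mul_one]
  have e2 : ∀ (z : ℂ) x, modularResolvent A Ω (modularWeight A Ω (modularCc A Ω
      (fun r => φ r * (r : ℂ) ^ z * (((1 + r) ^ 2 / r : ℝ) : ℂ)) x)) =
      modularCc A Ω (fun r => φ r * (r : ℂ) ^ (z - 1 / 2)) x := by
    intro z x
    rw [hwφ _ (hz z), hrφ _ ((hz z).mul hw0)]
    refine DFunLike.congr_fun (modularCc_congr (((hz z).mul hw0).mul hr0)
      (hφ.mul (continuousOn_ofReal_cpow _)) fun r hr => ?_) x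
    have : (1 + r) ^ 2 / r * (√r / (1 + r)) * (1 / (1 + r)) * √r = 1 := by
      have := Real.mul_self_sqrt hr.le
      field_simp
      rw [sq, this]
    have h2 : (r : ℂ) ^ z = (r : ℂ) ^ (z - 1 / 2) * (√r : ℂ) := by
      rw [hsqrt r hr, ← ofReal_cpow_add hr, sub_add_cancel]
    rw [h2]
    have h3 := congrArg (fun x : ℝ => (x : ℂ)) this
    simp only [Complex.ofReal_mul, Complex.ofReal_one] at h3
    linear_combination φ r * (r : ℂ) ^ (z - 1 / 2) * h3
  have e3 : ∀ (z : ℂ) x, modularWeight A Ω (modularCc A Ω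
      (fun r => φ r * (r : ℂ) ^ z * (((1 + r) ^ 2 / r : ℝ) : ℂ)) x) - modularResolvent A Ω
      (modularWeight A Ω (modularCc A Ω
      (fun r => φ r * (r : ℂ) ^ z * (((1 + r) ^ 2 / r : ℝ) : ℂ)) x)) =
      modularCc A Ω (fun r => φ r * (r : ℂ) ^ (z + 1 / 2)) x := by
    intro z x
    rw [e2, sub_eq_iff_eq_add, hwφ _ (hz z), ← add_apply,
      ← modularCc_add (hφ.mul (continuousOn_ofReal_cpow _)) (hφ.mul (continuousOn_ofReal_cpow _))]
    refine DFunLike.congr_fun (modularCc_congr ((hz z).mul hw0)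
      ((hφ.mul (continuousOn_ofReal_cpow _)).add (hφ.mul (continuousOn_ofReal_cpow _)))
      fun r hr => ?_) x
    have : (1 + r) ^ 2 / r * (√r / (1 + r)) * √r = 1 + r := by
      have := Real.mul_self_sqrt hr.le
      field_simp
      rw [sq, this]
    have h2 : (r : ℂ) ^ z = (r : ℂ) ^ (z - 1 / 2) * (√r : ℂ) := by
      rw [hsqrt r hr, ← ofReal_cpow_add hr, sub_add_cancel]
    have h4 : (r : ℂ) ^ (z + 1 / 2) = (r : ℂ) ^ (z - 1 / 2) * r := by
      have h5 := ofReal_cpow_add hr (z - 1 / 2) 1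
      rw [Complex.cpow_one] at h5
      rw [← h5]
      congr 1
      ring
    rw [h2, h4]
    have h3 := congrArg (fun x : ℝ => (x : ℂ)) this
    simp only [Complex.ofReal_mul, Complex.ofReal_one, Complex.ofReal_add] at h3
    linear_combination φ r * (r : ℂ) ^ (z - 1 / 2) * h3
  have h := inner_weight_commutant_apply hΩ ha hk hak
    (modularCc A Ω (fun r => φ r * (r : ℂ) ^ z * (((1 + r) ^ 2 / r : ℝ) : ℂ)) x)
    (modularCc A Ω (fun r => φ r * (r : ℂ) ^ w * (((1 + r) ^ 2 / r : ℝ) : ℂ)) y)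
  rwa [e1, e1, e3, e3, e2, e2] at h

lemma inner_modularUnitary_commutant_modularCc (hΩ : IsStandardVector A Ω) {a k : H →L[ℂ] H}
    (ha : a ∈ A.commutant) (hk : k ∈ A) {s : ℝ}
    (hak : IsModularImage A Ω (k Ω) (a Ω - (Real.exp s : ℂ) • k Ω)) (n : ℕ) (x y : H) :
    ∫ t : ℝ, Complex.exp (-Complex.I * s * t) *
        ⟪modularUnitary hΩ (-t) (modularCc A Ω (modularCutoff n) x),
          a (modularUnitary hΩ (-t) (modularCc A Ω (modularCutoff n) y))⟫_ℂ /
        (Real.cosh (Real.pi * t) : ℂ) =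
      2 * (Complex.exp (s / 2) * ⟪modularCc A Ω (modularCutoff n) x,
        modularConj hΩ (star k) (modularCc A Ω (modularCutoff n) y)⟫_ℂ) *
      ∫ t : ℝ, 1 / (Real.cosh (Real.pi * t) : ℂ) := by
  set φ := modularCutoff n with hφdef
  have hφ : IsCc φ := isCc_modularCutoff n
  set m := modularConj hΩ (star k) with hm
  -- Chosen so that `N (t + i/2) + N (t - i/2)` is the numerator of the integrand: the shifts by
  -- `±i/2` produce the half powers of `Δ` around `m`, and the exponentials yield the coefficients
  -- `e^s` and `1`. The conjugate in the conjugate-linear slot makes `N` holomorphic.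
  let N : ℂ → ℂ := fun z => Complex.exp (s / 2) * (Complex.exp (-Complex.I * s * z) *
    ⟪modularCc A Ω (fun r => φ r * (r : ℂ) ^ (-Complex.I * conj z)) x,
      m (modularCc A Ω (fun r => φ r * (r : ℂ) ^ (-Complex.I * z)) y)⟫_ℂ)
  have hconj : ∀ r, conj (φ r) = φ r := fun r => Complex.conj_ofReal _
  have hN1 : ∀ z : ℂ, ⟪modularCc A Ω (fun r => φ r * (r : ℂ) ^ (-Complex.I * conj z)) x,
      m (modularCc A Ω (fun r => φ r * (r : ℂ) ^ (-Complex.I * z)) y)⟫_ℂ =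
      ⟪x, (modularCc A Ω (fun r => φ r * (r : ℂ) ^ (Complex.I * z))) (m
        (modularCc A Ω (fun r => φ r * (r : ℂ) ^ (-Complex.I * z)) y))⟫_ℂ := by
    intro z
    rw [inner_modularCc_left]
    have h0 : ∀ (f g : ℝ → ℂ) (u : H), modularCc A Ω f = modularCc A Ω g →
        ⟪x, modularCc A Ω f u⟫_ℂ = ⟪x, modularCc A Ω g u⟫_ℂ := fun f g u h => by rw [h]
    refine h0 _ _ _ (modularCc_congr (hφ.mul (continuousOn_ofReal_cpow _)).star
      (hφ.mul (continuousOn_ofReal_cpow _)) fun r hr => ?_)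
    rw [map_mul, hconj, conj_ofReal_cpow hr]
    simp
  have hE := differentiable_modularCc_cpow A Ω hφ
  have hNd : Differentiable ℂ N := by
    simp only [N, hN1]
    have h1 : Differentiable ℂ fun z : ℂ => modularCc A Ω (fun r => φ r * (r : ℂ) ^ (Complex.I * z)) :=
      hE.comp (by fun_prop : Differentiable ℂ fun z : ℂ => Complex.I * z)
    have h2 : Differentiable ℂ fun z : ℂ => modularCc A Ω (fun r => φ r * (r : ℂ) ^ (-Complex.I * z)) :=
      hE.comp (by fun_prop : Differentiable ℂ fun z : ℂ => -Complex.I * z)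
    have h3 : Differentiable ℂ fun z : ℂ => (modularCc A Ω (fun r => φ r * (r : ℂ) ^ (Complex.I * z))) (m
        (modularCc A Ω (fun r => φ r * (r : ℂ) ^ (-Complex.I * z)) y)) :=
      h1.clm_apply (m.differentiable.comp (h2.clm_apply (differentiable_const y)))
    have h4 : Differentiable ℂ fun z : ℂ => ⟪x, (modularCc A Ω (fun r => φ r * (r : ℂ) ^ (Complex.I * z))) (m
        (modularCc A Ω (fun r => φ r * (r : ℂ) ^ (-Complex.I * z)) y))⟫_ℂ :=
      (innerSL ℂ x).differentiable.comp h3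
    fun_prop
  obtain ⟨C, hC⟩ := hφ.exists_norm_mul_cpow_le
  have hC0 : 0 ≤ C := (norm_nonneg _).trans (hC 0 (by simp) 1 one_pos)
  have hNb : ∀ z : ℂ, |z.im| ≤ 1 / 2 → ‖N z‖ ≤ ‖Complex.exp (s / 2)‖ *
      (Real.exp |s| * ((C * ‖x‖) * (‖m‖ * (C * ‖y‖)))) := by
    intro z hz
    simp only [N]
    rw [norm_mul, norm_mul]
    have h1 : ‖Complex.exp (-Complex.I * s * z)‖ ≤ Real.exp |s| := by
      rw [Complex.norm_exp, Real.exp_le_exp]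
      have : (-Complex.I * s * z).re = s * z.im := by simp
      rw [this]
      refine (le_abs_self _).trans ?_
      rw [abs_mul]
      nlinarith [abs_nonneg s]
    have h2 : ∀ w : ℂ, |w.re| ≤ 1 → ∀ x : H, ‖modularCc A Ω (fun r => φ r * (r : ℂ) ^ w) x‖ ≤ C * ‖x‖ :=
      fun w hw x => norm_modularCc_apply_le (hφ.mul (continuousOn_ofReal_cpow w)) (hC w hw) x
    have h3 := h2 (-Complex.I * conj z) (by simp; linarith) x
    have h4 := h2 (-Complex.I * z) (by simp; linarith) y
    have h5 := m.le_opNorm (modularCc A Ω (fun r => φ r * (r : ℂ) ^ (-Complex.I * z)) y)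
    refine mul_le_mul_of_nonneg_left (mul_le_mul h1 ?_ (norm_nonneg _) (Real.exp_pos _).le) (norm_nonneg _)
    refine (norm_inner_le_norm _ _).trans (mul_le_mul h3 (h5.trans ?_) (norm_nonneg _) (by positivity))
    gcongr
  have hmain := integral_strip_div_cosh hNd hNb
  have hN0 : N 0 = Complex.exp (s / 2) * ⟪modularCc A Ω φ x, m (modularCc A Ω φ y)⟫_ℂ := by
    simp [N]
  rw [hN0] at hmain
  rw [← hmain]
  congr 1
  ext t
  congr 1
  have hU : ∀ x, modularUnitary hΩ (-t) (modularCc A Ω φ x) =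
      modularCc A Ω (fun r => φ r * (r : ℂ) ^ (-Complex.I * t)) x := fun x => by
    rw [modularUnitary_modularCc hΩ (-t) hφ]
    simp
  rw [hU, hU, inner_modularCc_commutant_apply hΩ ha hk hak hφ]
  simp only [N]
  have f1 : -Complex.I * conj ((t : ℂ) + Complex.I / 2) = -Complex.I * t - 1 / 2 := by
    simp only [map_add, map_div₀, Complex.conj_ofReal, Complex.conj_I, map_ofNat]
    linear_combination (1 / 2 : ℂ) * Complex.I_mul_I
  have f2 : -Complex.I * ((t : ℂ) + Complex.I / 2) = -Complex.I * t + 1 / 2 := by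
    linear_combination (-1 / 2 : ℂ) * Complex.I_mul_I
  have f3 : -Complex.I * conj ((t : ℂ) - Complex.I / 2) = -Complex.I * t + 1 / 2 := by
    simp only [map_sub, map_div₀, Complex.conj_ofReal, Complex.conj_I, map_ofNat]
    linear_combination (-1 / 2 : ℂ) * Complex.I_mul_I
  have f4 : -Complex.I * ((t : ℂ) - Complex.I / 2) = -Complex.I * t - 1 / 2 := by
    linear_combination (1 / 2 : ℂ) * Complex.I_mul_I
  rw [f1, f2, f3, f4]
  have g1 : Complex.exp (s / 2) * Complex.exp (-Complex.I * s * ((t : ℂ) + Complex.I / 2)) =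
      Complex.exp (-Complex.I * s * t) * (Real.exp s : ℂ) := by
    rw [Complex.ofReal_exp, ← Complex.exp_add, ← Complex.exp_add]
    congr 1
    linear_combination (-s / 2 : ℂ) * Complex.I_mul_I
  have g2 : Complex.exp (s / 2) * Complex.exp (-Complex.I * s * ((t : ℂ) - Complex.I / 2)) =
      Complex.exp (-Complex.I * s * t) := by
    rw [← Complex.exp_add]
    congr 1
    linear_combination (s / 2 : ℂ) * Complex.I_mul_I
  rw [← mul_assoc (Complex.exp (s / 2)), ← mul_assoc (Complex.exp (s / 2)), g1, g2]
  ring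

/-- The integral formula for the modular flow: the operators `J k* J`, where
`(exp s + Δ) k Ω = a Ω`, are weighted Fourier coefficients of the modular flow of `a`. -/
theorem integral_modularUnitary_commutant (hΩ : IsStandardVector A Ω) {a k : H →L[ℂ] H}
    (ha : a ∈ A.commutant) (hk : k ∈ A) {s : ℝ}
    (hak : IsModularImage A Ω (k Ω) (a Ω - (Real.exp s : ℂ) • k Ω)) (x y : H) :
    ∫ t : ℝ, Complex.exp (-Complex.I * s * t) *
        ⟪modularUnitary hΩ (-t) x, a (modularUnitary hΩ (-t) y)⟫_ℂ /
        (Real.cosh (Real.pi * t) : ℂ) =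
      2 * (Complex.exp (s / 2) * ⟪x, modularConj hΩ (star k) y⟫_ℂ) *
      ∫ t : ℝ, 1 / (Real.cosh (Real.pi * t) : ℂ) := by
  set X : ℕ → H := fun n => modularCc A Ω (modularCutoff n) x with hX
  set Y : ℕ → H := fun n => modularCc A Ω (modularCutoff n) y with hY
  have hXl : Tendsto X atTop (𝓝 x) := tendsto_modularCutoff hΩ x
  have hYl : Tendsto Y atTop (𝓝 y) := tendsto_modularCutoff hΩ y
  have hb : ∀ n z, ‖modularCc A Ω (modularCutoff n) z‖ ≤ ‖z‖ := fun n z => by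
    have := norm_modularCc_apply_le (A := A) (Ω := Ω) (isCc_modularCutoff n)
      (fun y _ => norm_modularCutoff_le n y) z
    rwa [one_mul] at this
  have l1 : Tendsto (fun n => 2 * (Complex.exp (s / 2) * ⟪X n, modularConj hΩ (star k) (Y n)⟫_ℂ) *
      ∫ t : ℝ, 1 / (Real.cosh (Real.pi * t) : ℂ)) atTop
      (𝓝 (2 * (Complex.exp (s / 2) * ⟪x, modularConj hΩ (star k) y⟫_ℂ) *
      ∫ t : ℝ, 1 / (Real.cosh (Real.pi * t) : ℂ))) := by
    have := hXl.inner (𝕜 := ℂ) (((modularConj hΩ (star k)).continuous.tendsto y).comp hYl)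
    exact ((this.const_mul _).const_mul _).mul_const _
  refine tendsto_nhds_unique ?_ l1
  simp only [hX, hY, ← inner_modularUnitary_commutant_modularCc hΩ ha hk hak]
  have hcU : ∀ z, Continuous fun t : ℝ => modularUnitary hΩ (-t) z := fun z =>
    (continuous_modularUnitary_apply hΩ z).comp continuous_neg
  refine tendsto_integral_of_dominated_convergence
    (fun t : ℝ => ‖x‖ * (‖a‖ * ‖y‖) * (Real.cosh (Real.pi * t))⁻¹) (fun n => ?_)
    (Real.integrable_inv_cosh_pi_mul.const_mul _) (fun n => Eventually.of_forall fun t => ?_)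
    (Eventually.of_forall fun t => ?_)
  · refine Continuous.aestronglyMeasurable (Continuous.div ?_ (by fun_prop) fun t => ?_)
    · have h1 := hcU (X n)
      have h2 := hcU (Y n)
      exact (by fun_prop : Continuous fun t : ℝ => Complex.exp (-Complex.I * s * t)).mul
        (h1.inner (a.continuous.comp h2))
    · exact_mod_cast (Real.cosh_pos _).ne'
  · rw [norm_div, Complex.norm_real, Real.norm_of_nonneg (Real.cosh_pos _).le, div_eq_mul_inv, norm_mul]
    refine mul_le_mul_of_nonneg_right ?_ (inv_nonneg.2 (Real.cosh_pos _).le)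
    have e1 : ‖Complex.exp (-Complex.I * s * t)‖ = 1 := by
      rw [Complex.norm_exp]
      simp
    rw [e1, one_mul]
    refine (norm_inner_le_norm _ _).trans ?_
    have h2 := a.le_opNorm (modularUnitary hΩ (-t) (Y n))
    rw [norm_modularUnitary] at h2 ⊢
    exact mul_le_mul (hb n x) (h2.trans (by gcongr; exact hb n y)) (norm_nonneg _) (norm_nonneg _)
  · have hU := fun z (Z : ℕ → H) (h : Tendsto Z atTop (𝓝 z)) =>
      ((modularUnitary hΩ (-t)).continuous.tendsto z).comp h
    have := (hU x X hXl).inner (𝕜 := ℂ) ((a.continuous.tendsto _).comp (hU y Y hYl))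
    exact (this.const_mul _).div_const _

lemma modularConj_comm (hΩ : IsStandardVector A Ω) {a b : H →L[ℂ] H} (ha : a ∈ A)
    (hb : b ∈ A.commutant) (x : H) :
    modularConj hΩ a (modularConj hΩ b x) = modularConj hΩ b (modularConj hΩ a x) := by
  simp only [modularConj_apply, modularConjugation_involutive]
  rw [VonNeumannAlgebra.commute_apply ha hb]

/-- The modular flow maps `A'` into the commutant of `J A' J`. -/
lemma modularUnitary_conj_commutant_comm (hΩ : IsStandardVector A Ω) {a c : H →L[ℂ] H}
    (ha : a ∈ A.commutant) (hc : c ∈ A.commutant) (t : ℝ) (y : H) :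
    modularUnitary hΩ t (a (modularUnitary hΩ (-t) (modularConj hΩ c y))) =
      modularConj hΩ c (modularUnitary hΩ t (a (modularUnitary hΩ (-t) y))) := by
  refine ext_inner_left ℂ fun x => ?_
  rw [← sub_eq_zero]
  have hU : ∀ t x y, ⟪x, modularUnitary hΩ t y⟫_ℂ = ⟪modularUnitary hΩ (-t) x, y⟫_ℂ := fun t x y => by
    rw [inner_modularUnitary_left, neg_neg]
  have hadj : ∀ x y, ⟪x, modularConj hΩ c y⟫_ℂ = ⟪modularConj hΩ (star c) x, y⟫_ℂ := fun x y => by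
    rw [inner_modularConj_left, star_star]
  rw [hadj, hU, hU]
  set x' := modularConj hΩ (star c) x
  set y' := modularConj hΩ c y
  have hcU : ∀ z, Continuous fun t : ℝ => modularUnitary hΩ (-t) z := fun z =>
    (continuous_modularUnitary_apply hΩ z).comp continuous_neg
  have hcont : ∀ x y, Continuous fun t : ℝ => ⟪modularUnitary hΩ (-t) x, a (modularUnitary hΩ (-t) y)⟫_ℂ :=
    fun x y => (hcU x).inner (a.continuous.comp (hcU y))
  have hbd : ∀ x y, ∀ t : ℝ, ‖⟪modularUnitary hΩ (-t) x, a (modularUnitary hΩ (-t) y)⟫_ℂ‖ ≤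
      ‖x‖ * (‖a‖ * ‖y‖) := fun x y t => by
    refine (norm_inner_le_norm _ _).trans ?_
    have h2 := a.le_opNorm (modularUnitary hΩ (-t) y)
    rw [norm_modularUnitary] at h2 ⊢
    gcongr
  refine eq_zero_of_fourier_div_cosh (h := fun t =>
    ⟪modularUnitary hΩ (-t) x, a (modularUnitary hΩ (-t) y')⟫_ℂ -
      ⟪modularUnitary hΩ (-t) x', a (modularUnitary hΩ (-t) y)⟫_ℂ)
    ((hcont _ _).sub (hcont _ _))
    (fun t => (norm_sub_le _ _).trans (add_le_add (hbd _ _ t) (hbd _ _ t))) (fun s => ?_) t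
  -- For each frequency `s`, the coefficient of the flow of `a` is a multiple of `J k* J` with `k ∈
  -- A`, and this commutes with `J c J` for `c ∈ A'`. All coefficients of the difference therefore
  -- vanish.
  obtain ⟨k, hk, hak⟩ := hΩ.exists_resolvent_mem ha (Real.exp_pos s)
  have hi : ∀ x y, Integrable fun t : ℝ => Complex.exp (-Complex.I * s * t) *
      ⟪modularUnitary hΩ (-t) x, a (modularUnitary hΩ (-t) y)⟫_ℂ / (Real.cosh (Real.pi * t) : ℂ) := by
    intro x y
    refine integrable_div_cosh ((by fun_prop : Continuous fun t : ℝ =>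
      Complex.exp (-Complex.I * s * t)).mul (hcont x y)) (C := ‖x‖ * (‖a‖ * ‖y‖)) fun t => ?_
    have e1 : ‖Complex.exp (-Complex.I * s * t)‖ = 1 := by
      rw [Complex.norm_exp]
      simp
    rw [norm_mul, e1, one_mul]
    exact hbd x y t
  simp only [mul_sub, sub_div]
  rw [integral_sub (hi _ _) (hi _ _), integral_modularUnitary_commutant hΩ ha hk hak,
    integral_modularUnitary_commutant hΩ ha hk hak]
  have : ⟪x, modularConj hΩ (star k) y'⟫_ℂ = ⟪x', modularConj hΩ (star k) y⟫_ℂ := by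
    rw [← hadj, ← modularConj_comm hΩ (star_mem hk) hc]
  rw [this, sub_self]

/-- At time zero the commutation theorem says that `J c J` commutes with all of `A'`, so it lies in
the bicommutant. -/
lemma modularConj_mem_of_mem_commutant (hΩ : IsStandardVector A Ω) {c : H →L[ℂ] H}
    (hc : c ∈ A.commutant) : modularConj hΩ c ∈ A := by
  refine VonNeumannAlgebra.mem_of_commute fun b hb x => ?_
  have := modularUnitary_conj_commutant_comm hΩ hb hc 0 x
  simpa [modularUnitary_zero] using this

/-- Tomita's theorem: `J A J ⊆ A'`. -/
theorem modularConj_mem_commutant (hΩ : IsStandardVector A Ω) {c : H →L[ℂ] H} (hc : c ∈ A) :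
    modularConj hΩ c ∈ A.commutant := by
  have := modularConj_mem_of_mem_commutant hΩ.commutant (c := c) (by rwa [A.commutant_commutant])
  rwa [modularConj, modularConjugation_commutant hΩ] at this

/-- The operator `Δ ^ (i t) a Δ ^ (-i t)`. -/
noncomputable def modularFlow (hΩ : IsStandardVector A Ω) (t : ℝ) (a : H →L[ℂ] H) : H →L[ℂ] H :=
  modularUnitary hΩ t * a * modularUnitary hΩ (-t)

/-- Tomita's theorem: the modular flow preserves the algebra. -/
theorem modularFlow_mem (hΩ : IsStandardVector A Ω) (t : ℝ) {a : H →L[ℂ] H} (ha : a ∈ A) :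
    modularFlow hΩ t a ∈ A := by
  refine VonNeumannAlgebra.mem_of_commute fun b hb x => ?_
  -- Since `a = J c J` with `c = J a J ∈ A'`, it commutes with the flow of `b` at time `-t`;
  -- conjugating back makes the flow of `a` commute with `b`.
  have key : ∀ z, modularUnitary hΩ (-t) (b (modularUnitary hΩ t (a z))) =
      a (modularUnitary hΩ (-t) (b (modularUnitary hΩ t z))) := by
    intro z
    have h := modularUnitary_conj_commutant_comm hΩ hb (modularConj_mem_commutant hΩ ha) (-t) z
    rwa [modularConj_modularConj, neg_neg] at h
  have h := congrArg (modularUnitary hΩ t) (key (modularUnitary hΩ (-t) x))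
  rw [modularUnitary_apply_neg, modularUnitary_apply_neg] at h
  exact h

end Tomita

/-! ### Eigenvectors and weakly decaying orbits of the modular group -/

section Mixing

variable {H : Type*} [NormedAddCommGroup H] [InnerProductSpace ℂ H] [CompleteSpace H]
  {A : VonNeumannAlgebra H} {Ω : H}

namespace IsModularFun

lemma of_comp {h g : ℝ → ℂ} (hg : ContinuousOn g (Set.Ioi 0)) {ξ η ζ : H}
    (h1 : IsModularFun A Ω h ξ η) (h2 : IsModularFun A Ω (fun x => g x * h x) ξ ζ) :
    IsModularFun A Ω g η ζ :=
  isModularFun_of_forall fun φ hφ => by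
    rw [← h2.apply hφ, ← h1.apply (hφ.mul hg)]
    simp only [mul_assoc]

lemma symm {h : ℝ → ℂ} (hh : ContinuousOn h (Set.Ioi 0)) (h0 : ∀ x, 0 < x → h x ≠ 0) {ξ η : H}
    (h1 : IsModularFun A Ω h ξ η) : IsModularFun A Ω (fun x => (h x)⁻¹) η ξ := by
  have hi : ContinuousOn (fun x => (h x)⁻¹) (Set.Ioi 0) := hh.inv₀ h0
  exact of_comp hi h1 ((one ξ).congr continuousOn_const (hi.mul hh)
    fun x hx => (inv_mul_cancel₀ (h0 x hx)).symm)

/-- An eigenvector of `g(Δ)` with eigenvalue `g(p)` is an eigenvector of `h(Δ)`, if `g` takes the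
value `g(p)` only at `p`. -/
lemma eigenvector {g h : ℝ → ℂ} (hg : ContinuousOn g (Set.Ioi 0)) (hh : ContinuousOn h (Set.Ioi 0))
    {p : ℝ} (hp : 0 < p) (hgp : DifferentiableAt ℝ g p) (hhp : DifferentiableAt ℝ h p)
    (hinj : ∀ x, 0 < x → x ≠ p → g x ≠ g p) (hd : deriv g p ≠ 0) {v : H}
    (h1 : IsModularFun A Ω g v (g p • v)) : IsModularFun A Ω h v (h p • v) := by
  have hn : Set.Ioi (0 : ℝ) ∈ 𝓝 p := Ioi_mem_nhds hp
  have hdg : ContinuousOn (dslope g p) (Set.Ioi 0) := (continuousOn_dslope hn).2 ⟨hg, hgp⟩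
  have hdh : ContinuousOn (dslope h p) (Set.Ioi 0) := (continuousOn_dslope hn).2 ⟨hh, hhp⟩
  have h0 : ∀ x ∈ Set.Ioi (0 : ℝ), dslope g p x ≠ 0 := by
    intro x hx
    by_cases h : x = p
    · rwa [h, dslope_same]
    · rw [dslope_of_ne _ h, slope_def_module]
      exact smul_ne_zero (inv_ne_zero (sub_ne_zero.2 h)) (sub_ne_zero.2 (hinj x hx h))
  -- The difference quotients give `h - h(p) = k (g - g(p))` with `k` continuous through `p`, where
  -- the derivative condition is used. Hence `h(Δ) - h(p)` annihilates `v`.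
  have hk : ContinuousOn (fun x => dslope h p x / dslope g p x) (Set.Ioi 0) := hdh.div hdg h0
  have h2 := h1.fun_add hg continuousOn_const (const (-g p) v)
  rw [neg_smul, add_neg_cancel] at h2
  have h3 := (h2.comp hk (zero _)).fun_add (hk.mul (hg.add continuousOn_const)) continuousOn_const
    (const (h p) v)
  rw [zero_add] at h3
  refine h3.congr ((hk.mul (hg.add continuousOn_const)).add continuousOn_const) hh fun x hx => ?_
  have e1 := sub_smul_dslope g p x
  have e2 := sub_smul_dslope h p x
  rw [Complex.real_smul] at e1 e2
  have := h0 x hx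
  change dslope h p x / dslope g p x * (g x + -g p) + h p = h x
  rw [← sub_eq_add_neg, ← e1, ← sub_add_cancel (h x) (h p), ← e2]
  field_simp

lemma eigenvector_of_resolvent {h : ℝ → ℂ} (hh : ContinuousOn h (Set.Ioi 0)) {p : ℝ} (hp : 0 < p)
    (hhp : DifferentiableAt ℝ h p) {v : H}
    (h1 : modularResolvent A Ω v = ((1 / (1 + p) : ℝ) : ℂ) • v) : IsModularFun A Ω h v (h p • v) := by
  have hpos : ∀ x ∈ Set.Ioi (0 : ℝ), 1 + x ≠ 0 := fun x hx => by
    have : 0 < x := hx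
    positivity
  have hd : HasDerivAt (fun x : ℝ => ((1 / (1 + x) : ℝ) : ℂ)) ((-1 / (1 + p) ^ 2 : ℝ) : ℂ) p := by
    have := ((hasDerivAt_id p).const_add 1).inv (hpos p hp)
    simpa [one_div] using this.ofReal_comp
  refine eigenvector (g := fun x => ((1 / (1 + x) : ℝ) : ℂ))
    (Complex.continuous_ofReal.comp_continuousOn (by fun_prop (disch := assumption))) hh hp
    hd.differentiableAt hhp (fun x hx hne he => hne ?_) ?_ (h1 ▸ isModularFun_resolvent v)
  · have he' : 1 / (1 + x) = 1 / (1 + p) := by exact_mod_cast he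
    rw [one_div, one_div, inv_inj] at he'
    linarith
  · rw [hd.deriv]
    have := hpos p hp
    exact_mod_cast div_ne_zero (by norm_num) (pow_ne_zero 2 this)

lemma eigenvector_of_log {h : ℝ → ℂ} (hh : ContinuousOn h (Set.Ioi 0)) {p : ℝ} (hp : 0 < p)
    (hhp : DifferentiableAt ℝ h p) {v : H}
    (h1 : IsModularHamiltonian A Ω v (((-Real.log p : ℝ) : ℂ) • v)) :
    IsModularFun A Ω h v (h p • v) := by
  have hd : HasDerivAt (fun x : ℝ => ((-Real.log x : ℝ) : ℂ)) ((-p⁻¹ : ℝ) : ℂ) p :=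
    (Real.hasDerivAt_log hp.ne').neg.ofReal_comp
  refine eigenvector (g := fun x => ((-Real.log x : ℝ) : ℂ))
    (Complex.continuous_ofReal.comp_continuousOn
      (Real.continuousOn_log.mono fun x hx => ne_of_gt hx).neg) hh hp
    hd.differentiableAt hhp (fun x hx hne he => hne ?_) ?_ h1
  · have he' : -Real.log x = -Real.log p := by exact_mod_cast he
    exact Real.log_injOn_pos hx hp (neg_injective he')
  · rw [hd.deriv]
    exact_mod_cast neg_ne_zero.2 (inv_ne_zero hp.ne')

end IsModularFun

lemma differentiableAt_ofReal_cpow (z : ℂ) {p : ℝ} (hp : 0 < p) :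
    DifferentiableAt ℝ (fun x : ℝ => (x : ℂ) ^ z) p := by
  by_cases hz : z = 0
  · simp [hz]
  · exact (hasDerivAt_ofReal_cpow_const hp.ne' hz).differentiableAt

lemma one_mem_tomitaGraph (A : VonNeumannAlgebra H) (Ω : H) : (Ω, Ω) ∈ tomitaGraph A Ω := by
  simpa using mem_tomitaGraph_of_mem Ω (one_mem A)

/-- `SΩ = FΩ = Ω`, so `ΔΩ = Ω`; the constant is kept as `1 / (1 + 1)` to match the resolvent symbol
at the eigenvalue `1`. -/
lemma modularResolvent_vacuum (hΩ : IsStandardVector A Ω) :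
    modularResolvent A Ω Ω = ((1 / (1 + 1) : ℝ) : ℂ) • Ω := by
  refine modularResolvent_eq_of_isModularImage ((isModularImage_iff hΩ).2
    ⟨((1 / (1 + 1) : ℝ) : ℂ) • Ω, ?_, ?_⟩)
  · simpa using tomitaGraph_smul ((1 / (1 + 1) : ℝ) : ℂ) (one_mem_tomitaGraph A Ω)
  · have h := tomitaGraph_smul ((1 / (1 + 1) : ℝ) : ℂ) (one_mem_tomitaGraph A.commutant Ω)
    have e : Ω - ((1 / (1 + 1) : ℝ) : ℂ) • Ω = ((1 / (1 + 1) : ℝ) : ℂ) • Ω := by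
      rw [sub_eq_iff_eq_add, ← add_smul]
      norm_num
    rw [e]
    simpa using h

/-- `h(Δ) Ω = h(1) Ω`. -/
lemma isModularFun_vacuum (hΩ : IsStandardVector A Ω) {h : ℝ → ℂ} (hh : ContinuousOn h (Set.Ioi 0))
    (h1 : DifferentiableAt ℝ h 1) : IsModularFun A Ω h Ω (h 1 • Ω) :=
  IsModularFun.eigenvector_of_resolvent hh one_pos h1 (modularResolvent_vacuum hΩ)

lemma isModularPow_vacuum (hΩ : IsStandardVector A Ω) (z : ℂ) : IsModularPow A Ω z Ω Ω := by
  have := isModularFun_vacuum hΩ (continuousOn_ofReal_cpow z) (differentiableAt_ofReal_cpow z one_pos)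
  simpa [IsModularPow] using this

lemma modularUnitary_vacuum (hΩ : IsStandardVector A Ω) (t : ℝ) : modularUnitary hΩ t Ω = Ω :=
  IsModularFun.unique hΩ (isModularPow_modularUnitary hΩ t Ω) (isModularPow_vacuum hΩ _)

lemma tendsto_zero_of_approx {α : Type*} {l : Filter α} {f : α → ℂ}
    (h : ∀ ε > 0, ∃ g : α → ℂ, Tendsto g l (𝓝 0) ∧ ∀ t, ‖f t - g t‖ ≤ ε) : Tendsto f l (𝓝 0) := by
  rw [Metric.tendsto_nhds]
  intro ε hε
  obtain ⟨g, hg, hfg⟩ := h (ε / 2) (half_pos hε)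
  filter_upwards [Metric.tendsto_nhds.1 hg (ε / 2) (half_pos hε)] with t ht
  rw [dist_zero_right] at ht ⊢
  calc ‖f t‖ = ‖(f t - g t) + g t‖ := by rw [sub_add_cancel]
    _ ≤ ‖f t - g t‖ + ‖g t‖ := norm_add_le _ _
    _ < ε := by linarith [hfg t]

/-- The vectors `ζ` whose correlations with the orbit of `ξ` decay. -/
noncomputable def decorrelatedSubspace (hΩ : IsStandardVector A Ω) (ξ : H) : Submodule ℂ H where
  carrier := {ζ | Tendsto (fun t : ℝ => ⟪ζ, modularUnitary hΩ t ξ⟫_ℂ) (cocompact ℝ) (𝓝 0)}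
  add_mem' hx hy := by
    simpa only [Set.mem_ofPred_eq, inner_add_left, add_zero] using Tendsto.add hx hy
  zero_mem' := by simp
  smul_mem' c x hx := by
    simpa only [Set.mem_ofPred_eq, inner_smul_left, mul_zero] using Tendsto.const_mul (conj c) hx

lemma isClosed_decorrelatedSubspace (hΩ : IsStandardVector A Ω) (ξ : H) :
    IsClosed (decorrelatedSubspace hΩ ξ : Set H) := by
  refine isClosed_of_closure_subset fun ζ hζ => tendsto_zero_of_approx fun ε hε => ?_
  obtain ⟨y, hy, hd⟩ := Metric.mem_closure_iff.1 hζ (ε / (‖ξ‖ + 1)) (by positivity)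
  refine ⟨_, hy, fun t => ?_⟩
  rw [← inner_sub_left]
  refine (norm_inner_le_norm _ _).trans ?_
  rw [norm_modularUnitary, ← dist_eq_norm]
  calc _ ≤ ε / (‖ξ‖ + 1) * (‖ξ‖ + 1) := by gcongr; linarith
    _ = ε := by field_simp

/-- The vectors whose orbits under the modular unitary group tend weakly to zero. -/
noncomputable def mixingSubspace (hΩ : IsStandardVector A Ω) : Submodule ℂ H where
  carrier := {ξ | ∀ ζ, Tendsto (fun t : ℝ => ⟪ζ, modularUnitary hΩ t ξ⟫_ℂ) (cocompact ℝ) (𝓝 0)}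
  add_mem' hx hy ζ := by
    simpa only [map_add, inner_add_right, add_zero] using Tendsto.add (hx ζ) (hy ζ)
  zero_mem' := by simp
  smul_mem' c x hx ζ := by
    simpa only [map_smul, inner_smul_right, mul_zero] using Tendsto.const_mul c (hx ζ)

variable {hΩ : IsStandardVector A Ω}

lemma isClosed_mixingSubspace : IsClosed (mixingSubspace hΩ : Set H) := by
  refine isClosed_of_closure_subset fun ξ hξ ζ => tendsto_zero_of_approx fun ε hε => ?_
  obtain ⟨y, hy, hd⟩ := Metric.mem_closure_iff.1 hξ (ε / (‖ζ‖ + 1)) (by positivity)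
  refine ⟨_, hy ζ, fun t => ?_⟩
  rw [← inner_sub_right, ← map_sub]
  refine (norm_inner_le_norm _ _).trans ?_
  rw [norm_modularUnitary, ← dist_eq_norm]
  calc _ ≤ (‖ζ‖ + 1) * (ε / (‖ζ‖ + 1)) := by gcongr; linarith
    _ = ε := by field_simp

lemma mem_mixingSubspace_of_dense {ξ : H} {D : Set H} (hD : Dense D)
    (h : ∀ ζ ∈ D, Tendsto (fun t : ℝ => ⟪ζ, modularUnitary hΩ t ξ⟫_ℂ) (cocompact ℝ) (𝓝 0)) :
    ξ ∈ mixingSubspace hΩ := fun ζ =>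
  (isClosed_decorrelatedSubspace hΩ ξ).closure_subset_iff.2 h (hD ζ)

/-- A vector is mixing as soon as its autocorrelation decays. -/
lemma mem_mixingSubspace_of_self {ξ : H}
    (h : Tendsto (fun t : ℝ => ⟪ξ, modularUnitary hΩ t ξ⟫_ℂ) (cocompact ℝ) (𝓝 0)) :
    ξ ∈ mixingSubspace hΩ := by
  set D := decorrelatedSubspace hΩ ξ with hD
  have hcl := isClosed_decorrelatedSubspace hΩ ξ
  have horb : ∀ s, modularUnitary hΩ s ξ ∈ D := fun s => by
    refine (h.comp (Homeomorph.subRight s).isClosedEmbedding.tendsto_cocompact).congr fun t => ?_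
    rw [inner_modularUnitary_left, ← modularUnitary_add, Function.comp_apply,
      Homeomorph.subRight_apply, neg_add_eq_sub]
  -- The orbit lies in `D`, so a vector orthogonal to `D` has identically zero correlation with it
  -- and belongs to `D` as well. This forces the complement to be trivial.
  have hle : Dᗮ ≤ D := fun ζ hζ => by
    have : ∀ t, ⟪ζ, modularUnitary hΩ t ξ⟫_ℂ = 0 := fun t => D.inner_left_of_mem_orthogonal (horb t) hζ
    change Tendsto _ _ _
    simp only [this]
    exact tendsto_const_nhds
  have : CompleteSpace D := hcl.completeSpace_coe
  have htop : D = ⊤ := by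
    rw [← Submodule.orthogonal_eq_bot_iff, eq_bot_iff]
    exact (le_inf hle le_rfl).trans D.inf_orthogonal_eq_bot.le
  intro ζ
  have : ζ ∈ D := htop ▸ Submodule.mem_top
  exact this

lemma mixingSubspace_map {ξ : H} (hξ : ξ ∈ mixingSubspace hΩ) {Q : H →L[ℂ] H}
    (hQ : ∀ t x, modularUnitary hΩ t (Q x) = Q (modularUnitary hΩ t x)) :
    Q ξ ∈ mixingSubspace hΩ := fun ζ => by
  refine (hξ (star Q ζ)).congr fun t => ?_
  rw [hQ, ContinuousLinearMap.inner_star_apply]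

/-- No boundedness of `h` is needed: the cutoffs of `η` are bounded functions of `Δ` applied to `ξ`,
which commute with the modular group, and the mixing subspace is closed. -/
lemma IsModularFun.mem_mixingSubspace {h : ℝ → ℂ} (hh : ContinuousOn h (Set.Ioi 0)) {ξ η : H}
    (h1 : IsModularFun A Ω h ξ η) (hξ : ξ ∈ mixingSubspace hΩ) : η ∈ mixingSubspace hΩ := by
  refine isClosed_mixingSubspace.mem_of_tendsto (tendsto_modularCutoff hΩ η)
    (Eventually.of_forall fun n => ?_)
  have hn := isCc_modularCutoff n
  change _ ∈ mixingSubspace hΩ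
  rw [← h1.apply hn]
  exact mixingSubspace_map hξ fun t x => (modularCc_modularUnitary hΩ t (hn.mul hh) x).symm

/-- Eigenvectors of the modular Hamiltonian are orthogonal to the mixing vectors. -/
lemma inner_eq_zero_of_mem_mixingSubspace {l : ℝ} {v w : H}
    (hv : IsModularHamiltonian A Ω v ((l : ℂ) • v)) (hw : w ∈ mixingSubspace hΩ) : ⟪w, v⟫_ℂ = 0 := by
  have hv' : IsModularHamiltonian A Ω v (((-Real.log (Real.exp (-l)) : ℝ) : ℂ) • v) := by
    rwa [Real.log_exp, neg_neg]
  have h1 : ∀ t : ℝ, ‖⟪v, modularUnitary hΩ t w⟫_ℂ‖ = ‖⟪w, v⟫_ℂ‖ := by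
    intro t
    have h2 := IsModularFun.unique hΩ (isModularPow_modularUnitary hΩ (-t) v)
      (IsModularFun.eigenvector_of_log (continuousOn_ofReal_cpow _) (Real.exp_pos _)
        (differentiableAt_ofReal_cpow _ (Real.exp_pos _)) hv')
    rw [← neg_neg t, ← inner_modularUnitary_left, h2, inner_smul_left, norm_mul, RCLike.norm_conj,
      norm_ofReal_cpow (Real.exp_pos _), norm_inner_symm]
    simp
  have h2 := (hw v).norm
  simp only [h1, norm_zero] at h2
  exact norm_eq_zero.1 (tendsto_nhds_unique tendsto_const_nhds h2)

end Mixing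

/-! ### Fluctuations around the expectation value -/

section VacuumState

variable {H : Type*} [NormedAddCommGroup H] [InnerProductSpace ℂ H]

/-- The fluctuation `a - ψ(a) 1`. -/
noncomputable def fluctuation (Ω : H) (a : H →L[ℂ] H) : H →L[ℂ] H := a - vacuumState Ω a • 1

lemma fluctuation_apply {Ω : H} (a : H →L[ℂ] H) (ξ : H) :
    fluctuation Ω a ξ = a ξ - vacuumState Ω a • ξ := rfl

lemma vacuumState_add (Ω : H) (a b : H →L[ℂ] H) :
    vacuumState Ω (a + b) = vacuumState Ω a + vacuumState Ω b := inner_add_right _ _ _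

lemma vacuumState_smul (Ω : H) (c : ℂ) (a : H →L[ℂ] H) :
    vacuumState Ω (c • a) = c * vacuumState Ω a := inner_smul_right _ _ _

lemma fluctuation_add {Ω : H} (a b : H →L[ℂ] H) :
    fluctuation Ω (a + b) = fluctuation Ω a + fluctuation Ω b := by
  rw [fluctuation, fluctuation, fluctuation, vacuumState_add, add_smul]
  abel

lemma fluctuation_smul {Ω : H} (c : ℂ) (a : H →L[ℂ] H) :
    fluctuation Ω (c • a) = c • fluctuation Ω a := by
  rw [fluctuation, fluctuation, vacuumState_smul, mul_smul, smul_sub]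

end VacuumState

/-! ### Mixing operators through mixing vectors -/

section MixingSystem

variable {H : Type*} [NormedAddCommGroup H] [InnerProductSpace ℂ H] [CompleteSpace H]
  {A : VonNeumannAlgebra H} {Ω : H} {hΩ : IsStandardVector A Ω}

lemma fluctuation_mem {a : H →L[ℂ] H} (ha : a ∈ A) : fluctuation Ω a ∈ A :=
  sub_mem ha (A.smul_mem _ (one_mem A))

lemma vacuumState_star (Ω : H) (a : H →L[ℂ] H) :
    vacuumState Ω (star a) = conj (vacuumState Ω a) := by
  rw [vacuumState, vacuumState, inner_conj_symm, ContinuousLinearMap.inner_apply_star]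

lemma fluctuation_star (a : H →L[ℂ] H) : fluctuation Ω (star a) = star (fluctuation Ω a) := by
  rw [fluctuation, fluctuation, vacuumState_star, star_sub, star_smul, star_one]
  rfl

lemma inner_vacuum_self (hΩ : IsStandardVector A Ω) : ⟪Ω, Ω⟫_ℂ = 1 := by
  rw [inner_self_eq_norm_sq_to_K, hΩ.norm_eq_one]
  norm_num

lemma inner_vacuum_fluctuation (hΩ : IsStandardVector A Ω) (a : H →L[ℂ] H) : ⟪Ω, fluctuation Ω a Ω⟫_ℂ = 0 := by
  rw [fluctuation_apply, inner_sub_right, inner_smul_right, inner_vacuum_self hΩ, mul_one,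
    vacuumState, sub_self]

lemma isModularPow_half (hΩ : IsStandardVector A Ω) {a : H →L[ℂ] H} (ha : a ∈ A) :
    IsModularPow A Ω (1 / 2) (a Ω) (modularConjugation hΩ (star a Ω)) :=
  (isModularFun_sqrt hΩ (mem_tomitaGraph_of_mem Ω ha)).congr (by fun_prop)
    (continuousOn_ofReal_cpow _) fun x hx => by
      rw [Real.sqrt_eq_rpow, Complex.ofReal_cpow hx.le]
      norm_num

/-- Subtracting the scalar part of `b` removes exactly the disconnected part, since `Ω` is fixed by
`Δ^{1/2 + it}`. -/
lemma isModularCorrelator_iff {a b : H →L[ℂ] H} {d : H}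
    (hd : IsModularPow A Ω (1 / 2) (fluctuation Ω b Ω) d) {t : ℝ} {c : ℂ} :
    IsModularCorrelator A Ω a b t c ↔
      c - conj (vacuumState Ω a) * vacuumState Ω b = ⟪a Ω, modularUnitary hΩ t d⟫_ℂ := by
  have h1 : IsModularPow A Ω (1 / 2) (b Ω) (d + vacuumState Ω b • Ω) := by
    have := hd.add ((isModularPow_vacuum hΩ (1 / 2)).smul (vacuumState Ω b))
    rwa [fluctuation_apply, sub_add_cancel] at this
  have h2 := h1.comp (isModularPow_modularUnitary hΩ t _)
  rw [add_comm] at h2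
  have h3 : ⟪a Ω, modularUnitary hΩ t (d + vacuumState Ω b • Ω)⟫_ℂ =
      ⟪a Ω, modularUnitary hΩ t d⟫_ℂ + conj (vacuumState Ω a) * vacuumState Ω b := by
    rw [map_add, map_smul, modularUnitary_vacuum, inner_add_right, inner_smul_right, vacuumState,
      vacuumState, inner_conj_symm, mul_comm]
  rw [sub_eq_iff_eq_add, ← h3]
  refine ⟨?_, fun h => ⟨_, h2, h⟩⟩
  rintro ⟨η, hη, rfl⟩
  rw [IsModularFun.unique hΩ hη h2]

lemma clustersInModularTime_iff {a b : H →L[ℂ] H} {d : H}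
    (hd : IsModularPow A Ω (1 / 2) (fluctuation Ω b Ω) d) :
    ClustersInModularTime A Ω a b ↔
      Tendsto (fun t : ℝ => ⟪a Ω, modularUnitary hΩ t d⟫_ℂ) (cocompact ℝ) (𝓝 0) := by
  rw [cocompact_eq_atBot_atTop, tendsto_sup, and_comm]
  constructor
  · rintro ⟨f, hf, h1, h2⟩
    simp only [fun t => (isModularCorrelator_iff (hΩ := hΩ) hd).1 (hf t)] at h1 h2
    exact ⟨h1, h2⟩
  · rintro ⟨h1, h2⟩
    refine ⟨fun t => ⟪a Ω, modularUnitary hΩ t d⟫_ℂ + conj (vacuumState Ω a) * vacuumState Ω b,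
      fun t => (isModularCorrelator_iff (hΩ := hΩ) hd).2 (add_sub_cancel_right _ _), ?_, ?_⟩
    · simpa only [add_sub_cancel_right] using h1
    · simpa only [add_sub_cancel_right] using h2

lemma continuousOn_sqrt_ofReal : ContinuousOn (fun x : ℝ => (√x : ℂ)) (Set.Ioi 0) := by fun_prop

/-- Splitting `Δ^{1/2}` evenly gives `⟪ξ, U t Δ^{1/2} ξ⟫ = ⟪ξ₁, U t ξ₁⟫` with `ξ₁ = Δ^{1/4} ξ`,
which exists because `x^{1/4} ≤ 1 + √x`. Then `ξ₁` is mixing, and so is `ξ = Δ^{-1/4} ξ₁`. -/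
lemma mem_mixingSubspace_of_half {ξ d : H} (hd : IsModularPow A Ω (1 / 2) ξ d)
    (h : Tendsto (fun t : ℝ => ⟪ξ, modularUnitary hΩ t d⟫_ℂ) (cocompact ℝ) (𝓝 0)) :
    ξ ∈ mixingSubspace hΩ := by
  have hc := continuousOn_ofReal_cpow (1 / 4)
  have hd' := hd.congr (continuousOn_ofReal_cpow _) continuousOn_sqrt_ofReal fun x hx => by
    rw [Real.sqrt_eq_rpow, Complex.ofReal_cpow hx.le]
    norm_num
  obtain ⟨ξ₁, h1⟩ := hd'.exists_of_le hΩ Real.continuous_sqrt.continuousOn hc (C := 1)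
    (fun x _ => Real.sqrt_nonneg x) fun x hx => by
      rw [norm_ofReal_cpow hx, one_mul]
      have e : (1 / 4 : ℂ).re = 1 / 4 := by norm_num
      rw [e, Real.sqrt_eq_rpow]
      rcases le_total 1 x with h | h
      · have := Real.rpow_le_rpow_of_exponent_le h (by norm_num : (1 / 4 : ℝ) ≤ 1 / 2)
        linarith
      · have := Real.rpow_le_one hx.le h (by norm_num : (0 : ℝ) ≤ 1 / 4)
        have := Real.rpow_nonneg hx.le (1 / 2)
        linarith
  have h2 : IsModularFun A Ω (fun x => (x : ℂ) ^ (1 / 4 : ℂ)) ξ₁ d :=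
    h1.of_comp hc (hd.congr (continuousOn_ofReal_cpow _) (hc.mul hc) fun x hx => by
      rw [Pi.mul_apply, ← ofReal_cpow_add hx]
      norm_num)
  have h3 : ξ₁ ∈ mixingSubspace hΩ := mem_mixingSubspace_of_self (h.congr fun t => by
    refine (IsModularFun.inner_eq hΩ (h2.map hc fun φ hφ x => modularCc_modularUnitary hΩ t hφ x)
      (h1.congr hc (Complex.continuous_conj.comp_continuousOn hc) fun x hx => ?_)).symm
    rw [Function.comp_apply, conj_ofReal_cpow hx, map_div₀, map_one, map_ofNat])
  have hne : ∀ x : ℝ, 0 < x → (x : ℂ) ^ (1 / 4 : ℂ) ≠ 0 := fun x hx => by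
    simp [Complex.cpow_eq_zero_iff, hx.ne']
  exact (h1.symm hc hne).mem_mixingSubspace (hc.inv₀ hne) h3

/-- An operator is mixing if and only if its fluctuation maps the vacuum to a mixing vector. -/
theorem mem_maximalMixingSystem_iff (hΩ : IsStandardVector A Ω) {a : H →L[ℂ] H} :
    a ∈ maximalMixingSystem A Ω ↔ a ∈ A ∧ fluctuation Ω a Ω ∈ mixingSubspace hΩ := by
  refine and_congr_right fun ha => ?_
  have hd := isModularPow_half hΩ (fluctuation_mem (Ω := Ω) ha)
  rw [clustersInModularTime_iff (hΩ := hΩ) hd]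
  refine ⟨fun h => mem_mixingSubspace_of_half hd (h.congr fun t => ?_),
    fun h => hd.mem_mixingSubspace (continuousOn_ofReal_cpow _) h _⟩
  have e : ⟪Ω, modularUnitary hΩ t (modularConjugation hΩ (star (fluctuation Ω a) Ω))⟫_ℂ = 0 := by
    rw [← neg_neg t, ← inner_modularUnitary_left, modularUnitary_vacuum]
    have h1 : IsModularFun A Ω (fun x => conj ((x : ℂ) ^ (1 / 2 : ℂ))) Ω Ω :=
      (isModularPow_vacuum hΩ (1 / 2)).congr (continuousOn_ofReal_cpow _)
        (Complex.continuous_conj.comp_continuousOn (continuousOn_ofReal_cpow _)) fun x hx => by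
          rw [Function.comp_apply, conj_ofReal_cpow hx, map_div₀, map_one, map_ofNat]
    rw [← IsModularFun.inner_eq hΩ hd h1, inner_vacuum_fluctuation hΩ]
  rw [fluctuation_apply a, inner_sub_left, inner_smul_left, e, mul_zero, sub_zero]

theorem clustersInModularTime_of_mem (hΩ : IsStandardVector A Ω) {b : H →L[ℂ] H}
    (hb : b ∈ maximalMixingSystem A Ω) (a : H →L[ℂ] H) : ClustersInModularTime A Ω a b := by
  obtain ⟨hb, hb'⟩ := (mem_maximalMixingSystem_iff hΩ).1 hb
  have hd := isModularPow_half hΩ (fluctuation_mem (Ω := Ω) hb)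
  exact (clustersInModularTime_iff (hΩ := hΩ) hd).2
    (hd.mem_mixingSubspace (continuousOn_ofReal_cpow _) hb' _)

lemma modularFlow_vacuum (hΩ : IsStandardVector A Ω) (t : ℝ) (a : H →L[ℂ] H) :
    modularFlow hΩ t a Ω = modularUnitary hΩ t (a Ω) := by
  change modularUnitary hΩ t (a (modularUnitary hΩ (-t) Ω)) = _
  rw [modularUnitary_vacuum]

lemma isModularFlow_modularFlow (hΩ : IsStandardVector A Ω) (t : ℝ) (a : H →L[ℂ] H) :
    IsModularFlow A Ω t a (modularFlow hΩ t a) := fun ξ => by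
  refine ⟨modularUnitary hΩ (-t) ξ, ?_, isModularPow_modularUnitary hΩ t _⟩
  have := isModularPow_modularUnitary hΩ (-t) ξ
  rwa [Complex.ofReal_neg, mul_neg] at this

lemma star_modularFlow (hΩ : IsStandardVector A Ω) (t : ℝ) (a : H →L[ℂ] H) :
    star (modularFlow hΩ t a) = modularFlow hΩ t (star a) := by
  refine ContinuousLinearMap.ext fun x => ext_inner_left ℂ fun y => ?_
  rw [ContinuousLinearMap.inner_apply_star]
  change ⟪modularUnitary hΩ t (a (modularUnitary hΩ (-t) y)), x⟫_ℂ =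
    ⟪y, modularUnitary hΩ t (star a (modularUnitary hΩ (-t) x))⟫_ℂ
  rw [inner_modularUnitary_left, ← ContinuousLinearMap.inner_apply_star,
    inner_modularUnitary_left, neg_neg]

/-- The operator `S` is unbounded, so weak decay cannot be transported through it. It is tested
instead on the dense set `A'Ω`: the flowed operator lies in `A` by Tomita's theorem and commutes
with `b`, so `⟪bΩ, U t a*Ω⟫ = conj ⟪b*Ω, U t aΩ⟫`. -/
lemma star_mem_mixingSubspace {a : H →L[ℂ] H} (ha : a ∈ A) (h : a Ω ∈ mixingSubspace hΩ) :
    star a Ω ∈ mixingSubspace hΩ := by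
  refine mem_mixingSubspace_of_dense hΩ.commutant.cyclic ?_
  rintro _ ⟨b, hb, rfl⟩
  have h1 := (Complex.continuous_conj.tendsto 0).comp (h (star b Ω))
  rw [map_zero] at h1
  refine h1.congr fun t => ?_
  rw [Function.comp_apply, inner_conj_symm, ← modularFlow_vacuum, ← modularFlow_vacuum,
    ← star_modularFlow, ContinuousLinearMap.inner_apply_star, ContinuousLinearMap.inner_apply_star,
    VonNeumannAlgebra.commute_apply (modularFlow_mem hΩ t ha) hb]

lemma VonNeumannAlgebra.isClosed (A : VonNeumannAlgebra H) : IsClosed (A : Set (H →L[ℂ] H)) := by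
  rw [← A.commutant_commutant, VonNeumannAlgebra.coe_commutant]
  exact Set.isClosed_centralizer _

theorem isOperatorSystem_maximalMixingSystem (hΩ : IsStandardVector A Ω) :
    IsOperatorSystem (maximalMixingSystem A Ω) := by
  simp only [Set.ext fun a => mem_maximalMixingSystem_iff (a := a) hΩ]
  refine ⟨?_, ?_, ?_, ?_, ?_⟩
  · refine ⟨one_mem A, ?_⟩
    have : fluctuation Ω (1 : H →L[ℂ] H) Ω = 0 := by
      rw [fluctuation_apply, vacuumState, one_apply_eq_self, inner_vacuum_self hΩ, one_smul, sub_self]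
    rw [this]
    exact zero_mem _
  · rintro a ⟨ha, ha'⟩ b ⟨hb, hb'⟩
    refine ⟨add_mem ha hb, ?_⟩
    rw [fluctuation_add]
    exact add_mem ha' hb'
  · rintro c a ⟨ha, ha'⟩
    refine ⟨A.smul_mem c ha, ?_⟩
    rw [fluctuation_smul]
    exact Submodule.smul_mem _ c ha'
  · rintro a ⟨ha, ha'⟩
    refine ⟨star_mem ha, ?_⟩
    rw [fluctuation_star]
    exact star_mem_mixingSubspace (fluctuation_mem ha) ha'
  · refine A.isClosed.inter (isClosed_mixingSubspace.preimage (f := fun a => fluctuation Ω a Ω) ?_)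
    simp only [fluctuation_apply, vacuumState]
    fun_prop

theorem modularFlow_mem_maximalMixingSystem {a : H →L[ℂ] H} (ha : a ∈ maximalMixingSystem A Ω)
    (t : ℝ) : modularFlow hΩ t a ∈ maximalMixingSystem A Ω := by
  obtain ⟨ha, ha'⟩ := (mem_maximalMixingSystem_iff hΩ).1 ha
  refine (mem_maximalMixingSystem_iff hΩ).2 ⟨modularFlow_mem hΩ t ha, ?_⟩
  have h1 : vacuumState Ω (modularFlow hΩ t a) = vacuumState Ω a := by
    rw [vacuumState, modularFlow_vacuum, ← neg_neg t, ← inner_modularUnitary_left,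
      modularUnitary_vacuum, vacuumState]
  have : fluctuation Ω (modularFlow hΩ t a) Ω = modularUnitary hΩ t (fluctuation Ω a Ω) := by
    rw [fluctuation_apply, fluctuation_apply, h1, modularFlow_vacuum, map_sub, map_smul,
      modularUnitary_vacuum]
  rw [this]
  exact mixingSubspace_map ha' fun s x => by rw [← modularUnitary_add, add_comm, modularUnitary_add]

/-- The mixing operators are preserved by powers of the modular operator. -/
lemma mem_maximalMixingSystem_of_isModularPow (hΩ : IsStandardVector A Ω) {a b : H →L[ℂ] H}
    (ha : a ∈ maximalMixingSystem A Ω) (hb : b ∈ A) {z : ℂ} (h : IsModularPow A Ω z (a Ω) (b Ω)) :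
    b ∈ maximalMixingSystem A Ω := by
  obtain ⟨-, ha'⟩ := (mem_maximalMixingSystem_iff hΩ).1 ha
  have hc := continuousOn_ofReal_cpow z
  have h1 : IsModularFun A Ω (fun x => conj ((x : ℂ) ^ z)) Ω Ω :=
    (isModularPow_vacuum hΩ (conj z)).congr (continuousOn_ofReal_cpow _)
      (Complex.continuous_conj.comp_continuousOn hc) fun x hx => (conj_ofReal_cpow hx z).symm
  have h2 : vacuumState Ω a = vacuumState Ω b := IsModularFun.inner_eq hΩ h h1
  have h3 := h.sub ((isModularPow_vacuum hΩ z).smul (vacuumState Ω a))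
  refine (mem_maximalMixingSystem_iff hΩ).2 ⟨hb, h3.mem_mixingSubspace hc ha' |> fun h4 => ?_⟩
  rwa [h2] at h4

/-- Mixing operators are not countable sums of eigenoperators, except for the scalars. -/
theorem eq_smul_one_of_tendsto_eigenoperators (hΩ : IsStandardVector A Ω) {a : H →L[ℂ] H}
    (ha : a ∈ maximalMixingSystem A Ω) {l : ℕ → ℝ} {v : ℕ → H →L[ℂ] H}
    (hv : ∀ k, IsModularEigenoperator A Ω (l k) (v k))
    (h : ∀ ξ : H, Tendsto (fun n => ∑ k ∈ Finset.range n, ⟪ξ, v k Ω⟫_ℂ) atTop (𝓝 ⟪ξ, a Ω⟫_ℂ)) :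
    ∃ c : ℂ, a = c • 1 := by
  obtain ⟨haA, ha'⟩ := (mem_maximalMixingSystem_iff hΩ).1 ha
  -- The fluctuation vector is orthogonal to every eigenvector in the sum, hence to its weak limit;
  -- being orthogonal to `Ω` too, it is orthogonal to itself.
  have h1 : ⟪fluctuation Ω a Ω, a Ω⟫_ℂ = 0 := by
    have := h (fluctuation Ω a Ω)
    simp only [fun k => inner_eq_zero_of_mem_mixingSubspace (hv k).2 ha', Finset.sum_const_zero] at this
    exact tendsto_nhds_unique this tendsto_const_nhds
  have h2 : ⟪fluctuation Ω a Ω, fluctuation Ω a Ω⟫_ℂ = 0 := by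
    have h3 : ⟪fluctuation Ω a Ω, Ω⟫_ℂ = 0 := inner_eq_zero_symm.1 (inner_vacuum_fluctuation hΩ a)
    nth_rw 2 [fluctuation_apply]
    rw [inner_sub_right, h1, inner_smul_right, h3, mul_zero, sub_zero]
  have h3 := hΩ.separating _ (fluctuation_mem haA) (inner_self_eq_zero.1 h2)
  exact ⟨_, sub_eq_zero.1 h3⟩

end MixingSystem

/-! ### Continuation to complex times -/

section ComplexTimes

/-- A continuous function on the closed square which is holomorphic inside and vanishes on the
bottom side vanishes at the centre. -/
lemma Complex.eq_zero_of_vanish_on_side {g : ℂ → ℂ} {c : ℂ} {r : ℝ} (hr : 0 < r)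
    (hc : ContinuousOn g {w | |(w - c).re| ≤ r ∧ |(w - c).im| ≤ r})
    (hd : DifferentiableOn ℂ g {w | |(w - c).re| < r ∧ |(w - c).im| < r})
    (h0 : ∀ w, |(w - c).re| ≤ r → (w - c).im = -r → g w = 0) : g c = 0 := by
  let U : Set ℂ := {u | |u.re| < r ∧ |u.im| < r}
  let V : Set ℂ := {u | |u.re| ≤ r ∧ |u.im| ≤ r}
  -- The product over the four rotations about the centre vanishes on all sides of the square, so
  -- the maximum principle kills it. Its value at the centre is `g(c)^4`.
  let h : ℂ → ℂ := fun u => g (c + u) * g (c + Complex.I * u) * g (c + -u) * g (c + -(Complex.I * u))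
  have hre : Continuous fun u : ℂ => |u.re| := by fun_prop
  have him : Continuous fun u : ℂ => |u.im| := by fun_prop
  have hUo : IsOpen U := (isOpen_lt hre continuous_const).and (isOpen_lt him continuous_const)
  have hVc : IsClosed V := (isClosed_le hre continuous_const).and (isClosed_le him continuous_const)
  have hUV : closure U ⊆ V := closure_minimal (fun u hu => ⟨hu.1.le, hu.2.le⟩) hVc
  have hd1 : ∀ k : ℂ, (∀ u ∈ U, k * u ∈ U) → DifferentiableOn ℂ (fun u => g (c + k * u)) U :=
    fun k hk => hd.comp (by fun_prop) fun u hu => by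
      have := hk u hu
      simpa [U] using this
  have hc1 : ∀ k : ℂ, (∀ u ∈ V, k * u ∈ V) → ContinuousOn (fun u => g (c + k * u)) V :=
    fun k hk => hc.comp (by fun_prop) fun u hu => by
      have := hk u hu
      simpa [V] using this
  have e1 : h = fun u => g (c + 1 * u) * g (c + Complex.I * u) * g (c + (-1) * u) *
      g (c + (-Complex.I) * u) := by
    ext u
    simp [h]
  have hdc : DiffContOnCl ℂ h U := by
    rw [e1]
    constructor
    · refine (((hd1 1 ?_).mul (hd1 Complex.I ?_)).mul (hd1 (-1) ?_)).mul (hd1 (-Complex.I) ?_) <;>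
      · rintro u ⟨h1, h2⟩
        simp [U, h1, h2]
    · refine ContinuousOn.mono ?_ hUV
      refine (((hc1 1 ?_).mul (hc1 Complex.I ?_)).mul (hc1 (-1) ?_)).mul (hc1 (-Complex.I) ?_) <;>
      · rintro u ⟨h1, h2⟩
        simp [V, h1, h2]
  have hb : Bornology.IsBounded U := by
    refine Metric.isBounded_closedBall (x := (0 : ℂ)) (r := r + r) |>.subset fun u hu => ?_
    rw [mem_closedBall_zero_iff]
    exact (Complex.norm_le_abs_re_add_abs_im u).trans (add_le_add hu.1.le hu.2.le)
  have hfr : ∀ u ∈ frontier U, ‖h u‖ ≤ 0 := by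
    intro u hu
    rw [hUo.frontier_eq] at hu
    obtain ⟨⟨h1, h2⟩, h3⟩ : u ∈ V ∧ u ∉ U := ⟨hUV hu.1, hu.2⟩
    have h4 : |u.re| = r ∨ |u.im| = r := by
      by_contra! h5
      exact h3 ⟨lt_of_le_of_ne h1 h5.1, lt_of_le_of_ne h2 h5.2⟩
    rw [norm_le_zero_iff]
    rcases h4 with h4 | h4
    · rcases eq_or_eq_neg_of_abs_eq h4 with h5 | h5
      · have := h0 (c + -(Complex.I * u)) (by simpa using h2) (by simp [h5])
        simp only [h, this, mul_zero]
      · have := h0 (c + Complex.I * u) (by simpa using h2) (by simp [h5])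
        simp only [h, this, mul_zero, zero_mul]
    · rcases eq_or_eq_neg_of_abs_eq h4 with h5 | h5
      · have := h0 (c + -u) (by simpa using h1) (by simp [h5])
        simp only [h, this, mul_zero, zero_mul]
      · have := h0 (c + u) (by simpa using h1) (by simp [h5])
        simp only [h, this, zero_mul]
  have h0U : (0 : ℂ) ∈ closure U := subset_closure (by simp [U, hr])
  have := Complex.norm_le_of_forall_mem_frontier_norm_le hb hdc hfr h0U
  rw [norm_le_zero_iff] at this
  simpa [h] using this

/-- Uniqueness of the continuation from the boundary of a strip. -/
lemma Complex.eq_zero_of_strip_of_pos {g : ℂ → ℂ} {y : ℝ} (hy : 0 < y)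
    (hc : ContinuousOn g {w | w.im ∈ Set.Icc 0 y})
    (hd : DifferentiableOn ℂ g {w | w.im ∈ Set.Ioo 0 y})
    (h0 : ∀ t : ℝ, g t = 0) {z : ℂ} (hz : z.im ∈ Set.Icc 0 y) : g z = 0 := by
  set S : Set ℂ := {w | w.im ∈ Set.Ioo 0 y} with hS
  have hSo : IsOpen S := isOpen_Ioo.preimage Complex.continuous_im
  -- For such `c` the square with half-side `c.im` stands on the real line and fits in the strip.
  -- The identity theorem then covers the rest of the open strip, and continuity its boundary.
  have h1 : ∀ c : ℂ, 0 < c.im → c.im < y / 2 → g c = 0 := by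
    intro c hc1 hc2
    refine Complex.eq_zero_of_vanish_on_side (r := c.im) hc1 (hc.mono ?_) (hd.mono ?_) ?_
    · rintro w ⟨-, hw⟩
      rw [Complex.sub_im, abs_le] at hw
      exact ⟨by linarith [hw.1], by linarith [hw.2]⟩
    · rintro w ⟨-, hw⟩
      rw [Complex.sub_im, abs_lt] at hw
      exact ⟨by linarith [hw.1], by linarith [hw.2]⟩
    · intro w _ hw
      have him : w.im = 0 := by
        rw [Complex.sub_im] at hw
        linarith
      have hw' : w = (w.re : ℂ) := Complex.ext (by simp) (by simp [him])
      rw [hw', h0]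
  have hconv : Convex ℝ S := (convex_Ioo 0 y).linear_preimage Complex.imLm
  have h2 : Set.EqOn g 0 S := by
    have hp : Complex.I * (y / 4 : ℝ) ∈ S := by
      simp only [hS, Set.mem_ofPred_eq, Complex.mul_im, Complex.I_re, Complex.I_im, Complex.ofReal_re,
        Complex.ofReal_im, Set.mem_Ioo]
      constructor <;> linarith
    refine (hd.analyticOnNhd hSo).eqOn_zero_of_preconnected_of_eventuallyEq_zero
      hconv.isPreconnected hp ?_
    have ho : IsOpen {w : ℂ | w.im ∈ Set.Ioo 0 (y / 2)} := isOpen_Ioo.preimage Complex.continuous_im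
    refine (ho.eventually_mem ?_).mono fun w hw => h1 w hw.1 hw.2
    simp only [Set.mem_ofPred_eq, Complex.mul_im, Complex.I_re, Complex.I_im, Complex.ofReal_re,
      Complex.ofReal_im, Set.mem_Ioo]
    constructor <;> linarith
  have h3 : {w : ℂ | w.im ∈ Set.Icc 0 y} ⊆ closure S := by
    have := Complex.closure_preimage_im (Set.Ioo 0 y)
    rw [closure_Ioo hy.ne] at this
    exact this.ge
  have h4 : Set.EqOn g 0 {w | w.im ∈ Set.Icc 0 y} :=
    h2.of_subset_closure hc continuousOn_const
      (fun w hw => ⟨hw.1.le, hw.2.le⟩) h3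
  exact h4 hz

lemma Complex.eq_zero_of_strip {g : ℂ → ℂ} {y : ℝ} (hy : y ≠ 0)
    (hc : ContinuousOn g {w | w.im ∈ Set.uIcc 0 y})
    (hd : DifferentiableOn ℂ g {w | w.im ∈ Set.uIoo 0 y})
    (h0 : ∀ t : ℝ, g t = 0) {z : ℂ} (hz : z.im ∈ Set.uIcc 0 y) : g z = 0 := by
  rcases lt_or_gt_of_ne hy with hy | hy
  · rw [Set.uIcc_of_ge hy.le] at hc hz
    rw [Set.uIoo_of_ge hy.le] at hd
    have h1 : ContinuousOn (fun w => g (-w)) {w | w.im ∈ Set.Icc 0 (-y)} :=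
      hc.comp (by fun_prop) fun w hw => by
        rw [Set.mem_ofPred_eq, Complex.neg_im]
        exact ⟨by linarith [hw.2], by linarith [hw.1]⟩
    have h2 : DifferentiableOn ℂ (fun w => g (-w)) {w | w.im ∈ Set.Ioo 0 (-y)} :=
      hd.comp (by fun_prop) fun w hw => by
        rw [Set.mem_ofPred_eq, Complex.neg_im]
        exact ⟨by linarith [hw.2], by linarith [hw.1]⟩
    have := Complex.eq_zero_of_strip_of_pos (neg_pos.2 hy) h1 h2
      (fun t => by rw [← Complex.ofReal_neg, h0]) (z := -z)
      (by rw [Complex.neg_im]; exact ⟨by linarith [hz.2], by linarith [hz.1]⟩)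
    rwa [neg_neg] at this
  · rw [Set.uIcc_of_le hy.le] at hc hz
    rw [Set.uIoo_of_le hy.le] at hd
    exact Complex.eq_zero_of_strip_of_pos hy hc hd h0 hz

variable {H : Type*} [NormedAddCommGroup H] [InnerProductSpace ℂ H] [CompleteSpace H]
  {A : VonNeumannAlgebra H} {Ω : H}

lemma IsModularFlow.isModularPow (hΩ : IsStandardVector A Ω) {a b : H →L[ℂ] H} {t : ℝ}
    (h : IsModularFlow A Ω t a b) : IsModularPow A Ω (Complex.I * t) (a Ω) (b Ω) := by
  obtain ⟨η, h1, h2⟩ := h Ω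
  rwa [IsModularFun.unique hΩ h1 (isModularPow_vacuum hΩ _)] at h2

/-- After applying `φ(Δ)`, both `Δ^{iw} aΩ` and `F(w)Ω` are weakly analytic in the strip and agree
on the real line, so they agree up to the far boundary. -/
lemma IsComplexModularFlow.isModularPow (hΩ : IsStandardVector A Ω) {a b : H →L[ℂ] H} {z : ℂ}
    (h : IsComplexModularFlow A Ω z a b) : IsModularPow A Ω (Complex.I * z) (a Ω) (b Ω) := by
  obtain ⟨F, -, hc, hd, h0, rfl⟩ := h
  by_cases hz : z.im = 0
  · have hz' : z = (z.re : ℂ) := Complex.ext (by simp) (by simp [hz])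
    rw [hz']
    exact (h0 z.re).isModularPow hΩ
  refine isModularFun_of_forall fun φ hφ => ext_inner_left ℂ fun ζ => ?_
  let D : ℂ → ℂ := fun w => ⟪ζ, modularCc A Ω (fun x => φ x * (x : ℂ) ^ (Complex.I * w)) (a Ω)⟫_ℂ
  have hD : Differentiable ℂ D := by
    have h1 : Differentiable ℂ fun w : ℂ => modularCc A Ω fun x => φ x * (x : ℂ) ^ (Complex.I * w) :=
      (differentiable_modularCc_cpow A Ω hφ).comp (by fun_prop : Differentiable ℂ fun w : ℂ => Complex.I * w)
    exact (innerSL ℂ ζ).differentiable.comp (h1.clm_apply (differentiable_const (a Ω)))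
  have e : ∀ w, ⟪ζ, modularCc A Ω φ (F w Ω)⟫_ℂ = ⟪star (modularCc A Ω φ) ζ, F w Ω⟫_ℂ := fun w =>
    (ContinuousLinearMap.inner_star_apply _ _ _).symm
  refine sub_eq_zero.1 (Complex.eq_zero_of_strip (g := fun w => D w - ⟪ζ, modularCc A Ω φ (F w Ω)⟫_ℂ)
    hz ?_ ?_ (fun t => ?_) Set.right_mem_uIcc)
  · simp only [e]
    exact hD.continuous.continuousOn.sub (hc _ _)
  · simp only [e]
    exact hD.differentiableOn.sub (hd _ _)
  · rw [sub_eq_zero, ← ((h0 t).isModularPow hΩ).apply hφ]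

/-- The functions `x ^ (1/2 + i w) / (1 + √x)²`. -/
noncomputable def correlatorSymbol (w : ℂ) (x : ℝ) : ℂ :=
  (((1 + √x) ^ 2 : ℝ) : ℂ)⁻¹ * (x : ℂ) ^ (1 / 2 + Complex.I * w)

lemma correlatorSymbol_eq (w : ℂ) {x : ℝ} (hx : 0 < x) :
    correlatorSymbol w x =
      ((((1 + √x) ^ 2 : ℝ) : ℂ)⁻¹ * (x : ℂ) ^ (1 / 2 : ℂ)) * (x : ℂ) ^ (Complex.I * w) := by
  rw [correlatorSymbol, ofReal_cpow_add hx, mul_assoc]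

lemma continuousOn_inv_one_add_sqrt_sq :
    ContinuousOn (fun x : ℝ => (((1 + √x) ^ 2 : ℝ) : ℂ)⁻¹) (Set.Ioi 0) := by
  refine ContinuousOn.inv₀ (by fun_prop) fun x _ => ?_
  have : (0 : ℝ) < (1 + √x) ^ 2 := by positivity
  exact_mod_cast this.ne'

lemma continuousOn_correlatorSymbol (w : ℂ) : ContinuousOn (correlatorSymbol w) (Set.Ioi 0) :=
  continuousOn_inv_one_add_sqrt_sq.mul (continuousOn_ofReal_cpow _)

lemma norm_correlatorSymbol_le {w : ℂ} (hw : |w.im| ≤ 1 / 2) {x : ℝ} (hx : 0 < x) :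
    ‖correlatorSymbol w x‖ ≤ 1 := by
  have h0 : (0 : ℝ) < (1 + √x) ^ 2 := by positivity
  rw [correlatorSymbol, norm_mul, norm_inv, Complex.norm_real, Real.norm_of_nonneg h0.le,
    norm_ofReal_cpow hx, inv_mul_le_iff₀ h0, mul_one]
  have e : (1 / 2 + Complex.I * w).re = 1 / 2 - w.im := by simp [sub_eq_add_neg]
  obtain ⟨h1, h2⟩ := abs_le.1 hw
  have hs := Real.sqrt_nonneg x
  have hs2 := Real.sq_sqrt hx.le
  rw [e]
  rcases le_total 1 x with h | h
  · calc x ^ (1 / 2 - w.im) ≤ x ^ (1 : ℝ) := Real.rpow_le_rpow_of_exponent_le h (by linarith)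
      _ = √x ^ 2 := by rw [Real.rpow_one, hs2]
      _ ≤ _ := by gcongr; linarith
  · calc x ^ (1 / 2 - w.im) ≤ 1 := Real.rpow_le_one hx.le h (by linarith)
      _ ≤ _ := one_le_pow₀ (by linarith)

/-- The functions `x ^ (1/2 + i w) / (1 + √x)²` of the modular operator. -/
lemma exists_correlatorSymbol (hΩ : IsStandardVector A Ω) : ∃ Q : ℂ → H →L[ℂ] H,
    ∀ w, |w.im| ≤ 1 / 2 → ∀ ξ, IsModularFun A Ω (correlatorSymbol w) ξ (Q w ξ) ∧ ‖Q w ξ‖ ≤ ‖ξ‖ := by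
  have : ∀ w : ℂ, ∃ Q : H →L[ℂ] H, |w.im| ≤ 1 / 2 →
      ∀ ξ, IsModularFun A Ω (correlatorSymbol w) ξ (Q ξ) ∧ ‖Q ξ‖ ≤ ‖ξ‖ := by
    intro w
    by_cases hw : |w.im| ≤ 1 / 2
    · obtain ⟨Q, h1, h2⟩ := exists_isModularFun_of_bounded hΩ (continuousOn_correlatorSymbol w) (C := 1)
        fun x hx => norm_correlatorSymbol_le hw hx
      exact ⟨Q, fun _ ξ => ⟨h1 ξ, by simpa using h2 ξ⟩⟩
    · exact ⟨0, fun h => absurd h hw⟩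
  choose Q hQ using this
  exact ⟨Q, hQ⟩

lemma differentiableOn_inner_correlatorSymbol (hΩ : IsStandardVector A Ω) {Q : ℂ → H →L[ℂ] H}
    (hQ : ∀ w, |w.im| ≤ 1 / 2 → ∀ ξ, IsModularFun A Ω (correlatorSymbol w) ξ (Q w ξ) ∧ ‖Q w ξ‖ ≤ ‖ξ‖)
    (x y : H) : DifferentiableOn ℂ (fun w => ⟪x, Q w y⟫_ℂ) {w | |w.im| < 1 / 2} := by
  -- Cut-off symbols give entire functions of `w`. They converge uniformly on the strip, because the
  -- operators `Q w` are contractions there and the cutoff acts only on `y`.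
  let φ : ℕ → ℝ → ℂ := fun n r => modularCutoff n r * ((((1 + √r) ^ 2 : ℝ) : ℂ)⁻¹ * (r : ℂ) ^ (1 / 2 : ℂ))
  have hφ : ∀ n, IsCc (φ n) := fun n => (isCc_modularCutoff n).mul
    (continuousOn_inv_one_add_sqrt_sq.mul (continuousOn_ofReal_cpow _))
  let F : ℕ → ℂ → ℂ := fun n w =>
    ⟪x, modularCc A Ω (fun r => φ n r * (r : ℂ) ^ (Complex.I * w)) y⟫_ℂ
  have hF : ∀ n, Differentiable ℂ (F n) := fun n => by
    have h1 : Differentiable ℂ fun w : ℂ => modularCc A Ω fun r => φ n r * (r : ℂ) ^ (Complex.I * w) :=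
      (differentiable_modularCc_cpow A Ω (hφ n)).comp
        (by fun_prop : Differentiable ℂ fun w : ℂ => Complex.I * w)
    exact (innerSL ℂ x).differentiable.comp (h1.clm_apply (differentiable_const y))
  have hFQ : ∀ n w, |w.im| ≤ 1 / 2 → F n w = ⟪x, Q w (modularCc A Ω (modularCutoff n) y)⟫_ℂ := by
    intro n w hw
    have hn := isCc_modularCutoff n
    have h1 := ((hQ w hw _).1).unique hΩ (IsModularFun.cc (continuousOn_correlatorSymbol w) hn y)
    rw [h1]
    have h2 : modularCc A Ω (fun r => φ n r * (r : ℂ) ^ (Complex.I * w)) =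
        modularCc A Ω (fun r => modularCutoff n r * correlatorSymbol w r) :=
      modularCc_congr ((hφ n).mul (continuousOn_ofReal_cpow _))
        (hn.mul (continuousOn_correlatorSymbol w)) fun r hr => by
          rw [correlatorSymbol_eq w hr, ← mul_assoc]
    exact congrArg (fun T : H →L[ℂ] H => ⟪x, T y⟫_ℂ) h2
  have hU : TendstoUniformlyOn F (fun w => ⟪x, Q w y⟫_ℂ) atTop {w | |w.im| < 1 / 2} := by
    rw [Metric.tendstoUniformlyOn_iff]
    intro ε hε
    have h1 := (tendsto_iff_norm_sub_tendsto_zero.1 (tendsto_modularCutoff hΩ y)).eventually_lt_const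
      (show 0 < ε / (‖x‖ + 1) by positivity)
    filter_upwards [h1] with n hn w hw
    have hw' : |w.im| ≤ 1 / 2 := le_of_lt hw
    rw [dist_comm, dist_eq_norm, hFQ n w hw', ← inner_sub_right, ← map_sub]
    calc _ ≤ ‖x‖ * ‖Q w (modularCc A Ω (modularCutoff n) y - y)‖ := norm_inner_le_norm _ _
      _ ≤ ‖x‖ * ‖modularCc A Ω (modularCutoff n) y - y‖ := by gcongr; exact (hQ w hw' _).2
      _ ≤ (‖x‖ + 1) * ‖modularCc A Ω (modularCutoff n) y - y‖ := by gcongr; linarith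
      _ < (‖x‖ + 1) * (ε / (‖x‖ + 1)) := by gcongr
      _ = ε := by field_simp
  exact hU.tendstoLocallyUniformlyOn.differentiableOn
    (Eventually.of_forall fun n => (hF n).differentiableOn)
    (isOpen_lt (by fun_prop) continuous_const)

/-- Correlators of mixing operators continue to complex times, and cluster there. -/
theorem exists_continuation_of_mem (hΩ : IsStandardVector A Ω) {a b : H →L[ℂ] H} (ha : a ∈ A)
    (hb : b ∈ maximalMixingSystem A Ω) : ∃ F : ℂ → ℂ, DifferentiableOn ℂ F {z | |z.im| < 1 / 2} ∧
      (∀ t : ℝ, IsModularCorrelator A Ω a b t (F t)) ∧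
      ∀ z : ℂ, |z.im| < 1 / 2 → Tendsto (fun s : ℝ => F (s + z)) (cocompact ℝ)
        (𝓝 (conj (vacuumState Ω a) * vacuumState Ω b)) := by
  obtain ⟨hbA, hb'⟩ := (mem_maximalMixingSystem_iff hΩ).1 hb
  obtain ⟨Q, hQ⟩ := exists_correlatorSymbol hΩ
  let h : ℝ → ℂ := fun x => 1 + (√x : ℂ)
  have hh : ContinuousOn h (Set.Ioi 0) := continuousOn_const.add continuousOn_sqrt_ofReal
  have hconj : ∀ x, conj (h x) = h x := fun x => by simp [h]
  -- Both vectors lie in the domain of `1 + Δ^{1/2}`. Placing one such factor on each side of the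
  -- correlator leaves the bounded function `Q w` between them.
  have hdom : ∀ {c : H →L[ℂ] H}, c ∈ A → ∃ c₁, IsModularFun A Ω h (c Ω) c₁ := fun hc =>
    ⟨_, (IsModularFun.one _).fun_add continuousOn_const continuousOn_sqrt_ofReal
      (isModularFun_sqrt hΩ (mem_tomitaGraph_of_mem Ω hc))⟩
  obtain ⟨a₁, ha₁⟩ := hdom ha
  obtain ⟨b₁, hb₁⟩ := hdom hbA
  have ha₁' : IsModularFun A Ω (fun x => conj (h x)) (a Ω) a₁ := by simpa only [hconj] using ha₁
  have hsq : DifferentiableAt ℝ (fun x : ℝ => (√x : ℂ)) 1 :=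
    (Real.hasDerivAt_sqrt one_ne_zero).ofReal_comp.differentiableAt
  have hd : DifferentiableAt ℝ h 1 := hsq.const_add 1
  refine ⟨fun w => ⟪a₁, Q w b₁⟫_ℂ, differentiableOn_inner_correlatorSymbol hΩ hQ a₁ b₁,
    fun t => ?_, fun z hz => ?_⟩
  · have ht : |(t : ℂ).im| ≤ 1 / 2 := by simp
    have hp := (isModularPow_half hΩ hbA).comp (isModularPow_modularUnitary hΩ t _)
    rw [add_comm] at hp
    refine ⟨_, hp, IsModularFun.inner_eq hΩ ?_ ha₁'⟩
    have hq := continuousOn_correlatorSymbol t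
    refine (hb₁.comp hq (hQ t ht _).1).of_comp hh (hp.congr (continuousOn_ofReal_cpow _)
      (hh.mul (hq.mul hh)) fun x hx => ?_)
    have h1 : (0 : ℝ) < 1 + √x := by positivity
    have h2 : (1 + (√x : ℂ)) ≠ 0 := by exact_mod_cast h1.ne'
    change _ = (1 + (√x : ℂ)) * (correlatorSymbol t x * (1 + (√x : ℂ)))
    rw [correlatorSymbol]
    push_cast
    field_simp
  · have hz' : |z.im| ≤ 1 / 2 := hz.le
    have hq := continuousOn_correlatorSymbol z
    have hqd : DifferentiableAt ℝ (fun x => correlatorSymbol z x * h x) 1 := by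
      refine DifferentiableAt.mul (DifferentiableAt.mul ?_ (differentiableAt_ofReal_cpow _ one_pos)) hd
      have : DifferentiableAt ℝ (fun x : ℝ => ((1 + √x) ^ 2 : ℝ)) 1 :=
        ((Real.hasDerivAt_sqrt one_ne_zero).differentiableAt.const_add 1).pow 2
      exact (Complex.ofRealCLM.differentiableAt.comp 1 this).inv (by norm_num)
    have h1 : IsModularFun A Ω (fun x => correlatorSymbol z x * h x) (b Ω) (Q z b₁) :=
      hb₁.comp hq (hQ z hz' _).1
    have h2 := isModularFun_vacuum hΩ (hq.mul hh) hqd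
    -- The symbol is `1/4` and `1 + √x` is `2` at the eigenvalue `1` of `Ω`. This `1/2` cancels the
    -- factor `2` in `⟪a₁, Ω⟫`, leaving the product of expectation values as the limit.
    have e1 : correlatorSymbol z 1 * h 1 = 1 / 2 := by
      simp only [correlatorSymbol, h, Real.sqrt_one, Complex.ofReal_one, Complex.one_cpow]
      norm_num
    have e2 : h 1 = 2 := by
      simp only [h, Real.sqrt_one, Complex.ofReal_one]
      norm_num
    have h3 : Q z b₁ - vacuumState Ω b • (1 / 2 : ℂ) • Ω ∈ mixingSubspace hΩ := by
      have := h1.sub (h2.smul (vacuumState Ω b))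
      rw [Pi.mul_apply, e1] at this
      exact this.mem_mixingSubspace (hq.mul hh) hb'
    have h4 : ⟪a₁, Ω⟫_ℂ = 2 * conj (vacuumState Ω a) := by
      have := IsModularFun.inner_eq hΩ (isModularFun_vacuum hΩ hh hd) ha₁'
      rw [this, e2, inner_smul_right, vacuumState, inner_conj_symm]
    have h5 : ∀ s : ℝ, Q (s + z) b₁ = modularUnitary hΩ s (Q z b₁) := fun s => by
      have hs : |(s + z).im| ≤ 1 / 2 := by simpa using hz'
      refine (hQ _ hs _).1.unique hΩ ((IsModularFun.comp (continuousOn_ofReal_cpow _) (hQ z hz' _).1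
        (isModularPow_modularUnitary hΩ s _)).congr ((continuousOn_ofReal_cpow _).mul hq)
        (continuousOn_correlatorSymbol _) fun x hx => ?_)
      rw [Pi.mul_apply, correlatorSymbol_eq _ hx, correlatorSymbol_eq _ hx, mul_add,
        ofReal_cpow_add hx]
      ring
    have h6 := (h3 a₁).add_const (conj (vacuumState Ω a) * vacuumState Ω b)
    rw [zero_add] at h6
    refine h6.congr fun s => ?_
    simp only [h5]
    rw [ map_sub, map_smul, map_smul, modularUnitary_vacuum, inner_sub_right, inner_smul_right,
      inner_smul_right, h4]
    ring

end ComplexTimes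

/-! ### Thermal states and the operators `|E_m⟩⟨E_n|` -/

section Thermal

/-- A weakly convergent sequence of operators is bounded. -/
lemma ContinuousLinearMap.exists_norm_le_of_tendsto_inner {K : Type*} [NormedAddCommGroup K]
    [InnerProductSpace ℂ K] [CompleteSpace K] {s : ℕ → K →L[ℂ] K} {x : K →L[ℂ] K}
    (h : ∀ ξ η : K, Tendsto (fun N => ⟪ξ, s N η⟫_ℂ) atTop (𝓝 ⟪ξ, x η⟫_ℂ)) : ∃ C, ∀ N, ‖s N‖ ≤ C := by
  refine banach_steinhaus fun η => ?_
  obtain ⟨C, hC⟩ := banach_steinhaus (g := fun N => innerSL ℂ (s N η)) fun ξ => by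
    obtain ⟨C, hC⟩ := (h ξ η).norm.bddAbove_range
    refine ⟨C, fun N => ?_⟩
    rw [innerSL_apply_apply, norm_inner_symm]
    exact hC ⟨N, rfl⟩
  exact ⟨C, fun N => by simpa using hC N⟩

variable {H : Type*} [NormedAddCommGroup H] [InnerProductSpace ℂ H] [CompleteSpace H]
  {A : VonNeumannAlgebra H} {Ω : H}
  {K : Type*} [NormedAddCommGroup K] [InnerProductSpace ℂ K] [CompleteSpace K]
  {ι : Type*} {e : HilbertBasis ι ℂ K} {E : ι → ℝ} {β : ℝ}
  {π : (K →L[ℂ] K) →⋆ₐ[ℂ] (H →L[ℂ] H)}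

namespace IsThermalRepresentation

lemma mem (hπ : IsThermalRepresentation A Ω e E β π) (x : K →L[ℂ] K) : π x ∈ A := by
  have : π x ∈ (A : Set (H →L[ℂ] H)) := hπ.range_eq ▸ Set.mem_range_self x
  exact this

lemma exists_eq (hπ : IsThermalRepresentation A Ω e E β π) {a : H →L[ℂ] H} (ha : a ∈ A) :
    ∃ x, π x = a := by
  have : a ∈ Set.range π := hπ.range_eq ▸ ha
  exact this

lemma partition_ne_zero (hΩ : IsStandardVector A Ω) (hπ : IsThermalRepresentation A Ω e E β π) :
    (∑' n, (Real.exp (-β * E n) : ℂ)) ≠ 0 := by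
  intro h
  have h1 := hπ.state_eq 1
  rw [h, div_zero, map_one, vacuumState, one_apply_eq_self, inner_vacuum_self hΩ] at h1
  exact one_ne_zero h1

lemma vacuumState_mul_rankOne (hπ : IsThermalRepresentation A Ω e E β π) (x : K →L[ℂ] K) (m n : ι) :
    vacuumState Ω (π (x * InnerProductSpace.rankOne ℂ (e m) (e n))) =
      Real.exp (-β * E n) * ⟪e n, x (e m)⟫_ℂ / ∑' n, (Real.exp (-β * E n) : ℂ) := by
  rw [hπ.state_eq, tsum_eq_single n]
  · simp [e.orthonormal.1 n]
  · intro k hk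
    have : ⟪e n, e k⟫_ℂ = 0 := e.orthonormal.2 hk.symm
    simp [this]

lemma vacuumState_rankOne_mul (hπ : IsThermalRepresentation A Ω e E β π) (x : K →L[ℂ] K) (m n : ι) :
    vacuumState Ω (π (InnerProductSpace.rankOne ℂ (e m) (e n) * x)) =
      Real.exp (-β * E m) * ⟪e n, x (e m)⟫_ℂ / ∑' n, (Real.exp (-β * E n) : ℂ) := by
  rw [hπ.state_eq, tsum_eq_single m]
  · simp [e.orthonormal.1 m]
  · intro k hk
    have : ⟪e k, e m⟫_ℂ = 0 := e.orthonormal.2 hk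
    simp [this]

/-- The operators `|E_m⟩⟨E_n|` are eigenoperators of the modular Hamiltonian. -/
lemma isModularEigenoperator_rankOne
    (hπ : IsThermalRepresentation A Ω e E β π) (m n : ι) :
    IsModularEigenoperator A Ω (β * (E m - E n)) (π (InnerProductSpace.rankOne ℂ (e m) (e n))) := by
  refine ⟨hπ.mem _, ?_⟩
  set u : K →L[ℂ] K := InnerProductSpace.rankOne ℂ (e m) (e n) with hu
  have hu' : star u = InnerProductSpace.rankOne ℂ (e n) (e m) := by
    rw [ContinuousLinearMap.star_eq_adjoint, hu, InnerProductSpace.adjoint_rankOne]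
  set r : ℝ := Real.exp (-(β * (E m - E n))) with hr
  have hr0 : 0 < r := Real.exp_pos _
  have hrw : (r : ℂ) * Real.exp (-β * E n) = Real.exp (-β * E m) := by
    rw [← Complex.ofReal_mul, hr, ← Real.exp_add]
    congr 2
    ring
  -- The KMS relation on a matrix unit: moving `u*` from one side of `x` to the other exchanges the
  -- Boltzmann weights of levels `m` and `n`, whose ratio is `r`. This identifies `Δ π(u)Ω` as `r
  -- π(u)Ω`.
  have h1 : IsModularImage A Ω (π u Ω) ((r : ℂ) • π u Ω) := by
    refine ⟨star (π u) Ω, mem_tomitaGraph_of_mem Ω (hπ.mem u), fun p hp => ?_⟩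
    have hcl : IsClosed {p : H × H | ⟪(r : ℂ) • π u Ω, p.1⟫_ℂ = ⟪p.2, star (π u) Ω⟫_ℂ} :=
      isClosed_eq (by fun_prop) (by fun_prop)
    refine closure_minimal (t := {p : H × H | ⟪(r : ℂ) • π u Ω, p.1⟫_ℂ = ⟪p.2, star (π u) Ω⟫_ℂ})
      ?_ hcl hp
    rintro _ ⟨a, ha, rfl⟩
    obtain ⟨x, rfl⟩ := hπ.exists_eq ha
    have e1 : ⟪(r : ℂ) • π u Ω, π x Ω⟫_ℂ = r * vacuumState Ω (π (star u * x)) := by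
      rw [inner_smul_left, Complex.conj_ofReal, map_mul, map_star, vacuumState, mul_apply_eq_comp,
        ContinuousLinearMap.inner_apply_star]
    have e2 : ⟪star (π x) Ω, star (π u) Ω⟫_ℂ = vacuumState Ω (π (x * star u)) := by
      rw [ContinuousLinearMap.inner_star_apply, map_mul, map_star, vacuumState, mul_apply_eq_comp]
    change ⟪(r : ℂ) • π u Ω, π x Ω⟫_ℂ = ⟪star (π x) Ω, star (π u) Ω⟫_ℂ
    rw [e1, e2, hu', hπ.vacuumState_rankOne_mul, hπ.vacuumState_mul_rankOne, ← hrw]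
    ring
  have h2 : modularResolvent A Ω (π u Ω) = ((1 / (1 + r) : ℝ) : ℂ) • π u Ω := by
    have h3 : modularResolvent A Ω ((1 + r : ℂ) • π u Ω) = π u Ω :=
      modularResolvent_eq_of_isModularImage (by
        rwa [add_smul, one_smul, add_sub_cancel_left])
    have h4 : (1 + r : ℂ) ≠ 0 := by exact_mod_cast (by positivity : (1 + r : ℝ) ≠ 0)
    rw [map_smul] at h3
    conv_rhs => rw [← h3]
    rw [smul_smul]
    push_cast
    rw [one_div, inv_mul_cancel₀ h4, one_smul]
  have h5 := IsModularFun.eigenvector_of_resolvent (h := fun x => ((-Real.log x : ℝ) : ℂ))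
    (Complex.continuous_ofReal.comp_continuousOn
      (Real.continuousOn_log.mono fun x hx => ne_of_gt hx).neg) hr0
    (Real.hasDerivAt_log hr0.ne').neg.ofReal_comp.differentiableAt h2
  rwa [hr, Real.log_exp, neg_neg] at h5

/-- Every Boltzmann weight is nonzero, so the state evaluated on `x |E_m⟩⟨E_n|` detects each matrix
entry of `x`. -/
lemma faithful (hΩ : IsStandardVector A Ω) (hπ : IsThermalRepresentation A Ω e E β π) {x : K →L[ℂ] K}
    (hx : π x = 0) : x = 0 := by
  have h1 : ∀ m n, ⟪e n, x (e m)⟫_ℂ = 0 := by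
    intro m n
    have h := hπ.vacuumState_mul_rankOne x m n
    rw [map_mul, hx, zero_mul, vacuumState, zero_apply, inner_zero_right, eq_comm,
      div_eq_zero_iff, or_iff_left (hπ.partition_ne_zero hΩ), mul_eq_zero] at h
    exact h.resolve_left (by exact_mod_cast (Real.exp_pos _).ne')
  have h2 : ∀ m, x (e m) = 0 := fun m => e.repr.injective <| by
    ext n
    rw [e.repr_apply_apply, h1, map_zero]
    rfl
  refine ContinuousLinearMap.ext_on
    (Submodule.dense_iff_topologicalClosure_eq_top.2 e.dense_span) ?_
  rintro _ ⟨m, rfl⟩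
  exact h2 m

/-- A representation of a thermal state is weakly continuous along sequences. -/
lemma tendsto_inner (hΩ : IsStandardVector A Ω) (hπ : IsThermalRepresentation A Ω e E β π)
    {s : ℕ → K →L[ℂ] K} {x : K →L[ℂ] K}
    (h : ∀ ξ η : K, Tendsto (fun N => ⟪ξ, s N η⟫_ℂ) atTop (𝓝 ⟪ξ, x η⟫_ℂ)) (ξ : H) :
    Tendsto (fun N => ⟪ξ, π (s N) Ω⟫_ℂ) atTop (𝓝 ⟪ξ, π x Ω⟫_ℂ) := by
  obtain ⟨C, hC⟩ := ContinuousLinearMap.exists_norm_le_of_tendsto_inner h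
  have hC0 : 0 ≤ C := (norm_nonneg _).trans (hC 0)
  -- Against `π(y)Ω` the pairing is a Gibbs sum, where dominated convergence applies: weakly
  -- convergent sequences are bounded and the Boltzmann weights are summable. The same bound then
  -- extends convergence from this dense set to all `ξ`.
  have hdense : ∀ y : K →L[ℂ] K,
      Tendsto (fun N => ⟪π y Ω, π (s N) Ω⟫_ℂ) atTop (𝓝 ⟪π y Ω, π x Ω⟫_ℂ) := by
    intro y
    have e1 : ∀ z : K →L[ℂ] K, ⟪π y Ω, π z Ω⟫_ℂ =
        (∑' n, (Real.exp (-β * E n) : ℂ) * ⟪y (e n), z (e n)⟫_ℂ) /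
          ∑' n, (Real.exp (-β * E n) : ℂ) := by
      intro z
      have := hπ.state_eq (star y * z)
      rw [map_mul, map_star, vacuumState, mul_apply_eq_comp, ContinuousLinearMap.inner_apply_star] at this
      rw [this]
      simp only [mul_apply_eq_comp, ContinuousLinearMap.inner_apply_star]
    simp only [e1]
    refine Tendsto.div_const (tendsto_tsum_of_dominated_convergence
      (bound := fun n => Real.exp (-β * E n) * (‖y‖ * C)) (hπ.summable_boltzmann.mul_right _)
      (fun n => (h _ _).const_mul _) (Eventually.of_forall fun N n => ?_)) _
    rw [norm_mul, Complex.norm_real, Real.norm_of_nonneg (Real.exp_pos _).le]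
    gcongr
    have h1 := y.le_opNorm (e n)
    have h2 := (s N).le_of_opNorm_le (hC N) (e n)
    rw [e.orthonormal.1 n, mul_one] at h1 h2
    exact (norm_inner_le_norm _ _).trans (mul_le_mul h1 h2 (norm_nonneg _) (norm_nonneg _))
  rw [tendsto_iff_norm_sub_tendsto_zero, ← tendsto_zero_iff_norm_tendsto_zero]
  refine tendsto_zero_of_approx fun ε hε => ?_
  obtain ⟨_, ⟨a, ha, rfl⟩, hd⟩ := Metric.mem_closure_iff.1 (hΩ.cyclic ξ) (ε / (C + ‖π x‖ + 1))
    (by positivity)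
  obtain ⟨y, rfl⟩ := hπ.exists_eq ha
  refine ⟨fun N => ⟪π y Ω, π (s N) Ω⟫_ℂ - ⟪π y Ω, π x Ω⟫_ℂ, ?_, fun N => ?_⟩
  · simpa using (hdense y).sub_const ⟪π y Ω, π x Ω⟫_ℂ
  · beta_reduce
    rw [← inner_sub_right, ← inner_sub_right, ← inner_sub_left]
    refine (norm_inner_le_norm _ _).trans ?_
    have h1 : ‖π (s N) Ω - π x Ω‖ ≤ C + ‖π x‖ := by
      have h2 := (π (s N)).le_of_opNorm_le ((NonUnitalStarAlgHom.norm_apply_le π (s N)).trans (hC N)) Ω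
      have h3 := (π x).le_opNorm Ω
      rw [hΩ.norm_eq_one, mul_one] at h2 h3
      exact (norm_sub_le _ _).trans (add_le_add h2 h3)
    rw [← dist_eq_norm ξ]
    calc _ ≤ ε / (C + ‖π x‖ + 1) * (C + ‖π x‖ + 1) := by
          gcongr
          linarith
      _ = ε := by field_simp

theorem eq_smul_one (hΩ : IsStandardVector A Ω) (hπ : IsThermalRepresentation A Ω e E β π)
    {x : K →L[ℂ] K} {α : ℕ → ℂ} {m n : ℕ → ι}
    (h : ∀ ξ η : K, Tendsto
      (fun N => ∑ k ∈ Finset.range N,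
        ⟪ξ, (α k • InnerProductSpace.rankOne ℂ (e (m k)) (e (n k))) η⟫_ℂ) atTop (𝓝 ⟪ξ, x η⟫_ℂ))
    (hx : π x ∈ maximalMixingSystem A Ω) : ∃ c : ℂ, x = c • 1 := by
  let u : ℕ → K →L[ℂ] K := fun k => α k • InnerProductSpace.rankOne ℂ (e (m k)) (e (n k))
  have h1 : ∀ ξ η : K, Tendsto (fun N => ⟪ξ, (∑ k ∈ Finset.range N, u k) η⟫_ℂ) atTop (𝓝 ⟪ξ, x η⟫_ℂ) :=
    fun ξ η => (h ξ η).congr fun N => by rw [sum_apply, inner_sum]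
  obtain ⟨c, hc⟩ := eq_smul_one_of_tendsto_eigenoperators hΩ hx
    (l := fun k => β * (E (m k) - E (n k))) (v := fun k => π (u k)) (fun k => by
      obtain ⟨h2, h3⟩ := hπ.isModularEigenoperator_rankOne (m k) (n k)
      have e1 : π (u k) = α k • π (InnerProductSpace.rankOne ℂ (e (m k)) (e (n k))) := map_smul π _ _
      refine ⟨hπ.mem _, ?_⟩
      rw [e1]
      have := h3.smul (α k)
      rwa [smul_comm] at this)
    (fun ξ => (hπ.tendsto_inner hΩ h1 ξ).congr fun N => by rw [map_sum, sum_apply, inner_sum])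
  refine ⟨c, sub_eq_zero.1 (hπ.faithful hΩ ?_)⟩
  rw [map_sub, map_smul, map_one, hc, sub_self]

end IsThermalRepresentation

end Thermal
-- The structure theorem for mixing operators
theorem mainTheorem9 {H : Type*} [NormedAddCommGroup H] [InnerProductSpace ℂ H] [CompleteSpace H]
    (A : VonNeumannAlgebra H) (Ω : H) (hΩ : IsStandardVector A Ω) :
    -- the mixing operators form an operator system, in which any two operators are mixing
    (IsOperatorSystem (maximalMixingSystem A Ω) ∧
      ∀ a ∈ maximalMixingSystem A Ω, ∀ b ∈ maximalMixingSystem A Ω,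
        ClustersInModularTime A Ω a b) ∧
    -- closed under modular time evolution
    (∀ a ∈ maximalMixingSystem A Ω, ∀ t : ℝ,
      ∃ b ∈ maximalMixingSystem A Ω, IsModularFlow A Ω t a b) ∧
    -- closed under evolution to complex times
    (∀ a ∈ maximalMixingSystem A Ω, ∀ z : ℂ, |z.im| < 1 / 2 →
      ∀ b : H →L[ℂ] H, IsComplexModularFlow A Ω z a b → b ∈ maximalMixingSystem A Ω) ∧
    -- correlators continued to complex times exist and cluster
    (∀ a ∈ maximalMixingSystem A Ω, ∀ b ∈ maximalMixingSystem A Ω,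
      ∃ F : ℂ → ℂ, DifferentiableOn ℂ F {z | |z.im| < 1 / 2} ∧
        (∀ t : ℝ, IsModularCorrelator A Ω a b t (F t)) ∧
        ∀ z : ℂ, |z.im| < 1 / 2 →
          Tendsto (fun s : ℝ => F (s + z)) atTop
            (𝓝 (conj (vacuumState Ω a) * vacuumState Ω b)) ∧
          Tendsto (fun s : ℝ => F (s + z)) atBot
            (𝓝 (conj (vacuumState Ω a) * vacuumState Ω b))) ∧
    -- no non-scalar countable sum of eigenoperators of the modular Hamiltonian
    (∀ a ∈ maximalMixingSystem A Ω, ∀ (l : ℕ → ℝ) (v : ℕ → H →L[ℂ] H),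
      (∀ k, IsModularEigenoperator A Ω (l k) (v k)) →
      (∀ ξ : H, Tendsto (fun n => ∑ k ∈ Finset.range n, ⟪ξ, v k Ω⟫_ℂ) atTop (𝓝 ⟪ξ, a Ω⟫_ℂ)) →
      ∃ c : ℂ, a = c • 1) ∧
    -- the thermal case: no non-scalar countable sum of the operators `|E_m⟩⟨E_n|`
    (∀ {K : Type*} [NormedAddCommGroup K] [InnerProductSpace ℂ K] [CompleteSpace K]
      {ι : Type*} (e : HilbertBasis ι ℂ K) (E : ι → ℝ) (β : ℝ)
      (π : (K →L[ℂ] K) →⋆ₐ[ℂ] (H →L[ℂ] H)), IsThermalRepresentation A Ω e E β π →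
      ∀ (x : K →L[ℂ] K) (α : ℕ → ℂ) (m n : ℕ → ι),
        (∀ ξ η : K, Tendsto
          (fun N => ∑ k ∈ Finset.range N,
            ⟪ξ, (α k • InnerProductSpace.rankOne ℂ (e (m k)) (e (n k))) η⟫_ℂ)
          atTop (𝓝 ⟪ξ, x η⟫_ℂ)) →
        π x ∈ maximalMixingSystem A Ω → ∃ c : ℂ, x = c • 1) := by
  refine ⟨⟨isOperatorSystem_maximalMixingSystem hΩ,
      fun a _ b hb => clustersInModularTime_of_mem hΩ hb a⟩,
    fun a ha t => ⟨modularFlow hΩ t a, modularFlow_mem_maximalMixingSystem ha t,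
      isModularFlow_modularFlow hΩ t a⟩,
    fun a ha z _ b h => ?_, fun a ha b hb => ?_,
    fun a ha l v hv h => eq_smul_one_of_tendsto_eigenoperators hΩ ha hv h,
    fun e E β π hπ x α m n h hx => hπ.eq_smul_one hΩ h hx⟩
  · refine mem_maximalMixingSystem_of_isModularPow hΩ ha ?_ (h.isModularPow hΩ)
    obtain ⟨F, hF, -, -, -, rfl⟩ := h
    exact hF z Set.right_mem_uIcc
  · obtain ⟨F, h1, h2, h3⟩ := exists_continuation_of_mem hΩ ha.1 hb
    refine ⟨F, h1, h2, fun z hz => ?_⟩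
    have h4 := h3 z hz
    rw [cocompact_eq_atBot_atTop, tendsto_sup] at h4
    exact ⟨h4.2, h4.1⟩
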